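/- Throughout, computability is that of type-two computability theory. Names are elements of Baire space $\mathbb N^{\mathbb N}$; a representation of a set $S$ is a partial surjection $\delta:\subseteq\mathbb N^{\mathbb N}\to S$; a multivalued operation $f:\subseteq S\rightrightarrows T$ is $(\delta,\delta')$-computable if some computable partial function on Baire space maps every $\delta$-name of every $x\in\operatorname{dom} f$ to a $\delta'$-name of some element of $f(x)$; and $\delta\le\delta'$ means that $\delta$-names can be computably translated to $\delta'$-names of the same objects. $\langle p,q\rangle$ denotes pairing on Baire space, $\eta$ is the standard representation of the continuous partial functions $\subseteq\mathbb N^{\mathbb N}\to\mathbb N^{\mathbb N}$ with $G_\delta$ domain, $[\delta,\delta']$ is the product of representations and $\delta\sqcap\delta'$ their meet (a name consists of a $\delta$-name and a $\delta'$-name of the same object). Let $(X,d,\nu)$ be a computable metric space: $(X,d)$ is a metric space, $\nu:\mathbb N\to X$ has dense range and $(i,j)\mapsto d(\nu(i),\nu(j))$ is computable. Points are given by the Cauchy representation $\delta_X$: $p$ is a name of $x$ if $d(\nu(p_i),\nu(p_j))<2^{-\min\{i,j\}}$ for all $i,j$ and $\nu(p_i)\to x$. Ideal balls are the balls $B(\nu(a),q)$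 with $a\in\mathbb N$ and $q>0$ rational. Let * $\Sigma^0_1(X)$ be the open sets, where a name of $U$ enumerates ideal balls with union $U$, and $\Pi^0_1(X)$ the closed sets, where a name of $A$ is a $\Sigma^0_1(X)$-name of $X\setminus A$, with representation $\delta_{\Pi^0_1(X)}$; * $\delta_{\mathrm{range}}$ be the representation of the closed sets $A$ in which a name of $A\ne\emptyset$ encodes a sequence of $\delta_X$-names of points that are dense in $A$, with a separate name for $\emptyset$; * $\delta^{>}_{\mathrm{dist}}$ be the representation of the closed sets $A$ in which a name $p$ of $A$ is such that $\eta_p$ maps each $\delta_X$-name of each $x\in X$ to an enumeration of all rationals below $d(x,A)\in[0,\infty]$, where $d(x,\emptyset)=\infty$; * $\delta_{\mathrm{mc}}$ be the minimal cover representation of the set $\mathcal K(X)$ of compact sets: a name of $K$ lists the codes of all finite covers of $K$ by ideal balls each of which meets $K$; * $C$ be the set of continuous partial maps $f:\subseteq X\to X$ with closed domain, where $\langle p,q\rangle$ is a name of $f$ if $\eta_p$ maps each $\delta_X$-name of each $x\in\operatorname{dom} f$ to a $\delta_X$-name of $f(x)$ and $q$ is a $\Pi^0_1(X)$-name of $\operatorname{dom}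 f$. Let $\mathcal Y$ be a class of closed sets $A\subseteq X$ with $\dim A\le 0$, with a representation $\delta_{\mathcal Y}$ such that $\delta_{\mathcal Y}\le\delta_{\Pi^0_1(X)}$. Consider the following operations. * $E':\subseteq\mathcal Y\times\{\text{closed subsets of }X\}\rightrightarrows C$, with domain $\{(A,B): A\in\mathcal Y,\ \emptyset\ne B\subseteq A,\ B\ne X,\ B \text{ closed}\}$ and $E'(A,B)=\{f: \operatorname{dom} f=A,\ f(A)=B,\ f|_B=\mathrm{id}_B\}$; here $(A,B)$ is named by $[\delta_{\mathcal Y},\delta_{\mathrm{range}}\sqcap\delta^{>}_{\mathrm{dist}}]$. * $N:\subseteq\Pi^0_1(X)^2\times\mathcal Y\rightrightarrows\Sigma^0_1(X)^2$, with domain $\{(A,B,Y): A\cap B=\emptyset\}$ and $N(A,B,Y)=\{(U,V): A\subseteq U,\ B\subseteq V,\ Y\subseteq U\cup V,\ U\cap V=\emptyset\}$. * $M:\subseteq X\times\Sigma^0_1(X)\times\mathcal Y\rightrightarrows\Sigma^0_1(X)^2$, with domain $\{(x,U,Y): x\in U\}$ and $M(x,U,Y)=\{(V,W): x\in V\subseteq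 U,\ Y\subseteq V\cup W,\ V\cap W=\emptyset\}$. * $B$, with domain $\mathcal Y$, whose values at $Y$ are the triples $((U_i)_{i\in\mathbb N},(V_i)_{i\in\mathbb N},R)$, where $U_i,V_i$ are open, $U_i\cap V_i=\emptyset$ and $Y\subseteq U_i\cup V_i$ for every $i$, and $R\subseteq\mathbb N^2$ satisfies, with $\alpha$ the standard numbering of the ideal balls: $(i,a)\in R$ implies $U_i\cap Y\subseteq\alpha(a)$, and for all $a$ and $x\in\alpha(a)\cap Y$ there is $i$ with $(i,a)\in R$ and $x\in U_i$. Here the sequences are named by sequences of $\Sigma^0_1(X)$-names and $R$ by an enumeration. * $S:\subseteq\Sigma^0_1(X)^{\mathbb N}\times\mathcal Y\rightrightarrows\Sigma^0_1(X)^{\mathbb N}$, with domain $\{((U_i)_i,Y): Y\subseteq\bigcup_i U_i\}$ and $S((U_i)_i,Y)=\{(W_i)_i: W_i\subseteq U_i \text{ for all } i,\ Y\subseteq\bigcup_i W_i,\ W_i\cap W_j=\emptyset \text{ for } i\ne j\}$. Call $(\mathcal Y,\delta_{\mathcal Y})$ uniformly effectively zero-dimensional if $S$ is computable. **Corollary.**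 Suppose that $Y\cup\{x\}\in\mathcal Y$ for all $x\in X$, $Y\in\mathcal Y$ and that $\gamma:X\times\mathcal Y\to\mathcal Y$, $(x,Y)\mapsto Y\cup\{x\}$, is computable. Suppose further that $Y\cap\{y: d(x,y)\le 2^{-n}\}$ is compact for all $x\in X$, $n\in\mathbb N$, $Y\in\mathcal Y$ and that $\beta:X\times\mathbb N\times\mathcal Y\to\mathcal K(X)$, $(x,n,Y)\mapsto Y\cap\{y: d(x,y)\le 2^{-n}\}$, is computable with respect to $\delta_{\mathrm{mc}}$. Then $E'$ is computable if and only if $(\mathcal Y,\delta_{\mathcal Y})$ is uniformly effectively zero-dimensional. Moreover, computability of $N$, of $M$, of $B$ and of $S$ are equivalent conditions. -/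

import Mathlib

open Set Filter Topology

namespace TTE

/-! ### Computability on Baire space -/

/-- Baire space `ℕ → ℕ`; its elements serve as names. -/
abbrev Baire : Type := ℕ → ℕ

/-- The finite prefix `q 0, …, q (m - 1)`. -/
def prefixOf (q : Baire) (m : ℕ) : List ℕ := (List.range m).map q

/-- The canonical representation `η` of the continuous partial functions `⊆ Baire → Baire` with
`G_δ` domain, as a relation: `Eta a q r` says that `q` lies in the domain of `η_a` and that
`η_a (q) = r`. The sequence `a` tabulates, for every `n` and every finite prefix `w` of the input,
either `0` (the prefix is too short to determine the output symbol number `n`) or `v + 1`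
(the output symbol number `n` is `v`); the first nonzero entry along the input counts. -/
def Eta (a q r : Baire) : Prop :=
  ∀ n, ∃ m, a (Nat.pair n (Encodable.encode (prefixOf q m))) = r n + 1 ∧
    ∀ k < m, a (Nat.pair n (Encodable.encode (prefixOf q k))) = 0

/-- First component of the pairing `⟨p, q⟩` on Baire space (interleaving). -/
def left (p : Baire) : Baire := fun n => p (2 * n)

/-- Second component of the pairing `⟨p, q⟩` on Baire space (interleaving). -/
def right (p : Baire) : Baire := fun n => p (2 * n + 1)

/-- The `i`-th component of the countable tupling `⟨p⁽⁰⁾, p⁽¹⁾, …⟩`. -/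
def component (p : Baire) (i : ℕ) : Baire := fun k => p (Nat.pair i k)

/-! ### Naming relations, representations, multivalued operations -/

/-- A naming relation; `δ p x` says that `p` is a `δ`-name of `x`. -/
abbrev Naming (α : Type*) : Type _ := Baire → α → Prop

/-- `δ` is a representation of the set `S`: a partial surjection from Baire space onto `S`. -/
structure IsRepresentation {α : Type*} (δ : Naming α) (S : Set α) : Prop where
  functional : ∀ p x y, δ p x → δ p y → x = y
  mem : ∀ p x, δ p x → x ∈ S
  surjective : ∀ x ∈ S, ∃ p, δ p x

/-- The reduction `δ ≤ δ'`: names are translated by a computable partial function. -/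
def Reducible {α : Type*} (δ δ' : Naming α) : Prop :=
  ∃ a : Baire, Computable a ∧ ∀ p x, δ p x → ∃ r, Eta a p r ∧ δ' r x

/-- A multivalued partial operation `⊆ α ⇉ β`. -/
structure Operation (α β : Type*) where
  dom : Set α
  val : α → Set β

/-- An everywhere defined single-valued operation on a set. -/
def Operation.ofFun {α β : Type*} (s : Set α) (f : α → β) : Operation α β where
  dom := s
  val := fun x => {f x}

/-- `(δ, δ')`-computability: some computable partial function on Baire space maps every name of
every point of the domain to a name of one of the values of the operation at that point. -/
def Operation.IsComputable {α β : Type*} (f : Operation α β) (δ : Naming α) (δ' : Naming β) :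
    Prop :=
  ∃ a : Baire, Computable a ∧
    ∀ x ∈ f.dom, ∀ p, δ p x → ∃ r, Eta a p r ∧ ∃ y ∈ f.val x, δ' r y

/-- The product representation `[δ, δ']`. -/
def prodName {α β : Type*} (δ : Naming α) (δ' : Naming β) : Naming (α × β) :=
  fun p x => δ (left p) x.1 ∧ δ' (right p) x.2

/-- The representation `δ^ω` of sequences. -/
def seqName {α : Type*} (δ : Naming α) : Naming (ℕ → α) :=
  fun p x => ∀ i, δ (component p i) (x i)

/-- The meet `δ ⊓ δ'`: a name supplies a `δ`-name and a `δ'`-name of the same object. -/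
def meetName {α : Type*} (δ δ' : Naming α) : Naming α :=
  fun p x => δ (left p) x ∧ δ' (right p) x

/-- The representation `p ↦ p 0` of the natural numbers. -/
def natName : Naming ℕ := fun p n => p 0 = n

/-- Enumerations (with padding by `0`) of sets of pairs of natural numbers. -/
def enumName : Naming (Set (ℕ × ℕ)) :=
  fun p R => R = {c | ∃ i, p i = Nat.pair c.1 c.2 + 1}

/-- Standard total numbering of the positive rationals. -/
def posRat (k : ℕ) : ℚ := ((k.unpair.1 : ℚ) + 1) / ((k.unpair.2 : ℚ) + 1)

/-- Standard total numbering of the rationals. -/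
def rat (k : ℕ) : ℚ :=
  ((k.unpair.1.unpair.1 : ℚ) - (k.unpair.1.unpair.2 : ℚ)) / ((k.unpair.2 : ℚ) + 1)

/-- Extended reals named from below: the name enumerates all rationals strictly below `t`. -/
def lowerName : Naming EReal :=
  fun p t => {n : ℕ | (((rat n : ℚ) : ℝ) : EReal) < t} = {n | ∃ i, p i = n + 1}

/-! ### Computable metric spaces and their hyperspaces -/

/-- `(X, d, ν)` is a computable metric space: `ν` is a dense sequence and the real numbers
`d (ν i, ν j)` are computable uniformly in `i, j`. -/
structure IsComputableMetricSpace {X : Type*} [MetricSpace X] (ν : ℕ → X) : Prop where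
  dense : DenseRange ν
  computable_dist : ∃ f : ℕ × ℕ × ℕ → ℕ, Computable f ∧
    ∀ i j k, |dist (ν i) (ν j) - ((rat (f (i, j, k)) : ℚ) : ℝ)| ≤ (2 : ℝ)⁻¹ ^ k

section Spaces

variable {X : Type*} [MetricSpace X] (ν : ℕ → X)

/-- The Cauchy representation of `X`. -/
def cauchyName : Naming X :=
  fun p x => (∀ i j, dist (ν (p i)) (ν (p j)) < (2 : ℝ)⁻¹ ^ (min i j)) ∧
    Tendsto (fun i => ν (p i)) atTop (𝓝 x)

/-- The standard numbering of the ideal open balls. -/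
def idealBall (c : ℕ) : Set X :=
  Metric.ball (ν c.unpair.1) ((posRat c.unpair.2 : ℚ) : ℝ)

/-- The representation of the open sets by enumerating ideal balls that exhaust them. -/
def openName : Naming (Set X) :=
  fun p U => U = ⋃ c ∈ {c : ℕ | ∃ i, p i = c + 1}, idealBall ν c

/-- The representation of the closed sets by negative information. -/
def closedName : Naming (Set X) := fun p A => openName ν p Aᶜ

/-- The representation of the closed sets by a dense sequence of points (positive information);
the empty set has the single name `0^ω`. -/
def rangeName : Naming (Set X) :=
  fun p A => IsClosed A ∧
    ((A = ∅ ∧ ∀ i, p i = 0) ∨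
      (A ≠ ∅ ∧ (∀ i, 1 ≤ p i) ∧ ∃ y : ℕ → X,
        (∀ i, cauchyName ν (fun k => component p i k - 1) (y i)) ∧
          (∀ i, y i ∈ A) ∧ A ⊆ closure (range y)))

/-- The representation of the closed sets by the distance function as a lower semicontinuous
function into the extended reals (with `d(x, ∅) = ∞`). -/
noncomputable def distName : Naming (Set X) :=
  fun a A => IsClosed A ∧
    ∀ q x, cauchyName ν q x → ∃ r, Eta a q r ∧ lowerName r (Metric.infEDist x A : EReal)

/-- The minimal cover representation of the compact sets: a name lists (the codes of) all finite
covers of `K` by ideal balls each of which meets `K`. -/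
def minCoverName : Naming (Set X) :=
  fun p K => IsCompact K ∧
    range p = {c | ∃ w : List ℕ, c = Encodable.encode w ∧
      (K ⊆ ⋃ b ∈ {b | b ∈ w}, idealBall ν b) ∧ ∀ b ∈ w, (idealBall ν b ∩ K).Nonempty}

/-- `η_a` realizes the partial function `f : ⊆ X → X`. -/
def RealizesMap (a : Baire) (f : X →. X) : Prop :=
  ∀ p x, cauchyName ν p x → ∀ y ∈ f x, ∃ r, Eta a p r ∧ cauchyName ν r y

/-- The continuous partial functions `⊆ X → X` with closed domain. -/
def partialMaps : Set (X →. X) := {f | IsClosed f.Dom ∧ ∃ a, RealizesMap ν a f}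

/-- The representation of `partialMaps`: a realizer, and negative information on the domain. -/
def partialMapName : Naming (X →. X) :=
  fun p f => RealizesMap ν (left p) f ∧ closedName ν (right p) f.Dom

/-! ### The operations -/

/-- `γ : X × 𝒴 → 𝒴` adds a point. -/
def opAddPoint (𝒴 : Set (Set X)) : Operation (X × Set X) (Set X) :=
  Operation.ofFun {z | z.2 ∈ 𝒴} fun z => insert z.1 z.2

/-- `β : X × ℕ × 𝒴 → 𝒦(X)` intersects with the closed ball of radius `2⁻ⁿ`. -/
noncomputable def opBall (𝒴 : Set (Set X)) : Operation (X × ℕ × Set X) (Set X) :=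
  Operation.ofFun {z | z.2.2 ∈ 𝒴} fun z => z.2.2 ∩ Metric.closedBall z.1 ((2 : ℝ)⁻¹ ^ z.2.1)

/-- The retraction operator `E'`: on `(A, B)` with `A ∈ 𝒴`, `B` closed, `∅ ≠ B ⊆ A`, `B ≠ X`, its
values are the continuous partial functions with domain `A` and image `B` that fix `B`
pointwise. -/
def opRetract (𝒴 : Set (Set X)) : Operation (Set X × Set X) (X →. X) where
  dom := {z | z.1 ∈ 𝒴 ∧ IsClosed z.2 ∧ z.2.Nonempty ∧ z.2 ⊆ z.1 ∧ z.2 ≠ univ}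
  val := fun z => {f | f ∈ partialMaps ν ∧ f.Dom = z.1 ∧ f.ran = z.2 ∧ ∀ b ∈ z.2, b ∈ f b}

/-- Computability of `E'`: the set `A` is given by a name in `𝒴`, and `B` by positive information
together with its distance function from below. -/
def RetractComputable (𝒴 : Set (Set X)) (δ : Naming (Set X)) : Prop :=
  (opRetract ν 𝒴).IsComputable (prodName δ (meetName (rangeName ν) (distName ν)))
    (partialMapName ν)

/-- The operation `N` (vanishing large inductive dimension). -/
def opN (𝒴 : Set (Set X)) : Operation (Set X × Set X × Set X) (Set X × Set X) where
  dom := {z | IsClosed z.1 ∧ IsClosed z.2.1 ∧ z.2.2 ∈ 𝒴 ∧ Disjoint z.1 z.2.1}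
  val := fun z => {o | IsOpen o.1 ∧ IsOpen o.2 ∧ z.1 ⊆ o.1 ∧ z.2.1 ⊆ o.2 ∧
    z.2.2 ⊆ o.1 ∪ o.2 ∧ Disjoint o.1 o.2}

def NComputable (𝒴 : Set (Set X)) (δ : Naming (Set X)) : Prop :=
  (opN 𝒴).IsComputable (prodName (closedName ν) (prodName (closedName ν) δ))
    (prodName (openName ν) (openName ν))

/-- The operation `M` (vanishing small inductive dimension). -/
def opM (𝒴 : Set (Set X)) : Operation (X × Set X × Set X) (Set X × Set X) where
  dom := {z | IsOpen z.2.1 ∧ z.2.2 ∈ 𝒴 ∧ z.1 ∈ z.2.1}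
  val := fun z => {o | IsOpen o.1 ∧ IsOpen o.2 ∧ z.1 ∈ o.1 ∧ o.1 ⊆ z.2.1 ∧
    z.2.2 ⊆ o.1 ∪ o.2 ∧ Disjoint o.1 o.2}

def MComputable (𝒴 : Set (Set X)) (δ : Naming (Set X)) : Prop :=
  (opM 𝒴).IsComputable (prodName (cauchyName ν) (prodName (openName ν) δ))
    (prodName (openName ν) (openName ν))

/-- The operation `B` (a countable basis of relatively clopen sets): on `Y ∈ 𝒴` its values consist
of a sequence of pairs of disjoint open sets `(U i, V i)` covering `Y` and a refined inclusion
`R` of the numbering `i ↦ U i ∩ Y` with respect to the numbering `a ↦ idealBall ν a ∩ Y`. So the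
sets `U i ∩ Y` form a basis of the topology of `Y`. -/
def opB (𝒴 : Set (Set X)) :
    Operation (Set X) ((ℕ → Set X) × (ℕ → Set X) × Set (ℕ × ℕ)) where
  dom := 𝒴
  val := fun Y => {o | (∀ i, IsOpen (o.1 i) ∧ IsOpen (o.2.1 i) ∧ Y ⊆ o.1 i ∪ o.2.1 i ∧
      Disjoint (o.1 i) (o.2.1 i)) ∧
    (∀ i a, (i, a) ∈ o.2.2 → o.1 i ∩ Y ⊆ idealBall ν a ∩ Y) ∧
    ∀ a, ∀ x ∈ idealBall ν a ∩ Y, ∃ i, (i, a) ∈ o.2.2 ∧ x ∈ o.1 i ∩ Y}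

def BComputable (𝒴 : Set (Set X)) (δ : Naming (Set X)) : Prop :=
  (opB ν 𝒴).IsComputable δ
    (prodName (seqName (openName ν)) (prodName (seqName (openName ν)) enumName))

/-- The operation `S` (reduction principle for sequences of open sets covering a set of `𝒴`). -/
def opS (𝒴 : Set (Set X)) : Operation ((ℕ → Set X) × Set X) (ℕ → Set X) where
  dom := {z | (∀ i, IsOpen (z.1 i)) ∧ z.2 ∈ 𝒴 ∧ z.2 ⊆ ⋃ i, z.1 i}
  val := fun z => {W | (∀ i, IsOpen (W i) ∧ W i ⊆ z.1 i) ∧ z.2 ⊆ ⋃ i, W i ∧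
    Pairwise fun i j => Disjoint (W i) (W j)}

def SComputable (𝒴 : Set (Set X)) (δ : Naming (Set X)) : Prop :=
  (opS 𝒴).IsComputable (prodName (seqName (openName ν)) δ) (seqName (openName ν))

/-- The represented class `(𝒴, δ)` is uniformly effectively zero-dimensional. -/
def UniformlyEffectivelyZeroDimensional (𝒴 : Set (Set X)) (δ : Naming (Set X)) : Prop :=
  SComputable ν 𝒴 δ

end Spaces

end TTE

/-!
A point has names each finite prefix of which also begins names of all points of a neighbourhood. So
an operation computable in a point, applied to the finite prefixes of names, yields a computable
sequence of results that serves every point.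

From `M` this gives, for a cover `(Uᵢ)` of `Y`, a sequence of disjoint open pairs `(Vₙ, Wₙ)` with
`Y ⊆ Vₙ ∪ Wₙ`, each `Vₙ` inside some `Uᵢ` and the `Vₙ` covering `Y`; a basis as in `B` gives such a
sequence as well. Collecting the sets `Vₙ ∩ ⋂ Wₘ` over the earlier `m` that belong to other indices
yields the disjoint refinement required by `S`. Conversely `S` gives `N` by refining the cover of
`Y` by `Bᶜ` and `Aᶜ`, `N` gives `M` with `A = {x}` and `B = Uᶜ`, and `S` gives `B` by refining the
covers of `Y` by small balls.

For `E'` from `S`, let `(bⱼ)` be dense in `B`. The `k`-th refinement of the cover of `A` by `Bᶜ` and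
the balls of radius `2⁻ᵏ` around the `bⱼ` assigns to `z ∈ A` either a `bⱼ` close to `z` or the
information `z ∉ B`. The assigned points, frozen once `z ∉ B` is seen, converge to a point of `B`,
which is `z` if `z ∈ B`.

For `M` from `E'`, a retraction of `Y ∪ {x, y}` onto `{x, y}` splits `Y` into a part around `x` and
a part around `y`. Since `Y ∩ closedBall x r` is compact, finitely many of these splittings, found
with the help of a minimal cover, isolate from `x` all its points outside `ball x r`. The pair
`{x, y}` has to differ from `X`, so finite spaces are treated separately; there the points are open.
-/

namespace TTE

section Computable

variable {α β γ : Type*} [Primcodable α] [Primcodable β] [Primcodable γ]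

theorem computable_add {f g : α → ℕ} (hf : Computable f) (hg : Computable g) :
    Computable fun x => f x + g x := Primrec.nat_add.to_comp.comp hf hg

theorem computable_sub {f g : α → ℕ} (hf : Computable f) (hg : Computable g) :
    Computable fun x => f x - g x := Primrec.nat_sub.to_comp.comp hf hg

theorem computable_mul {f g : α → ℕ} (hf : Computable f) (hg : Computable g) :
    Computable fun x => f x * g x := Primrec.nat_mul.to_comp.comp hf hg

theorem computable_div {f g : α → ℕ} (hf : Computable f) (hg : Computable g) :
    Computable fun x => f x / g x := Primrec.nat_div.to_comp.comp hf hg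

theorem computable_mod {f g : α → ℕ} (hf : Computable f) (hg : Computable g) :
    Computable fun x => f x % g x := Primrec.nat_mod.to_comp.comp hf hg

theorem computable_natPair {f g : α → ℕ} (hf : Computable f) (hg : Computable g) :
    Computable fun x => Nat.pair (f x) (g x) := Primrec₂.natPair.to_comp.comp hf hg

theorem computable_getElem? {f : α → List β} {g : α → ℕ} (hf : Computable f)
    (hg : Computable g) : Computable fun x => (f x)[g x]? := Computable.list_getElem?.comp hf hg

theorem computable_getD {f : α → List ℕ} {g : α → ℕ} (hf : Computable f)
    (hg : Computable g) : Computable fun x => (f x).getD (g x) 0 :=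
  (Primrec.list_getD 0).to_comp.comp hf hg

theorem computable_and {f g : α → Bool} (hf : Computable f) (hg : Computable g) :
    Computable fun x => f x && g x := Primrec.and.to_comp.comp hf hg

theorem computable_or {f g : α → Bool} (hf : Computable f) (hg : Computable g) :
    Computable fun x => f x || g x := Primrec.or.to_comp.comp hf hg

theorem computable_not {f : α → Bool} (hf : Computable f) :
    Computable fun x => !(f x) := Primrec.not.to_comp.comp hf

theorem computable_decide_eq [DecidableEq β] {f g : α → β} (hf : Computable f)
    (hg : Computable g) : Computable fun x => decide (f x = g x) :=
  (Primrec.eq (α := β)).decide.to_comp.comp hf hg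

theorem computable_blt {f g : α → ℕ} (hf : Computable f) (hg : Computable g) :
    Computable fun x => Nat.blt (f x) (g x) :=
  (Primrec.nat_lt.decide.to_comp.comp hf hg).of_eq fun x => by
    rw [Bool.eq_iff_iff, Nat.blt_eq, decide_eq_true_iff]

theorem computable_ble {f g : α → ℕ} (hf : Computable f) (hg : Computable g) :
    Computable fun x => Nat.ble (f x) (g x) :=
  (Primrec.nat_le.decide.to_comp.comp hf hg).of_eq fun x => by
    rw [Bool.eq_iff_iff, Nat.ble_eq, decide_eq_true_iff]

theorem computable_optionElim {o : α → Option β} {d : α → γ} {f : α → β → γ}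
    (ho : Computable o) (hd : Computable d) (hf : Computable fun z : α × β => f z.1 z.2) :
    Computable fun x => (o x).elim (d x) (f x) := by
  refine (Computable.option_casesOn ho hd hf.to₂).of_eq fun x => ?_
  cases o x <;> rfl

attribute [fun_prop] Computable

attribute [fun_prop] Computable.id Computable.const Computable.comp Computable.pair Computable.fst
  Computable.snd Computable.unpair Computable.encode Computable.decode Computable.list_length
  Computable.option_some Computable.cond computable_add computable_sub computable_mul
  computable_div computable_mod computable_natPair computable_getElem? computable_getD
  computable_and computable_or computable_not computable_decide_eq computable_blt computable_ble
  computable_optionElim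

@[fun_prop]
theorem computable_pow {f g : α → ℕ} (hf : Computable f) (hg : Computable g) :
    Computable fun x => f x ^ g x := by
  have : Computable fun x => Nat.rec (motive := fun _ => ℕ) 1 (fun _ r => r * f x) (g x) :=
    Computable.nat_rec hg (Computable.const 1)
      (h := fun x z => z.2 * f x) (Computable₂.mk (by fun_prop))
  refine this.of_eq fun x => ?_
  induction g x with
  | zero => rfl
  | succ k ih => rw [pow_succ, ← ih]

@[fun_prop]
theorem computable_decide_exists_lt {f : α → ℕ → Bool} {n : α → ℕ}
    (hf : Computable fun z : α × ℕ => f z.1 z.2) (hn : Computable n) :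
    Computable fun x => decide (∃ k < n x, f x k = true) := by
  have hstep : Computable₂ fun x (z : ℕ × Bool) => z.2 || f x z.1 := by
    have := hf.comp (by fun_prop : Computable fun z : α × ℕ × Bool => (z.1, z.2.1))
    exact Computable₂.mk (by fun_prop)
  refine (Computable.nat_rec hn (Computable.const false) hstep).of_eq fun x => ?_
  induction n x with
  | zero => simp
  | succ k ih =>
    rw [Bool.eq_iff_iff, decide_eq_true_iff, Nat.exists_lt_succ_right]
    simp [ih]

@[fun_prop]
theorem computable_decide_forall_lt {f : α → ℕ → Bool} {n : α → ℕ}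
    (hf : Computable fun z : α × ℕ => f z.1 z.2) (hn : Computable n) :
    Computable fun x => decide (∀ k < n x, f x k = true) := by
  have : Computable fun x => !decide (∃ k < n x, (!f x k) = true) := by fun_prop
  exact this.of_eq fun x => by rw [Bool.eq_iff_iff]; simp

@[fun_prop]
theorem computable_findGreatest {f : α → ℕ → Bool} {n : α → ℕ}
    (hf : Computable fun z : α × ℕ => f z.1 z.2) (hn : Computable n) :
    Computable fun x => Nat.findGreatest (fun k => f x k = true) (n x) := by
  have hstep : Computable₂ fun x (z : ℕ × ℕ) => bif f x (z.1 + 1) then z.1 + 1 else z.2 := by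
    have := hf.comp (by fun_prop : Computable fun z : α × ℕ × ℕ => (z.1, z.2.1 + 1))
    exact Computable₂.mk (by fun_prop)
  refine (Computable.nat_rec hn (Computable.const 0) hstep).of_eq fun x => ?_
  induction n x with
  | zero => rfl
  | succ k ih => rw [Nat.findGreatest_succ, ← ih, ← Bool.cond_eq_ite]

/-- The successor of the largest `v < n` with `f v`, and `0` if there is none: an entry of a table
for `Eta`, where `0` means that no output symbol is known yet. -/
def outputBelow (f : ℕ → Bool) (n : ℕ) : ℕ :=
  Nat.findGreatest (fun k => (Nat.blt 0 k && f (k - 1)) = true) n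

@[fun_prop]
theorem computable_outputBelow {f : α → ℕ → Bool} {n : α → ℕ}
    (hf : Computable fun z : α × ℕ => f z.1 z.2) (hn : Computable n) :
    Computable fun x => outputBelow (f x) (n x) := by
  have := hf.comp (by fun_prop : Computable fun z : α × ℕ => (z.1, z.2 - 1))
  exact computable_findGreatest (f := fun x k => Nat.blt 0 k && f x (k - 1)) (by fun_prop) hn

theorem outputBelow_spec {f : ℕ → Bool} {n v : ℕ} (h : outputBelow f n = v + 1) :
    f v = true := by
  simpa using (Nat.findGreatest_of_ne_zero h v.succ_ne_zero)

theorem outputBelow_ne_zero {f : ℕ → Bool} {n v : ℕ} (hv : v < n) (h : f v = true) :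
    outputBelow f n ≠ 0 :=
  (Nat.succ_pos v).trans_le (Nat.le_findGreatest hv (by simpa using h)) |>.ne'

end Computable

section Prefix

theorem length_prefixOf (q : Baire) (m : ℕ) : (prefixOf q m).length = m := by simp [prefixOf]

theorem getElem?_prefixOf {q : Baire} {m i : ℕ} (h : i < m) : (prefixOf q m)[i]? = some (q i) := by
  simp [prefixOf, h]

theorem getD_prefixOf {q : Baire} {m i : ℕ} (h : i < m) : (prefixOf q m).getD i 0 = q i := by
  rw [List.getD_eq_getElem?_getD, getElem?_prefixOf h, Option.getD_some]

theorem prefixOf_isPrefix (q : Baire) {m m' : ℕ} (h : m ≤ m') :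
    prefixOf q m <+: prefixOf q m' := by
  obtain ⟨k, rfl⟩ := Nat.exists_eq_add_of_le h
  exact ⟨((List.range k).map (m + ·)).map q, by simp [prefixOf, List.range_add]⟩

theorem prefixOf_congr {q q' : Baire} {m : ℕ} (h : ∀ i < m, q i = q' i) :
    prefixOf q m = prefixOf q' m :=
  List.map_congr_left fun i hi => h i (List.mem_range.1 hi)

theorem prefixOf_eq_iff {q : Baire} {m : ℕ} {w : List ℕ} :
    prefixOf q m = w ↔ w.length = m ∧ ∀ i < m, w[i]? = some (q i) := by
  constructor
  · rintro rfl
    exact ⟨length_prefixOf q m, fun i hi => getElem?_prefixOf hi⟩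
  · rintro ⟨rfl, h⟩
    refine List.ext_getElem (length_prefixOf q _) fun i _ hi => Option.some_injective _ ?_
    rw [← List.getElem?_eq_getElem, ← List.getElem?_eq_getElem, getElem?_prefixOf hi, h i hi]

theorem Eta.apply_eq_iff {a q r : Baire} (h : Eta a q r) {n v : ℕ} :
    r n = v ↔ ∃ m, a (Nat.pair n (Encodable.encode (prefixOf q m))) = v + 1 ∧
      ∀ k < m, a (Nat.pair n (Encodable.encode (prefixOf q k))) = 0 := by
  obtain ⟨m, hm, hlt⟩ := h n
  constructor
  · rintro rfl
    exact ⟨m, hm, hlt⟩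
  · rintro ⟨m', hm', hlt'⟩
    rcases lt_trichotomy m m' with hmm' | rfl | hmm'
    · simp [hlt' m hmm'] at hm
    · omega
    · simp [hlt m' hmm'] at hm'

theorem eta_of_outputBelow {a q r : Baire} {E : ℕ → ℕ → ℕ → Bool}
    (ha : ∀ n m, a (Nat.pair n (Encodable.encode (prefixOf q m))) = outputBelow (E m n) m)
    (hunique : ∀ m n v, E m n v = true → v = r n)
    (hE : ∀ n, ∀ᶠ m in atTop, E m n (r n) = true) : Eta a q r := by
  classical
  intro n
  have hex : ∃ m, a (Nat.pair n (Encodable.encode (prefixOf q m))) ≠ 0 := by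
    obtain ⟨m, hm, hrm⟩ := ((hE n).and (eventually_gt_atTop (r n))).exists
    exact ⟨m, by rw [ha]; exact outputBelow_ne_zero hrm hm⟩
  refine ⟨Nat.find hex, ?_, fun k hk => not_not.1 (Nat.find_min hex hk)⟩
  obtain ⟨v, hv⟩ := Nat.exists_eq_succ_of_ne_zero (Nat.find_spec hex)
  rw [hv, hunique _ n v (outputBelow_spec ((ha _ _).symm.trans hv))]

/-- The prefix of the input to which the entry number `e` of a table for `Eta` refers. -/
def tablePrefix (e : ℕ) : List ℕ := (Encodable.decode e.unpair.2 : Option (List ℕ)).elim [] id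

theorem tablePrefix_natPair (n : ℕ) (w : List ℕ) :
    tablePrefix (Nat.pair n (Encodable.encode w)) = w := by
  simp [tablePrefix]

@[fun_prop]
theorem computable_tablePrefix : Computable tablePrefix :=
  computable_optionElim (by fun_prop) (by fun_prop) Computable.snd

end Prefix

section Relative

variable {T : Type*} {α β γ : Type} [Primcodable α] [Primcodable β] [Primcodable γ]
  {nm : T → Baire} {P Q : T → α → Prop}

/-- `P t x` is recursively enumerable uniformly in a name `nm t` of the input `t` and in the
discrete parameter `x`: a computable test on prefixes of `nm t`, monotone in the prefix, succeeds
on some prefix if and only if `P t x` holds. -/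
def REPredFrom (nm : T → Baire) (P : T → α → Prop) : Prop :=
  ∃ D : List ℕ × α → Bool, Computable D ∧
    (∀ ⦃w w' x⦄, w <+: w' → D (w, x) = true → D (w', x) = true) ∧
    ∀ t x, P t x ↔ ∃ m, D (prefixOf (nm t) m, x) = true

/-- The value `F t x` is computable uniformly in a name `nm t` of the input `t` and in the discrete
parameter `x`. It is encoded by the graph of `F t` being recursively enumerable, which for total
functions amounts to the same. -/
def ComputableFrom (nm : T → Baire) (F : T → α → β) : Prop :=
  REPredFrom nm fun t (z : α × β) => F t z.1 = z.2

theorem REPredFrom.congr (h : REPredFrom nm P) (hPQ : ∀ t x, Q t x ↔ P t x) : REPredFrom nm Q := by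
  obtain rfl : Q = P := funext₂ fun t x => propext (hPQ t x)
  exact h

theorem REPredFrom.of_computable {b : α → Bool} (hb : Computable b) :
    REPredFrom nm fun _ x => b x = true :=
  ⟨fun z => b z.2, by fun_prop, fun _ _ _ _ h => h,
    fun _ _ => ⟨fun h => ⟨0, h⟩, fun ⟨_, h⟩ => h⟩⟩

theorem REPredFrom.const_true : REPredFrom nm fun _ (_ : α) => True :=
  (REPredFrom.of_computable (Computable.const true)).congr fun _ _ => by simp

protected theorem REPredFrom.and (hP : REPredFrom nm P) (hQ : REPredFrom nm Q) :
    REPredFrom nm fun t x => P t x ∧ Q t x := by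
  obtain ⟨D, hD, hDm, hDP⟩ := hP
  obtain ⟨E, hE, hEm, hEQ⟩ := hQ
  refine ⟨fun z => D z && E z, by fun_prop, fun w w' x hw h => ?_, fun t x => ?_⟩
  · rw [Bool.and_eq_true] at h ⊢
    exact ⟨hDm hw h.1, hEm hw h.2⟩
  · simp only [hDP, hEQ, Bool.and_eq_true]
    refine ⟨fun ⟨⟨m, hm⟩, ⟨k, hk⟩⟩ => ⟨max m k, ?_, ?_⟩, fun ⟨m, hm⟩ => ⟨⟨m, hm.1⟩, ⟨m, hm.2⟩⟩⟩
    · exact hDm (prefixOf_isPrefix _ (le_max_left _ _)) hm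
    · exact hEm (prefixOf_isPrefix _ (le_max_right _ _)) hk

protected theorem REPredFrom.or (hP : REPredFrom nm P) (hQ : REPredFrom nm Q) :
    REPredFrom nm fun t x => P t x ∨ Q t x := by
  obtain ⟨D, hD, hDm, hDP⟩ := hP
  obtain ⟨E, hE, hEm, hEQ⟩ := hQ
  refine ⟨fun z => D z || E z, by fun_prop, fun w w' x hw h => ?_, fun t x => ?_⟩
  · rw [Bool.or_eq_true] at h ⊢
    exact h.imp (hDm hw) (hEm hw)
  · simp only [hDP, hEQ, Bool.or_eq_true, exists_or]

protected theorem REPredFrom.exists {P : T → α → β → Prop}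
    (hP : REPredFrom nm fun t (z : α × β) => P t z.1 z.2) :
    REPredFrom nm fun t x => ∃ b, P t x b := by
  obtain ⟨D, hD, hDm, hDP⟩ := hP
  let D' (z : List ℕ × α) (k : ℕ) : Bool :=
    (Encodable.decode k : Option β).elim false fun b => D (z.1, (z.2, b))
  have hD' (z k) : D' z k = true ↔ ∃ b, Encodable.decode k = some b ∧ D (z.1, (z.2, b)) = true := by
    cases h : (Encodable.decode k : Option β) <;> simp [D', h]
  refine ⟨fun z => decide (∃ k < z.1.length, D' z k = true), by fun_prop,
    fun w w' x hw h => ?_, fun t x => ?_⟩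
  · simp only [decide_eq_true_iff, hD'] at h ⊢
    obtain ⟨k, hk, b, hb, h⟩ := h
    exact ⟨k, hk.trans_le hw.length_le, b, hb, hDm hw h⟩
  · simp only [decide_eq_true_iff, hD', length_prefixOf]
    constructor
    · rintro ⟨b, hb⟩
      obtain ⟨m, hm⟩ := (hDP t (x, b)).1 hb
      exact ⟨max m (Encodable.encode b + 1), Encodable.encode b, by omega, b,
        Encodable.encodek b, hDm (prefixOf_isPrefix _ (le_max_left _ _)) hm⟩
    · rintro ⟨m, k, -, b, -, h⟩
      exact ⟨b, (hDP t (x, b)).2 ⟨m, h⟩⟩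

theorem REPredFrom.reindex {P : T → β → Prop} (hP : REPredFrom nm P) {g : α → β}
    (hg : Computable g) : REPredFrom nm fun t x => P t (g x) := by
  obtain ⟨D, hD, hDm, hDP⟩ := hP
  exact ⟨fun z => D (z.1, g z.2), by fun_prop, fun _ _ _ hw => hDm hw, fun t x => hDP t (g x)⟩

theorem REPredFrom.forall_lt {P : T → α → ℕ → Prop}
    (hP : REPredFrom nm fun t (z : α × ℕ) => P t z.1 z.2) {n : α → ℕ} (hn : Computable n) :
    REPredFrom nm fun t x => ∀ i < n x, P t x i := by
  obtain ⟨D, hD, hDm, hDP⟩ := hP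
  refine ⟨fun z => decide (∀ k < n z.2, D (z.1, (z.2, k)) = true), by fun_prop,
    fun w w' x hw h => ?_, fun t x => ?_⟩
  · rw [decide_eq_true_iff] at h ⊢
    exact fun k hk => hDm hw (h k hk)
  · simp only [decide_eq_true_iff]
    refine ⟨fun h => ?_, fun ⟨m, hm⟩ i hi => (hDP t (x, i)).2 ⟨m, hm i hi⟩⟩
    have hbound : ∀ i, ∃ m, i < n x → D (prefixOf (nm t) m, (x, i)) = true := fun i => by
      by_cases hi : i < n x
      · exact ((hDP t (x, i)).1 (h i hi)).imp fun _ hm _ => hm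
      · exact ⟨0, fun h => absurd h hi⟩
    choose m hm using hbound
    exact ⟨(Finset.range (n x)).sup m, fun k hk =>
      hDm (prefixOf_isPrefix _ (Finset.le_sup (f := m) (Finset.mem_range.2 hk))) (hm k hk)⟩

theorem ComputableFrom.of_computable {g : α → β} (hg : Computable g) :
    ComputableFrom nm fun _ x => g x := by
  have : DecidableEq β := Encodable.decidableEqOfEncodable β
  exact (REPredFrom.of_computable (b := fun z : α × β => decide (g z.1 = z.2))
    (by fun_prop)).congr fun _ _ => by simp

theorem ComputableFrom.name : ComputableFrom nm fun t k => nm t k := by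
  refine ⟨fun z => decide (z.1[z.2.1]? = some z.2.2), by fun_prop, fun w w' x hw h => ?_,
    fun t x => ?_⟩
  · obtain ⟨v, rfl⟩ := hw
    rw [decide_eq_true_iff] at h ⊢
    rw [List.getElem?_append_left (List.getElem?_eq_some_iff.1 h).1, h]
  · simp only [decide_eq_true_iff]
    constructor
    · rintro h
      exact ⟨x.1 + 1, by rw [getElem?_prefixOf (Nat.lt_succ_self _), h]⟩
    · rintro ⟨m, hm⟩
      have hx : x.1 < m := length_prefixOf (nm t) m ▸ (List.getElem?_eq_some_iff.1 hm).1
      exact Option.some.inj ((getElem?_prefixOf hx).symm.trans hm)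

theorem REPredFrom.comp {P : T → β → Prop} (hP : REPredFrom nm P) {F : T → α → β}
    (hF : ComputableFrom nm F) : REPredFrom nm fun t x => P t (F t x) :=
  (REPredFrom.exists (P := fun t x b => F t x = b ∧ P t b)
    (hF.and (hP.reindex Computable.snd))).congr fun t x => by simp

theorem ComputableFrom.congr {F G : T → α → β} (h : ComputableFrom nm F)
    (hFG : ∀ t x, G t x = F t x) : ComputableFrom nm G := by
  obtain rfl : G = F := funext₂ hFG
  exact h

theorem ComputableFrom.reindex {F : T → β → γ} (hF : ComputableFrom nm F) {g : α → β}
    (hg : Computable g) : ComputableFrom nm fun t x => F t (g x) :=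
  REPredFrom.reindex (P := fun t (z : β × γ) => F t z.1 = z.2) hF
    (g := fun z : α × γ => (g z.1, z.2)) (by fun_prop)

theorem ComputableFrom.comp {F : T → β → γ} (hF : ComputableFrom nm F) {G : T → α → β}
    (hG : ComputableFrom nm G) : ComputableFrom nm fun t x => F t (G t x) :=
  (REPredFrom.exists (P := fun t (x : α × γ) b => G t x.1 = b ∧ F t b = x.2)
    ((REPredFrom.reindex (P := fun t (z : α × β) => G t z.1 = z.2) hG
      (g := fun z : (α × γ) × β => (z.1.1, z.2)) (by fun_prop)).and
    (REPredFrom.reindex (P := fun t (z : β × γ) => F t z.1 = z.2) hF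
      (g := fun z : (α × γ) × β => (z.2, z.1.2)) (by fun_prop)))).congr fun t x => by simp

theorem ComputableFrom.map {g : β → γ} (hg : Computable g) {F : T → α → β}
    (hF : ComputableFrom nm F) : ComputableFrom nm fun t x => g (F t x) :=
  ComputableFrom.comp (F := fun _ b => g b) (.of_computable hg) hF

theorem ComputableFrom.pair {F : T → α → β} {G : T → α → γ} (hF : ComputableFrom nm F)
    (hG : ComputableFrom nm G) : ComputableFrom nm fun t x => (F t x, G t x) :=
  ((REPredFrom.reindex (P := fun t (z : α × β) => F t z.1 = z.2) hF
      (g := fun z : α × (β × γ) => (z.1, z.2.1)) (by fun_prop)).and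
    (REPredFrom.reindex (P := fun t (z : α × γ) => G t z.1 = z.2) hG
      (g := fun z : α × (β × γ) => (z.1, z.2.2)) (by fun_prop))).congr
    fun t x => Prod.ext_iff

theorem ComputableFrom.map₂ {σ : Type} [Primcodable σ] {g : β → γ → σ}
    (hg : Computable fun z : β × γ => g z.1 z.2) {F : T → α → β} {G : T → α → γ}
    (hF : ComputableFrom nm F) (hG : ComputableFrom nm G) :
    ComputableFrom nm fun t x => g (F t x) (G t x) :=
  .map hg (hF.pair hG)

theorem ComputableFrom.cond {c : T → α → Bool} {F G : T → α → β} (hc : ComputableFrom nm c)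
    (hF : ComputableFrom nm F) (hG : ComputableFrom nm G) :
    ComputableFrom nm fun t x => bif c t x then F t x else G t x :=
  .map (g := fun z : Bool × β × β => bif z.1 then z.2.1 else z.2.2) (by fun_prop)
    (hc.pair (hF.pair hG))

theorem ComputableFrom.rePred_eq_true {F : T → α → Bool} (hF : ComputableFrom nm F) :
    REPredFrom nm fun t x => F t x = true :=
  REPredFrom.reindex (P := fun t (z : α × Bool) => F t z.1 = z.2) hF
    (g := fun x => (x, true)) (by fun_prop)

theorem ComputableFrom.rePred_eq {F G : T → α → β} (hF : ComputableFrom nm F)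
    (hG : ComputableFrom nm G) : REPredFrom nm fun t x => F t x = G t x := by
  have : DecidableEq β := Encodable.decidableEqOfEncodable β
  exact (ComputableFrom.map (g := fun z : β × β => decide (z.1 = z.2)) (by fun_prop)
    (hF.pair hG)).rePred_eq_true.congr fun _ _ => by simp

theorem ComputableFrom.rePred_ne {F G : T → α → β} (hF : ComputableFrom nm F)
    (hG : ComputableFrom nm G) : REPredFrom nm fun t x => F t x ≠ G t x := by
  have : DecidableEq β := Encodable.decidableEqOfEncodable β
  exact (ComputableFrom.map (g := fun z : β × β => !decide (z.1 = z.2)) (by fun_prop)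
    (hF.pair hG)).rePred_eq_true.congr fun _ _ => by simp

protected theorem ComputableFrom.prefixOf {F : T → α × ℕ → ℕ} (hF : ComputableFrom nm F) :
    ComputableFrom nm fun t (z : α × ℕ) => prefixOf (fun k => F t (z.1, k)) z.2 := by
  have hlength : REPredFrom nm fun _ (z : (α × ℕ) × List ℕ) => z.2.length = z.1.2 :=
    ComputableFrom.rePred_eq (F := fun _ (z : (α × ℕ) × List ℕ) => z.2.length)
      (.of_computable (by fun_prop)) (.of_computable (by fun_prop))
  have hentry : REPredFrom nm fun t (z : ((α × ℕ) × List ℕ) × ℕ) =>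
      z.1.2[z.2]? = some (F t (z.1.1.1, z.2)) :=
    ComputableFrom.rePred_eq (F := fun _ (z : ((α × ℕ) × List ℕ) × ℕ) => z.1.2[z.2]?)
      (G := fun t (z : ((α × ℕ) × List ℕ) × ℕ) => some (F t (z.1.1.1, z.2)))
      (.of_computable (by fun_prop))
      (.map (g := fun n : ℕ => some n) (by fun_prop)
        (hF.reindex (g := fun z : ((α × ℕ) × List ℕ) × ℕ => (z.1.1.1, z.2)) (by fun_prop)))
  have hentries : REPredFrom nm fun t (z : (α × ℕ) × List ℕ) =>
      ∀ i < z.1.2, z.2[i]? = some (F t (z.1.1, i)) :=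
    REPredFrom.forall_lt (P := fun t (z : (α × ℕ) × List ℕ) i => z.2[i]? = some (F t (z.1.1, i)))
      hentry (n := fun z => z.1.2) (by fun_prop)
  exact (hlength.and hentries).congr fun t z => prefixOf_eq_iff

theorem ComputableFrom.exists_search {q : T → α × ℕ → Bool} (hq : ComputableFrom nm q)
    (h : ∀ t a, ∃ s, q t (a, s) = true) :
    ∃ F : T → α → ℕ, ComputableFrom nm F ∧ ∀ t a, q t (a, F t a) = true := by
  refine ⟨fun t a => Nat.find (h t a), ?_, fun t a => Nat.find_spec (h t a)⟩
  have hfalse : REPredFrom nm fun t z => q t z ≠ true := hq.rePred_ne (.of_computable (.const true))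
  exact REPredFrom.congr (P := fun t (z : α × ℕ) => q t z = true ∧ ∀ i < z.2, q t (z.1, i) ≠ true)
    (hq.rePred_eq_true.and (.forall_lt (hfalse.reindex (by fun_prop)) (by fun_prop)))
    fun t z => Nat.find_eq_iff _

theorem REPredFrom.exists_stages {P : T → β → Prop} (hP : REPredFrom nm P) :
    ∃ Q : T → β × ℕ → Bool, ComputableFrom nm Q ∧ ∀ t b, P t b ↔ ∃ s, Q t (b, s) = true := by
  obtain ⟨D, hD, -, hDP⟩ := hP
  have hprefix : ComputableFrom nm fun t (z : β × ℕ) => prefixOf (nm t) z.2 :=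
    (ComputableFrom.prefixOf (F := fun t (z : Unit × ℕ) => nm t z.2)
      (ComputableFrom.name.reindex (by fun_prop))).reindex
      (g := fun z : β × ℕ => ((), z.2)) (by fun_prop)
  exact ⟨fun t z => D (prefixOf (nm t) z.2, z.1),
    .map hD (hprefix.pair (.of_computable (by fun_prop))), hDP⟩

theorem REPredFrom.exists_choice {P : T → α → β → Prop}
    (hP : REPredFrom nm fun t (z : α × β) => P t z.1 z.2) (h : ∀ t a, ∃ b, P t a b) :
    ∃ F : T → α → β, ComputableFrom nm F ∧ ∀ t a, P t a (F t a) := by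
  have hcode : REPredFrom nm fun t (z : α × ℕ) => ∃ b, Encodable.decode z.2 = some b ∧ P t z.1 b :=
    .exists (.and (ComputableFrom.rePred_eq (.of_computable (by fun_prop))
      (.of_computable (by fun_prop)))
      (hP.reindex (g := fun z : (α × ℕ) × β => (z.1.1, z.2)) (by fun_prop)))
  obtain ⟨Q, hQ, hQP⟩ := hcode.exists_stages
  -- Searching for a code of `b` and a stage at which `b` is accepted, paired as one number.
  obtain ⟨K, hK, hKQ⟩ := ComputableFrom.exists_search (nm := nm) (α := α)
    (q := fun t z => Q t ((z.1, z.2.unpair.1), z.2.unpair.2)) (hQ.reindex (by fun_prop))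
    (fun t a => by
      obtain ⟨b, hb⟩ := h t a
      obtain ⟨s, hs⟩ := (hQP t (a, Encodable.encode b)).1 ⟨b, Encodable.encodek b, hb⟩
      exact ⟨Nat.pair (Encodable.encode b) s, by simpa using hs⟩)
  choose F hF hFP using fun t a => (hQP t (a, (K t a).unpair.1)).2 ⟨_, hKQ t a⟩
  refine ⟨F, ?_, hFP⟩
  refine (ComputableFrom.rePred_eq (F := fun t (z : α × β) =>
    (Encodable.decode (K t z.1).unpair.1 : Option β)) (G := fun _ z => some z.2)
    (.map (g := fun k => (Encodable.decode k.unpair.1 : Option β)) (by fun_prop)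
      (hK.reindex (by fun_prop)))
    (.of_computable (by fun_prop))).congr fun t z => ?_
  rw [hF, Option.some_inj]

theorem REPredFrom.exists_enumeration {E : T → α × ℕ → Prop} (hE : REPredFrom nm E) :
    ∃ F : T → α × ℕ → ℕ, ComputableFrom nm F ∧ ∀ t a c, E t (a, c) ↔ ∃ i, F t (a, i) = c + 1 := by
  obtain ⟨Q, hQ, hQE⟩ := hE.exists_stages
  refine ⟨fun t z => bif Q t ((z.1, z.2.unpair.1), z.2.unpair.2) then z.2.unpair.1 + 1 else 0,
    .cond (hQ.reindex (by fun_prop)) (.of_computable (by fun_prop)) (.of_computable (by fun_prop)),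
    fun t a c => ?_⟩
  rw [hQE]
  constructor
  · rintro ⟨s, hs⟩
    exact ⟨Nat.pair c s, by simp [hs]⟩
  · rintro ⟨i, hi⟩
    cases hq : Q t ((a, i.unpair.1), i.unpair.2) with
    | false => simp [hq] at hi
    | true =>
      simp only [hq, cond_true, Nat.add_right_cancel_iff] at hi
      exact ⟨_, hi ▸ hq⟩

theorem ComputableFrom.of_eta {A Q R : T → α × ℕ → ℕ} (hA : ComputableFrom nm A)
    (hQ : ComputableFrom nm Q)
    (h : ∀ t a, Eta (fun k => A t (a, k)) (fun k => Q t (a, k)) fun k => R t (a, k)) :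
    ComputableFrom nm R := by
  let entry (t : T) (z : (α × ℕ) × ℕ) : ℕ :=
    A t (z.1.1, Nat.pair z.1.2 (Encodable.encode (prefixOf (fun k => Q t (z.1.1, k)) z.2)))
  have hentry : ComputableFrom nm entry :=
    hA.comp (.pair (.of_computable (by fun_prop)) (.map₂ (by fun_prop)
      (.of_computable (g := fun z : (α × ℕ) × ℕ => z.1.2) (by fun_prop))
      (.map (by fun_prop) (hQ.prefixOf.reindex
        (g := fun z : (α × ℕ) × ℕ => (z.1.1, z.2)) (by fun_prop)))))
  have hfound : REPredFrom nm fun t (z : ((α × ℕ) × ℕ) × ℕ) => entry t (z.1.1, z.2) = z.1.2 + 1 :=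
    ComputableFrom.rePred_eq (hentry.reindex
      (g := fun z : ((α × ℕ) × ℕ) × ℕ => (z.1.1, z.2)) (by fun_prop))
      (.of_computable (g := fun z : ((α × ℕ) × ℕ) × ℕ => z.1.2 + 1) (by fun_prop))
  have hzero : REPredFrom nm fun t (z : ((α × ℕ) × ℕ) × ℕ) => ∀ k < z.2, entry t (z.1.1, k) = 0 :=
    REPredFrom.forall_lt (P := fun t (z : ((α × ℕ) × ℕ) × ℕ) k => entry t (z.1.1, k) = 0)
      (ComputableFrom.rePred_eq (hentry.reindex
      (g := fun z : (((α × ℕ) × ℕ) × ℕ) × ℕ => (z.1.1.1, z.2)) (by fun_prop))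
      (.of_computable (Computable.const 0)))
      (n := fun z => z.2) (by fun_prop)
  exact REPredFrom.congr (REPredFrom.exists (P := fun t (z : (α × ℕ) × ℕ) m =>
    entry t (z.1, m) = z.2 + 1 ∧ ∀ k < m, entry t (z.1, k) = 0) (hfound.and hzero))
    fun t z => (h t z.1.1).apply_eq_iff

end Relative

section NamedFrom

variable {T T' : Type*} {α β γ : Type} [Primcodable α] [Primcodable β] [Primcodable γ]
  {B C : Type*} {nm : T → Baire} {nm' : T' → Baire}

/-- The pairing `⟨p, q⟩` on Baire space, inverse to `left` and `right`. -/
def interleave (p q : Baire) : Baire := fun n => bif n % 2 = 0 then p (n / 2) else q (n / 2)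

theorem left_interleave (p q : Baire) : left (interleave p q) = p := by
  funext n
  simp [left, interleave]

theorem right_interleave (p q : Baire) : right (interleave p q) = q := by
  funext n
  simp [right, interleave, show (2 * n + 1) / 2 = n by omega]

theorem ComputableFrom.interleave {F G : T → α × ℕ → ℕ} (hF : ComputableFrom nm F)
    (hG : ComputableFrom nm G) :
    ComputableFrom nm fun t (z : α × ℕ) => interleave (fun k => F t (z.1, k))
      (fun k => G t (z.1, k)) z.2 :=
  ComputableFrom.cond (c := fun _ z => decide (z.2 % 2 = 0)) (.of_computable (by fun_prop))
    (hF.reindex (g := fun z : α × ℕ => (z.1, z.2 / 2)) (by fun_prop))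
    (hG.reindex (g := fun z : α × ℕ => (z.1, z.2 / 2)) (by fun_prop))

/-- A `δ`-name of the object `y t x` can be computed uniformly from a name `nm t` of the input `t`
and from the discrete parameter `x`. -/
def NamedFrom (nm : T → Baire) (δ : Naming B) (y : T → α → B) : Prop :=
  ∃ F : T → α × ℕ → ℕ, ComputableFrom nm F ∧ ∀ t a, δ (fun k => F t (a, k)) (y t a)

variable {δ : Naming B} {δ' : Naming C}

theorem NamedFrom.congr {y z : T → α → B} (h : NamedFrom nm δ y) (hyz : ∀ t a, z t a = y t a) :
    NamedFrom nm δ z := by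
  obtain rfl : z = y := funext₂ hyz
  exact h

theorem NamedFrom.comp {y : T → α → B} (h : NamedFrom nm δ y) {G : T → β → α}
    (hG : ComputableFrom nm G) :
    NamedFrom nm δ fun t b => y t (G t b) := by
  obtain ⟨F, hF, hFy⟩ := h
  exact ⟨fun t z => F t (G t z.1, z.2), hF.comp (ComputableFrom.pair (hG.reindex (by fun_prop))
    (.of_computable (by fun_prop))), fun t b => hFy t (G t b)⟩

theorem NamedFrom.reindex {y : T → α → B} (h : NamedFrom nm δ y) {g : β → α} (hg : Computable g) :
    NamedFrom nm δ fun t b => y t (g b) :=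
  h.comp (G := fun _ => g) (.of_computable hg)

theorem NamedFrom.prod {y : T → α → B} {z : T → α → C} (hy : NamedFrom nm δ y)
    (hz : NamedFrom nm δ' z) :
    NamedFrom nm (prodName δ δ') fun t a => (y t a, z t a) := by
  obtain ⟨F, hF, hFy⟩ := hy
  obtain ⟨G, hG, hGz⟩ := hz
  refine ⟨_, hF.interleave hG, fun t a => ⟨?_, ?_⟩⟩
  · simpa only [left_interleave] using hFy t a
  · simpa only [right_interleave] using hGz t a

theorem NamedFrom.meet {δ₁ δ₂ : Naming B} {y : T → α → B} (h₁ : NamedFrom nm δ₁ y)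
    (h₂ : NamedFrom nm δ₂ y) : NamedFrom nm (meetName δ₁ δ₂) y := by
  obtain ⟨F, hF, hFy⟩ := h₁
  obtain ⟨G, hG, hGz⟩ := h₂
  refine ⟨_, hF.interleave hG, fun t a => ⟨?_, ?_⟩⟩
  · simpa only [left_interleave] using hFy t a
  · simpa only [right_interleave] using hGz t a

theorem ComputableFrom.left {F : T → α × ℕ → ℕ} (hF : ComputableFrom nm F) :
    ComputableFrom nm fun t (z : α × ℕ) => left (fun k => F t (z.1, k)) z.2 :=
  hF.reindex (g := fun z : α × ℕ => (z.1, 2 * z.2)) (by fun_prop)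

theorem ComputableFrom.right {F : T → α × ℕ → ℕ} (hF : ComputableFrom nm F) :
    ComputableFrom nm fun t (z : α × ℕ) => right (fun k => F t (z.1, k)) z.2 :=
  hF.reindex (g := fun z : α × ℕ => (z.1, 2 * z.2 + 1)) (by fun_prop)

theorem NamedFrom.fst {y : T → α → B × C} (h : NamedFrom nm (prodName δ δ') y) :
    NamedFrom nm δ fun t a => (y t a).1 := by
  obtain ⟨F, hF, hFy⟩ := h
  exact ⟨_, hF.left, fun t a => (hFy t a).1⟩

theorem NamedFrom.snd {y : T → α → B × C} (h : NamedFrom nm (prodName δ δ') y) :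
    NamedFrom nm δ' fun t a => (y t a).2 := by
  obtain ⟨F, hF, hFy⟩ := h
  exact ⟨_, hF.right, fun t a => (hFy t a).2⟩

theorem NamedFrom.meet_left {δ₁ δ₂ : Naming B} {y : T → α → B}
    (h : NamedFrom nm (meetName δ₁ δ₂) y) :
    NamedFrom nm δ₁ y := by
  obtain ⟨F, hF, hFy⟩ := h
  exact ⟨_, hF.left, fun t a => (hFy t a).1⟩

theorem NamedFrom.meet_right {δ₁ δ₂ : Naming B} {y : T → α → B}
    (h : NamedFrom nm (meetName δ₁ δ₂) y) :
    NamedFrom nm δ₂ y := by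
  obtain ⟨F, hF, hFy⟩ := h
  exact ⟨_, hF.right, fun t a => (hFy t a).2⟩

theorem NamedFrom.seq {y : T → α → ℕ → B} (h : NamedFrom nm δ fun t (z : α × ℕ) => y t z.1 z.2) :
    NamedFrom nm (seqName δ) y := by
  obtain ⟨F, hF, hFy⟩ := h
  refine ⟨fun t z => F t ((z.1, z.2.unpair.1), z.2.unpair.2), hF.reindex (by fun_prop),
    fun t a i => ?_⟩
  unfold component
  simpa only [Nat.unpair_pair] using hFy t (a, i)

theorem NamedFrom.seq_apply {y : T → α → ℕ → B} (h : NamedFrom nm (seqName δ) y) :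
    NamedFrom nm δ fun t (z : α × ℕ) => y t z.1 z.2 := by
  obtain ⟨F, hF, hFy⟩ := h
  exact ⟨fun t z => F t (z.1.1, Nat.pair z.1.2 z.2), hF.reindex (by fun_prop),
    fun t a => hFy t a.1 a.2⟩

theorem NamedFrom.nat {F : T → α → ℕ} (hF : ComputableFrom nm F) : NamedFrom nm natName F :=
  ⟨fun t z => F t z.1, hF.reindex (by fun_prop), fun _ _ => rfl⟩

theorem NamedFrom.reduce {δ₁ δ₂ : Naming B} (hδ : Reducible δ₁ δ₂) {y : T → α → B}
    (h : NamedFrom nm δ₁ y) : NamedFrom nm δ₂ y := by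
  obtain ⟨e, he, hδ⟩ := hδ
  obtain ⟨F, hF, hFy⟩ := h
  choose R hR hRy using fun t a => hδ _ _ (hFy t a)
  exact ⟨fun t z => R t z.1 z.2, ComputableFrom.of_eta (A := fun _ z => e z.2)
    (ComputableFrom.of_computable
    (Computable.comp he Computable.snd)) hF hR, hRy⟩

theorem Operation.IsComputable.apply {f : Operation B C} (hf : f.IsComputable δ δ')
    {y : T → α → B} (h : NamedFrom nm δ y) (hdom : ∀ t a, y t a ∈ f.dom) :
    ∃ z : T → α → C, NamedFrom nm δ' z ∧ ∀ t a, z t a ∈ f.val (y t a) := by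
  obtain ⟨e, he, hf⟩ := hf
  obtain ⟨F, hF, hFy⟩ := h
  choose R hR z hz hRz using fun t a => hf _ (hdom t a) _ (hFy t a)
  exact ⟨z, ⟨fun t z => R t z.1 z.2, ComputableFrom.of_eta (A := fun _ z => e z.2)
    (ComputableFrom.of_computable
    (Computable.comp he Computable.snd)) hF hR, hRz⟩, hz⟩

/-- The inputs on which a realizer of `f` has to work: a point of the domain together with one of
its names. Computability of `f` is computability uniformly in the names of these inputs. -/
abbrev Operation.Input (f : Operation B C) (δ : Naming B) : Type _ :=
  {z : Baire × B // z.2 ∈ f.dom ∧ δ z.1 z.2}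

/-- The name that belongs to an input. -/
abbrev Operation.Input.name {f : Operation B C} {δ : Naming B} (t : f.Input δ) : Baire := t.1.1

theorem Operation.isComputable_of_named {f : Operation B C}
    (h : ∃ y : f.Input δ → Unit → C, NamedFrom Input.name δ' y ∧ ∀ t, y t () ∈ f.val t.1.2) :
    f.IsComputable δ δ' := by
  obtain ⟨y, ⟨F, hF, hFy⟩, hy⟩ := h
  obtain ⟨D, hD, hDm, hDF⟩ : ComputableFrom (Input.name (f := f) (δ := δ)) fun t k => F t ((), k) :=
    hF.reindex (by fun_prop)
  refine ⟨fun e => outputBelow (fun v => D (tablePrefix e, (e.unpair.1, v)))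
    (tablePrefix e).length, by fun_prop, fun x hx p hp => ?_⟩
  let t : f.Input δ := ⟨(p, x), hx, hp⟩
  refine ⟨fun k => F t ((), k), ?_, y t (), hy t, hFy t ()⟩
  refine eta_of_outputBelow (E := fun m n v => D (prefixOf p m, (n, v)))
    (fun n m => by simp only [tablePrefix_natPair, length_prefixOf, Nat.unpair_pair])
    (fun m n v h => ((hDF t (n, v)).2 ⟨m, h⟩).symm) fun n => ?_
  obtain ⟨m, hm⟩ := (hDF t (n, F t ((), n))).1 rfl
  filter_upwards [eventually_ge_atTop m] with m' hm'
  exact hDm (prefixOf_isPrefix p hm') hm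

theorem Operation.Input.named (f : Operation B C) (δ : Naming B) :
    NamedFrom (name (f := f) (δ := δ)) δ fun t (_ : Unit) => t.1.2 :=
  ⟨fun t z => t.name z.2, ComputableFrom.name.reindex (by fun_prop), fun t _ => t.2.2⟩

theorem REPredFrom.exists_prefix {D : List ℕ × γ → Bool} (hD : Computable D) {F : T → β × ℕ → ℕ}
    (hF : ComputableFrom nm F) :
    REPredFrom nm fun t (z : β × γ) => ∃ m, D (prefixOf (fun k => F t (z.1, k)) m, z.2) = true := by
  refine REPredFrom.exists (ComputableFrom.rePred_eq_true
    (ComputableFrom.map hD (ComputableFrom.pair ?_ (.of_computable (by fun_prop)))))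
  exact hF.prefixOf.reindex (g := fun z : (β × γ) × ℕ => (z.1.1, z.2)) (by fun_prop)

theorem REPredFrom.exists_pullback {P : T' → γ → Prop} (hP : REPredFrom nm' P) {S : T → β → Prop}
    (hS : REPredFrom nm S) (φ : ∀ t b, S t b → T') {F : T → β × ℕ → ℕ} (hF : ComputableFrom nm F)
    (h : ∀ t b hs k, nm' (φ t b hs) k = F t (b, k)) :
    REPredFrom nm fun t (z : β × γ) => ∃ hs : S t z.1, P (φ t z.1 hs) z.2 := by
  obtain ⟨D, hD, -, hDP⟩ := hP
  refine (REPredFrom.and (hS.reindex (g := fun z : β × γ => z.1) (by fun_prop))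
    (REPredFrom.exists_prefix hD hF)).congr fun t z => ?_
  constructor
  · rintro ⟨hs, hp⟩
    refine ⟨hs, ?_⟩
    simpa only [← h t z.1 hs] using (hDP _ _).1 hp
  · rintro ⟨hs, hp⟩
    refine ⟨hs, (hDP _ _).2 ?_⟩
    simpa only [← h t z.1 hs] using hp

theorem REPredFrom.pullback {P : T → γ → Prop} (hP : REPredFrom nm P) {φ : T' → T}
    (h : ComputableFrom nm' fun t k => nm (φ t) k) : REPredFrom nm' fun t x => P (φ t) x :=
  ((REPredFrom.exists_pullback hP (REPredFrom.const_true (α := Unit)) (fun t _ _ => φ t)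
    (F := fun t z => nm (φ t) z.2) (h.reindex (by fun_prop)) fun _ _ _ _ => rfl).reindex
    (g := fun x : γ => ((), x)) (by fun_prop)).congr fun t x => by simp

theorem ComputableFrom.pullback {F : T → β → γ} (hF : ComputableFrom nm F) {φ : T' → T}
    (h : ComputableFrom nm' fun t k => nm (φ t) k) : ComputableFrom nm' fun t x => F (φ t) x :=
  REPredFrom.pullback hF h

theorem NamedFrom.pullback {y : T → α → B} (hy : NamedFrom nm δ y) {φ : T' → T}
    (h : ComputableFrom nm' fun t k => nm (φ t) k) : NamedFrom nm' δ fun t a => y (φ t) a := by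
  obtain ⟨F, hF, hFy⟩ := hy
  exact ⟨_, hF.pullback h, fun t a => hFy (φ t) a⟩

theorem ComputableFrom.of_interleave_left {base : T' → T} {q : T' → Baire}
    (h : ∀ t, nm' t = TTE.interleave (q t) (nm (base t))) : ComputableFrom nm' fun t k => q t k :=
  (ComputableFrom.name.reindex (g := fun k => 2 * k) (by fun_prop)).congr fun t k => by
    rw [h, ← left_interleave (q t) (nm (base t))]
    simp [TTE.left, left_interleave]

theorem ComputableFrom.of_interleave_right {base : T' → T} {q : T' → Baire}
    (h : ∀ t, nm' t = TTE.interleave (q t) (nm (base t))) :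
    ComputableFrom nm' fun t k => nm (base t) k :=
  (ComputableFrom.name.reindex (g := fun k => 2 * k + 1) (by fun_prop)).congr fun t k => by
    rw [h, ← right_interleave (q t) (nm (base t))]
    simp [TTE.right, right_interleave]

theorem prefixOf_interleave {q q' p p' : Baire} {m : ℕ} (hq : ∀ i < m, q i = q' i)
    (hp : ∀ i < m, p i = p' i) : prefixOf (interleave q p) (2 * m) = prefixOf (interleave q' p')
      (2 * m) := by
  refine prefixOf_congr fun i hi => ?_
  simp only [interleave, hq (i / 2) (by omega), hp (i / 2) (by omega)]

/-- The entry `(n, w)` of the table for `Eta` runs the algorithm for `G` on the prefix `w` of `q t`,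
interleaved with equally many symbols of the name of `base t`. -/
theorem ComputableFrom.curry {base : T' → T} {q : T' → Baire}
    (h : ∀ t, nm' t = TTE.interleave (q t) (nm (base t))) {G : T' → ℕ → ℕ}
    (hG : ComputableFrom nm' G) :
    ∃ A : T → Unit × ℕ → ℕ, ComputableFrom nm A ∧
      ∀ t, Eta (fun k => A (base t) ((), k)) (q t) fun n => G t n := by
  obtain ⟨D, hD, hDm, hDG⟩ := hG
  let L (t : T) (e : ℕ) : List ℕ := prefixOf
    (TTE.interleave (fun i => (tablePrefix e).getD i 0) (nm t)) (2 * (tablePrefix e).length)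
  have hL : ComputableFrom nm L :=
    (ComputableFrom.interleave (F := fun _ (z : ℕ × ℕ) => (tablePrefix z.1).getD z.2 0)
      (G := fun t z => nm t z.2) (.of_computable (by fun_prop))
      (ComputableFrom.name.reindex (by fun_prop))).prefixOf.reindex
      (g := fun e => (e, 2 * (tablePrefix e).length)) (by fun_prop)
  have hL_eq (t n m) : L (base t) (Nat.pair n (Encodable.encode (prefixOf (q t) m))) =
      prefixOf (nm' t) (2 * m) := by
    simp only [L, tablePrefix_natPair, length_prefixOf, h]
    exact prefixOf_interleave (fun i hi => getD_prefixOf hi) fun _ _ => rfl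
  refine ⟨fun t z => outputBelow (fun v => D (L t z.2, (z.2.unpair.1, v)))
    (tablePrefix z.2).length, ?_, fun t => ?_⟩
  · exact .map (g := fun y : List ℕ × ℕ =>
      outputBelow (fun v => D (y.1, (y.2.unpair.1, v))) (tablePrefix y.2).length) (by fun_prop)
      (.pair (hL.reindex (by fun_prop)) (.of_computable (by fun_prop)))
  · refine eta_of_outputBelow (E := fun m n v => D (prefixOf (nm' t) (2 * m), (n, v)))
      (fun n m => by simp only [hL_eq, tablePrefix_natPair, length_prefixOf, Nat.unpair_pair])
      (fun m n v h => ((hDG t (n, v)).2 ⟨_, h⟩).symm) fun n => ?_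
    obtain ⟨m, hm⟩ := (hDG t (n, G t n)).1 rfl
    filter_upwards [eventually_ge_atTop m] with m' hm'
    exact hDm (prefixOf_isPrefix _ (by omega)) hm

end NamedFrom

/-- A code, for the numbering `rat`, of the rational number `(a - b) / (c + 1)`. -/
def ratCode (a b c : ℕ) : ℕ := Nat.pair (Nat.pair a b) c

theorem rat_ratCode (a b c : ℕ) : rat (ratCode a b c) = ((a : ℚ) - b) / (c + 1) := by
  simp [rat, ratCode]

theorem rat_surjective : Function.Surjective rat := by
  intro q
  obtain ⟨d, hd⟩ := Nat.exists_eq_succ_of_ne_zero q.den_pos.ne'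
  have hq : q = (q.num : ℚ) / ((d : ℚ) + 1) := by
    have h := (Rat.num_div_den q).symm
    rw [hd] at h
    push_cast at h
    exact h
  refine ⟨ratCode q.num.toNat (-q.num).toNat d, ?_⟩
  rw [rat_ratCode]
  conv_rhs => rw [hq]
  congr 1
  have : ((q.num.toNat : ℤ) - ((-q.num).toNat : ℤ)) = q.num := by omega
  exact_mod_cast this

theorem exists_rat_btwn_code {x y : ℝ} (h : x < y) : ∃ n, x < (rat n : ℚ) ∧ ((rat n : ℚ) : ℝ) < y :=
    by
  obtain ⟨q, hq⟩ := exists_rat_btwn h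
  obtain ⟨n, rfl⟩ := rat_surjective q
  exact ⟨n, hq⟩

/-- Addition of rational numbers on the codes of `rat`. -/
def ratAdd (n m : ℕ) : ℕ :=
  ratCode (n.unpair.1.unpair.1 * (m.unpair.2 + 1) + m.unpair.1.unpair.1 * (n.unpair.2 + 1))
    (n.unpair.1.unpair.2 * (m.unpair.2 + 1) + m.unpair.1.unpair.2 * (n.unpair.2 + 1))
    ((n.unpair.2 + 1) * (m.unpair.2 + 1) - 1)

theorem rat_ratAdd (n m : ℕ) : rat (ratAdd n m) = rat n + rat m := by
  rw [ratAdd, rat_ratCode]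
  have h : (((n.unpair.2 + 1) * (m.unpair.2 + 1) - 1 : ℕ) : ℚ) =
      ((n.unpair.2 : ℚ) + 1) * ((m.unpair.2 : ℚ) + 1) - 1 := by
    rw [Nat.cast_sub (Nat.succ_le_of_lt (by positivity))]
    push_cast
    ring
  rw [h]
  simp only [rat]
  push_cast
  rw [sub_add_cancel, div_add_div _ _ (by positivity) (by positivity)]
  congr 1
  ring

/-- Negation of rational numbers on the codes of `rat`. -/
def ratNeg (n : ℕ) : ℕ := ratCode n.unpair.1.unpair.2 n.unpair.1.unpair.1 n.unpair.2

theorem rat_ratNeg (n : ℕ) : rat (ratNeg n) = -rat n := by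
  rw [ratNeg, rat_ratCode, rat, ← neg_div, neg_sub]

/-- The order of the rational numbers on the codes of `rat`. -/
def ratLt (n m : ℕ) : Bool :=
  Nat.blt (n.unpair.1.unpair.1 * (m.unpair.2 + 1) + m.unpair.1.unpair.2 * (n.unpair.2 + 1))
    (m.unpair.1.unpair.1 * (n.unpair.2 + 1) + n.unpair.1.unpair.2 * (m.unpair.2 + 1))

theorem ratLt_iff {n m : ℕ} : ratLt n m = true ↔ rat n < rat m := by
  rw [ratLt, Nat.blt_eq, rat, rat, div_lt_div_iff₀ (by positivity) (by positivity),
    ← Nat.cast_lt (α := ℚ)]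
  push_cast
  constructor <;> intro h <;> linarith

/-- A code of `2⁻ᵏ` for the numbering `rat`. -/
def ratPow (k : ℕ) : ℕ := ratCode 1 0 (2 ^ k - 1)

theorem rat_ratPow (k : ℕ) : ((rat (ratPow k) : ℚ) : ℝ) = (2 : ℝ)⁻¹ ^ k := by
  rw [ratPow, rat_ratCode, Nat.cast_sub Nat.one_le_two_pow]
  simp

/-- The translation of codes from the numbering `posRat` to the numbering `rat`. -/
def ratPos (k : ℕ) : ℕ := ratCode (k.unpair.1 + 1) 0 k.unpair.2

theorem rat_ratPos (k : ℕ) : rat (ratPos k) = posRat k := by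
  rw [ratPos, rat_ratCode, posRat]
  simp

section RatCodes

variable {α : Type*} [Primcodable α] {f g h : α → ℕ}

@[fun_prop]
theorem computable_ratCode (hf : Computable f) (hg : Computable g) (hh : Computable h) :
    Computable fun x => ratCode (f x) (g x) (h x) := by unfold ratCode; fun_prop

@[fun_prop]
theorem computable_ratAdd (hf : Computable f) (hg : Computable g) :
    Computable fun x => ratAdd (f x) (g x) := by unfold ratAdd; fun_prop

@[fun_prop]
theorem computable_ratNeg (hf : Computable f) :
    Computable fun x => ratNeg (f x) := by unfold ratNeg; fun_prop

@[fun_prop]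
theorem computable_ratLt (hf : Computable f) (hg : Computable g) :
    Computable fun x => ratLt (f x) (g x) := by unfold ratLt; fun_prop

@[fun_prop]
theorem computable_ratPow (hf : Computable f) :
    Computable fun x => ratPow (f x) := by unfold ratPow; fun_prop

@[fun_prop]
theorem computable_ratPos (hf : Computable f) :
    Computable fun x => ratPos (f x) := by unfold ratPos; fun_prop

end RatCodes

section Real

variable {T : Type*} {α β : Type} [Primcodable α] [Primcodable β] {nm : T → Baire}

/-- The real number `f t x` is computable uniformly in a name `nm t` of the input `t` and in the
discrete parameter `x`: its lower and its upper rational cut are recursively enumerable. -/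
def ComputableRealFrom (nm : T → Baire) (f : T → α → ℝ) : Prop :=
  (REPredFrom nm fun t (z : α × ℕ) => ((rat z.2 : ℚ) : ℝ) < f t z.1) ∧
    REPredFrom nm fun t (z : α × ℕ) => f t z.1 < ((rat z.2 : ℚ) : ℝ)

theorem ComputableRealFrom.congr {f g : T → α → ℝ} (hf : ComputableRealFrom nm f)
    (h : ∀ t x, g t x = f t x) : ComputableRealFrom nm g := by
  obtain rfl : g = f := funext₂ h
  exact hf

theorem ComputableRealFrom.comp {f : T → β → ℝ} (hf : ComputableRealFrom nm f) {G : T → α → β}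
    (hG : ComputableFrom nm G) :
    ComputableRealFrom nm fun t x => f t (G t x) := by
  have h : ComputableFrom nm fun t (z : α × ℕ) => (G t z.1, z.2) :=
    ComputableFrom.pair (hG.reindex (by fun_prop)) (.of_computable (by fun_prop))
  have hlower := hf.1.comp h
  have hupper := hf.2.comp h
  exact ⟨hlower, hupper⟩

theorem ComputableRealFrom.reindex {f : T → β → ℝ} (hf : ComputableRealFrom nm f) {g : α → β}
    (hg : Computable g) :
    ComputableRealFrom nm fun t x => f t (g x) :=
  hf.comp (G := fun _ => g) (.of_computable hg)

theorem ComputableRealFrom.of_rat {G : T → α → ℕ} (hG : ComputableFrom nm G) : ComputableRealFrom nm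
    fun t x => ((rat (G t x) : ℚ) : ℝ) := by
  constructor
  · refine (ComputableFrom.rePred_eq_true (ComputableFrom.map₂ (g := fun a b : ℕ => ratLt a b)
    (by fun_prop)
      (.of_computable (g := fun z : α × ℕ => z.2) (by fun_prop))
      (hG.reindex (g := fun z : α × ℕ => z.1) (by fun_prop)))).congr fun t z => ?_
    rw [ratLt_iff, Rat.cast_lt]
  · refine (ComputableFrom.rePred_eq_true (ComputableFrom.map₂ (g := fun a b : ℕ => ratLt a b)
    (by fun_prop)
      (hG.reindex (g := fun z : α × ℕ => z.1) (by fun_prop))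
      (.of_computable (g := fun z : α × ℕ => z.2) (by fun_prop)))).congr fun t z => ?_
    rw [ratLt_iff, Rat.cast_lt]

theorem ComputableRealFrom.pow {G : T → α → ℕ} (hG : ComputableFrom nm G) : ComputableRealFrom nm
    fun t x => (2 : ℝ)⁻¹ ^ G t x :=
  (ComputableRealFrom.of_rat (ComputableFrom.map (g := ratPow) (by fun_prop) hG)).congr fun _ _ =>
    (rat_ratPow _).symm

theorem ComputableRealFrom.of_posRat {G : T → α → ℕ} (hG : ComputableFrom nm G) :
    ComputableRealFrom nm fun t x => ((posRat (G t x) : ℚ) : ℝ) :=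
  (ComputableRealFrom.of_rat (ComputableFrom.map (g := ratPos) (by fun_prop) hG)).congr
    fun _ _ => by rw [rat_ratPos]

theorem ComputableRealFrom.zero : ComputableRealFrom nm fun _ (_ : α) => (0 : ℝ) :=
  (ComputableRealFrom.of_rat (G := fun _ _ => ratCode 0 0 0) (.of_computable (by fun_prop))).congr
    fun _ _ => by simp [rat_ratCode]

theorem ComputableRealFrom.lt {f g : T → α → ℝ} (hf : ComputableRealFrom nm f)
    (hg : ComputableRealFrom nm g) :
    REPredFrom nm fun t x => f t x < g t x :=
  (REPredFrom.exists (hf.2.and hg.1)).congr fun _ _ => ⟨fun h => exists_rat_btwn_code h,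
    fun ⟨_, h1, h2⟩ => h1.trans h2⟩

theorem ComputableRealFrom.neg {f : T → α → ℝ}
    (hf : ComputableRealFrom nm f) : ComputableRealFrom nm fun t x => -f t x := by
  constructor
  · refine (hf.2.reindex (g := fun z : α × ℕ => (z.1, ratNeg z.2)) (by fun_prop)).congr
      fun t z => ?_
    rw [rat_ratNeg, Rat.cast_neg, lt_neg]
  · refine (hf.1.reindex (g := fun z : α × ℕ => (z.1, ratNeg z.2)) (by fun_prop)).congr
      fun t z => ?_
    rw [rat_ratNeg, Rat.cast_neg, neg_lt]

theorem REPredFrom.rat_lt_add {f g : T → α → ℝ} (hf : ComputableRealFrom nm f)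
    (hg : ComputableRealFrom nm g) :
    REPredFrom nm fun t (z : α × ℕ) => ((rat z.2 : ℚ) : ℝ) < f t z.1 + g t z.1 := by
  have hsplit : REPredFrom nm fun t (z : α × ℕ) => ∃ n, ((rat n : ℚ) : ℝ) < f t z.1 ∧
      ((rat (ratAdd z.2 (ratNeg n)) : ℚ) : ℝ) < g t z.1 :=
    .exists (.and (hf.1.reindex (g := fun z : (α × ℕ) × ℕ => (z.1.1, z.2)) (by fun_prop))
      (hg.1.reindex (g := fun z : (α × ℕ) × ℕ => (z.1.1, ratAdd z.1.2 (ratNeg z.2)))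
        (by fun_prop)))
  refine hsplit.congr fun t z => ?_
  simp only [rat_ratAdd, rat_ratNeg, Rat.cast_add, Rat.cast_neg]
  constructor
  · intro h
    obtain ⟨n, hgn, hnf⟩ := exists_rat_btwn_code
      (show ((rat z.2 : ℚ) : ℝ) - g t z.1 < f t z.1 by linarith)
    exact ⟨n, hnf, by linarith⟩
  · rintro ⟨n, hnf, hng⟩
    linarith

theorem ComputableRealFrom.add {f g : T → α → ℝ} (hf : ComputableRealFrom nm f)
    (hg : ComputableRealFrom nm g) : ComputableRealFrom nm fun t x => f t x + g t x := by
  refine ⟨.rat_lt_add hf hg, ((REPredFrom.rat_lt_add hf.neg hg.neg).reindex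
    (g := fun z : α × ℕ => (z.1, ratNeg z.2)) (by fun_prop)).congr fun t z => ?_⟩
  rw [rat_ratNeg, Rat.cast_neg, ← neg_add, neg_lt_neg_iff]

theorem ComputableRealFrom.sub {f g : T → α → ℝ} (hf : ComputableRealFrom nm f)
    (hg : ComputableRealFrom nm g) :
    ComputableRealFrom nm fun t x => f t x - g t x :=
  (hf.add hg.neg).congr fun _ _ => sub_eq_add_neg _ _

theorem exists_pow_lt {ε : ℝ} (h : 0 < ε) : ∃ k, (2 : ℝ)⁻¹ ^ k < ε :=
  exists_pow_lt_of_lt_one h (by norm_num)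

theorem REPredFrom.rat_lt_of_approx {f : T → α → ℝ} {g : T → α → ℕ → ℝ}
    (hg : ComputableRealFrom nm fun t (z : α × ℕ) => g t z.1 z.2)
    (h : ∀ t x k, |f t x - g t x k| ≤ 2 * (2 : ℝ)⁻¹ ^ k) :
    REPredFrom nm fun t (z : α × ℕ) => ((rat z.2 : ℚ) : ℝ) < f t z.1 := by
  have hpow : ComputableRealFrom nm fun (_ : T) (z : (α × ℕ) × ℕ) => (2 : ℝ)⁻¹ ^ z.2 :=
    .pow (.of_computable (by fun_prop))
  have hg' : ComputableRealFrom nm fun t (z : (α × ℕ) × ℕ) => g t z.1.1 z.2 :=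
    hg.reindex (g := fun z : (α × ℕ) × ℕ => (z.1.1, z.2)) (by fun_prop)
  have hrat : ComputableRealFrom nm fun (_ : T) (z : (α × ℕ) × ℕ) => ((rat z.1.2 : ℚ) : ℝ) :=
    .of_rat (.of_computable (by fun_prop))
  refine (REPredFrom.exists (P := fun t (z : α × ℕ) k => ((rat z.2 : ℚ) : ℝ) <
    g t z.1 k - ((2 : ℝ)⁻¹ ^ k + (2 : ℝ)⁻¹ ^ k)) (hrat.lt (hg'.sub (hpow.add hpow)))).congr
    fun t z => ⟨fun hz => ?_, ?_⟩
  · obtain ⟨k, hk⟩ := exists_pow_lt (show 0 < (f t z.1 - rat z.2) / 4 by linarith)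
    have := abs_le.1 (h t z.1 k)
    exact ⟨k, by linarith⟩
  · rintro ⟨k, hk⟩
    have := abs_le.1 (h t z.1 k)
    linarith

theorem ComputableRealFrom.of_approx {f : T → α → ℝ} {g : T → α → ℕ → ℝ}
    (hg : ComputableRealFrom nm fun t (z : α × ℕ) => g t z.1 z.2)
    (h : ∀ t x k, |f t x - g t x k| ≤ 2 * (2 : ℝ)⁻¹ ^ k) : ComputableRealFrom nm f := by
  have hneg : REPredFrom nm fun t (z : α × ℕ) => ((rat z.2 : ℚ) : ℝ) < -f t z.1 :=
    .rat_lt_of_approx (f := fun t x => -f t x) (g := fun t x k => -g t x k) hg.neg fun t x k => by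
      rw [neg_sub_neg, abs_sub_comm]
      exact h t x k
  refine ⟨.rat_lt_of_approx hg h, (hneg.reindex (g := fun z : α × ℕ => (z.1, ratNeg z.2))
    (by fun_prop)).congr fun t z => ?_⟩
  rw [rat_ratNeg, Rat.cast_neg, neg_lt_neg_iff]

end Real

section Metric

variable {X : Type*} [MetricSpace X] {ν : ℕ → X}

theorem cauchyName.dist_le {p : Baire} {x : X} (h : cauchyName ν p x) (i : ℕ) :
    dist (ν (p i)) x ≤ (2 : ℝ)⁻¹ ^ i := by
  refine le_of_tendsto (tendsto_const_nhds.dist h.2) (eventually_atTop.2 ⟨i, fun j hj => ?_⟩)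
  simpa only [min_eq_left hj] using (h.1 i j).le

theorem cauchyName_of_lt {p : Baire} {x : X} (h : ∀ i, dist (ν (p i)) x < (2 : ℝ)⁻¹ ^ (i + 1)) :
    cauchyName ν p x := by
  constructor
  · intro i j
    have hhalf : ∀ i, dist (ν (p i)) x < (2 : ℝ)⁻¹ ^ i / 2 := fun i => by
      have := h i
      rw [pow_succ] at this
      linarith
    have hi : (2 : ℝ)⁻¹ ^ i ≤ (2 : ℝ)⁻¹ ^ min i j :=
      pow_le_pow_of_le_one (by norm_num) (by norm_num) (min_le_left _ _)
    have hj : (2 : ℝ)⁻¹ ^ j ≤ (2 : ℝ)⁻¹ ^ min i j :=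
      pow_le_pow_of_le_one (by norm_num) (by norm_num) (min_le_right _ _)
    have := dist_triangle_right (ν (p i)) (ν (p j)) x
    linarith [hhalf i, hhalf j]
  · rw [tendsto_iff_dist_tendsto_zero]
    refine squeeze_zero (fun _ => dist_nonneg) (fun i => (h i).le) ?_
    exact (tendsto_pow_atTop_nhds_zero_of_lt_one (by norm_num)
      (by norm_num : (2 : ℝ)⁻¹ < 1)).comp (tendsto_add_atTop_nat 1)

theorem cauchyName_const (i : ℕ) : cauchyName ν (fun _ => i) (ν i) :=
  cauchyName_of_lt fun _ => by rw [dist_self]; positivity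

theorem exists_cauchyName (hν : DenseRange ν) (x : X) : ∃ p, cauchyName ν p x := by
  have h : ∀ i : ℕ, ∃ n, dist (ν n) x < (2 : ℝ)⁻¹ ^ (i + 1) := fun i => by
    obtain ⟨n, hn⟩ := hν.exists_dist_lt x (show (0 : ℝ) < 2⁻¹ ^ (i + 1) by positivity)
    exact ⟨n, by rwa [dist_comm]⟩
  choose p hp using h
  exact ⟨p, cauchyName_of_lt hp⟩

theorem mem_idealBall {z : X} {c : ℕ} :
    z ∈ idealBall ν c ↔ dist z (ν c.unpair.1) < ((posRat c.unpair.2 : ℚ) : ℝ) := Iff.rfl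

theorem exists_idealBall (hν : DenseRange ν) (z : X) {ε : ℝ} (hε : 0 < ε) :
    ∃ c, z ∈ idealBall ν c ∧ dist z (ν c.unpair.1) < ε ∧ ((posRat c.unpair.2 : ℚ) : ℝ) < ε := by
  obtain ⟨k, hk⟩ := exists_nat_one_div_lt hε
  have hr : ((posRat (Nat.pair 0 k) : ℚ) : ℝ) = 1 / ((k : ℝ) + 1) := by simp [posRat]
  obtain ⟨n, hn⟩ := hν.exists_dist_lt z (show 0 < 1 / ((k : ℝ) + 1) by positivity)
  refine ⟨Nat.pair n (Nat.pair 0 k), ?_, ?_, ?_⟩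
  · rw [mem_idealBall]
    simpa only [Nat.unpair_pair, hr] using hn
  · simpa only [Nat.unpair_pair] using hn.trans hk
  · simpa only [Nat.unpair_pair, hr] using hk

theorem isOpen_of_openName {p : Baire} {U : Set X} (h : openName ν p U) : IsOpen U := by
  rw [show U = _ from h]
  exact isOpen_biUnion fun _ _ => Metric.isOpen_ball

variable {T : Type*} {α β : Type} [Primcodable α] [Primcodable β] {nm : T → Baire}

theorem NamedFrom.isOpen {U : T → α → Set X} (h : NamedFrom nm (openName ν) U) (t : T) (a : α) :
    IsOpen (U t a) := by
  obtain ⟨F, -, hF⟩ := h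
  exact isOpen_of_openName (hF t a)

theorem ComputableRealFrom.dist_dense (hν : IsComputableMetricSpace ν) :
    ComputableRealFrom nm fun _ (z : ℕ × ℕ) => dist (ν z.1) (ν z.2) := by
  obtain ⟨f, hf, hfd⟩ := hν.computable_dist
  refine ComputableRealFrom.of_approx (g := fun _ z k => ((rat (f (z.1, z.2, k)) : ℚ) : ℝ))
    (.of_rat (.of_computable (by fun_prop))) fun _ x k => (hfd x.1 x.2 k).trans ?_
  have : (0 : ℝ) < 2⁻¹ ^ k := by positivity
  linarith

theorem ComputableRealFrom.dist (hν : IsComputableMetricSpace ν) {x y : T → α → X}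
    (hx : NamedFrom nm (cauchyName ν) x) (hy : NamedFrom nm (cauchyName ν) y) :
    ComputableRealFrom nm fun t a => dist (x t a) (y t a) := by
  obtain ⟨F, hF, hFx⟩ := hx
  obtain ⟨G, hG, hGy⟩ := hy
  refine ComputableRealFrom.of_approx
    (g := fun t a k => Dist.dist (ν (F t (a, k))) (ν (G t (a, k))))
    ((ComputableRealFrom.dist_dense hν).comp (hF.pair hG)) fun t a k => ?_
  have hxk := (hFx t a).dist_le k
  have hyk := (hGy t a).dist_le k
  have hdist := dist_dist_dist_le (x t a) (y t a) (ν (F t (a, k))) (ν (G t (a, k)))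
  rw [Real.dist_eq] at hdist
  rw [dist_comm] at hxk hyk
  linarith

theorem NamedFrom.dense {G : T → α → ℕ} (hG : ComputableFrom nm G) :
    NamedFrom nm (cauchyName ν) fun t a => ν (G t a) :=
  ⟨fun t z => G t z.1, hG.reindex (by fun_prop), fun t a => cauchyName_const (G t a)⟩

theorem NamedFrom.openName_of_rePred {E : T → α × ℕ → Prop} (hE : REPredFrom nm E)
    {U : T → α → Set X} (hsub : ∀ t a c, E t (a, c) → idealBall ν c ⊆ U t a)
    (hcover : ∀ t a, ∀ z ∈ U t a, ∃ c, E t (a, c) ∧ z ∈ idealBall ν c) :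
    NamedFrom nm (openName ν) U := by
  obtain ⟨F, hF, hFE⟩ := hE.exists_enumeration
  refine ⟨F, hF, fun t a => Subset.antisymm (fun z hz => ?_) (iUnion₂_subset fun c hc => ?_)⟩
  · obtain ⟨c, hc, hzc⟩ := hcover t a z hz
    exact mem_iUnion₂.2 ⟨c, (hFE t a c).1 hc, hzc⟩
  · exact hsub t a c ((hFE t a c).2 hc)

theorem NamedFrom.exists_rePred {U : T → α → Set X} (h : NamedFrom nm (openName ν) U) :
    ∃ E : T → α × ℕ → Prop, REPredFrom nm E ∧
      ∀ t a z, z ∈ U t a ↔ ∃ c, E t (a, c) ∧ z ∈ idealBall ν c := by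
  obtain ⟨F, hF, hFU⟩ := h
  refine ⟨fun t z => ∃ i, F t (z.1, i) = z.2 + 1, ?_, fun t a z => ?_⟩
  · exact REPredFrom.exists (ComputableFrom.rePred_eq
      (hF.reindex (g := fun z : (α × ℕ) × ℕ => (z.1.1, z.2)) (by fun_prop))
      (.of_computable (by fun_prop)))
  · rw [show U t a = _ from hFU t a]
    simp only [mem_iUnion₂, mem_ofPred_eq, exists_prop]

theorem ComputableRealFrom.radius {G : T → α → ℕ} (hG : ComputableFrom nm G) :
    ComputableRealFrom nm fun t a => ((posRat (G t a).unpair.2 : ℚ) : ℝ) :=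
  ComputableRealFrom.of_posRat (ComputableFrom.map (g := fun c => c.unpair.2) (by fun_prop) hG)

theorem ComputableRealFrom.dist_center (hν : IsComputableMetricSpace ν) {x : T → α → X}
    {G : T → α → ℕ} (hx : NamedFrom nm (cauchyName ν) x) (hG : ComputableFrom nm G) :
    ComputableRealFrom nm fun t a => Dist.dist (x t a) (ν (G t a).unpair.1) :=
  ComputableRealFrom.dist hν hx (NamedFrom.dense
    (ComputableFrom.map (g := fun c => c.unpair.1) (by fun_prop) hG))

theorem REPredFrom.mem (hν : IsComputableMetricSpace ν) {U : T → α → Set X}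
    (h : NamedFrom nm (openName ν) U) {x : T → α → X} (hx : NamedFrom nm (cauchyName ν) x) :
    REPredFrom nm fun t a => x t a ∈ U t a := by
  obtain ⟨E, hE, hEU⟩ := h.exists_rePred
  have hc : ComputableFrom nm fun (_ : T) (z : α × ℕ) => z.2 :=
    ComputableFrom.of_computable (by fun_prop)
  exact (REPredFrom.exists (P := fun t a c => E t (a, c) ∧ x t a ∈ idealBall ν c)
    (REPredFrom.and hE ((ComputableRealFrom.dist_center hν (hx.reindex (by fun_prop)) hc).lt
      (ComputableRealFrom.radius hc)))).congr fun t a => hEU t a (x t a)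

theorem NamedFrom.ball (hν : IsComputableMetricSpace ν) {x : T → α → X} {r : T → α → ℝ}
    (hx : NamedFrom nm (cauchyName ν) x) (hr : ComputableRealFrom nm r) :
    NamedFrom nm (openName ν) fun t a => Metric.ball (x t a) (r t a) := by
  have hc : ComputableFrom nm fun (_ : T) (z : α × ℕ) => z.2 :=
    ComputableFrom.of_computable (by fun_prop)
  have hdist := ComputableRealFrom.dist_center hν
    (hx.reindex (g := fun z : α × ℕ => z.1) (by fun_prop)) hc
  refine NamedFrom.openName_of_rePred ((hdist.add (ComputableRealFrom.radius hc)).lt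
    (hr.reindex (g := fun z : α × ℕ => z.1) (by fun_prop)))
    (fun t a c hc z hz => ?_) fun t a z hz => ?_
  · rw [mem_idealBall] at hz
    rw [Metric.mem_ball]
    have := dist_triangle_right z (x t a) (ν c.unpair.1)
    simp only at hc
    linarith
  · rw [Metric.mem_ball] at hz
    obtain ⟨c, hzc, hcenter, hradius⟩ := exists_idealBall hν.dense z
      (show 0 < (r t a - Dist.dist z (x t a)) / 2 by linarith)
    refine ⟨c, ?_, hzc⟩
    have := dist_triangle_left (x t a) (ν c.unpair.1) z
    simp only
    linarith

theorem NamedFrom.setOf_lt_dist (hν : IsComputableMetricSpace ν) {x : T → α → X} {r : T → α → ℝ}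
    (hx : NamedFrom nm (cauchyName ν) x) (hr : ComputableRealFrom nm r) :
    NamedFrom nm (openName ν) fun t a => {z | r t a < dist (x t a) z} := by
  have hc : ComputableFrom nm fun (_ : T) (z : α × ℕ) => z.2 :=
    ComputableFrom.of_computable (by fun_prop)
  have hdist := ComputableRealFrom.dist_center hν
    (hx.reindex (g := fun z : α × ℕ => z.1) (by fun_prop)) hc
  refine NamedFrom.openName_of_rePred (((hr.reindex (g := fun z : α × ℕ => z.1)
    (by fun_prop)).add (ComputableRealFrom.radius hc)).lt hdist)
    (fun t a c hc z hz => ?_) fun t a z hz => ?_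
  · rw [mem_idealBall] at hz
    rw [mem_ofPred_eq]
    have := dist_triangle (x t a) z (ν c.unpair.1)
    simp only at hc
    linarith
  · rw [mem_ofPred_eq] at hz
    obtain ⟨c, hzc, hcenter, hradius⟩ := exists_idealBall hν.dense z
      (show 0 < (Dist.dist (x t a) z - r t a) / 2 by linarith)
    refine ⟨c, ?_, hzc⟩
    have := dist_triangle_right (x t a) z (ν c.unpair.1)
    simp only
    linarith

theorem NamedFrom.biUnion {P : T → α → β → Prop}
    (hP : REPredFrom nm fun t (z : α × β) => P t z.1 z.2)
    {U : T → α → β → Set X} (hU : NamedFrom nm (openName ν) fun t (z : α × β) => U t z.1 z.2) :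
    NamedFrom nm (openName ν) fun t a => {z | ∃ b, P t a b ∧ z ∈ U t a b} := by
  obtain ⟨E, hE, hEU⟩ := hU.exists_rePred
  refine NamedFrom.openName_of_rePred (E := fun t z => ∃ b, P t z.1 b ∧ E t ((z.1, b), z.2)) ?_
    (fun t a c hc z hz => ?_) fun t a z hz => ?_
  · refine REPredFrom.exists (REPredFrom.and ?_ ?_)
    · exact hP.reindex (g := fun z : (α × ℕ) × β => (z.1.1, z.2)) (by fun_prop)
    · exact hE.reindex (by fun_prop)
  · obtain ⟨b, hb, hc⟩ := hc
    exact ⟨b, hb, (hEU t (a, b) z).2 ⟨c, hc, hz⟩⟩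
  · obtain ⟨b, hb, hz⟩ := hz
    obtain ⟨c, hc, hz⟩ := (hEU t (a, b) z).1 hz
    exact ⟨c, ⟨b, hb, hc⟩, hz⟩

theorem NamedFrom.sep {P : T → α → Prop} (hP : REPredFrom nm P) {U : T → α → Set X}
    (hU : NamedFrom nm (openName ν) U) :
    NamedFrom nm (openName ν) fun t a => {z | P t a ∧ z ∈ U t a} :=
  (NamedFrom.biUnion (β := Unit) (P := fun t a _ => P t a) (U := fun t a _ => U t a)
    (hP.reindex (by fun_prop)) (hU.reindex (by fun_prop))).congr fun t a => by simp

theorem NamedFrom.whole (hν : DenseRange ν) :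
    NamedFrom nm (openName ν) fun _ (_ : α) => (Set.univ : Set X) :=
  NamedFrom.openName_of_rePred (REPredFrom.const_true) (fun _ _ _ _ => subset_univ _) fun _ _ z _ =>
    let ⟨c, hc, _⟩ := exists_idealBall hν z one_pos
    ⟨c, trivial, hc⟩

theorem NamedFrom.union {U V : T → α → Set X} (hU : NamedFrom nm (openName ν) U)
    (hV : NamedFrom nm (openName ν) V) : NamedFrom nm (openName ν) fun t a => U t a ∪ V t a := by
  obtain ⟨E, hE, hEU⟩ := hU.exists_rePred
  obtain ⟨F, hF, hFV⟩ := hV.exists_rePred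
  refine NamedFrom.openName_of_rePred (hE.or hF) (fun t a c hc z hz => ?_) fun t a z hz => ?_
  · exact hc.imp (fun hc => (hEU t a z).2 ⟨c, hc, hz⟩) fun hc => (hFV t a z).2 ⟨c, hc, hz⟩
  · rcases hz with hz | hz
    · obtain ⟨c, hc, hz⟩ := (hEU t a z).1 hz
      exact ⟨c, Or.inl hc, hz⟩
    · obtain ⟨c, hc, hz⟩ := (hFV t a z).1 hz
      exact ⟨c, Or.inr hc, hz⟩

/-- Formal inclusion of ideal balls: the condition on centres and radii which, by the triangle
inequality, forces `idealBall ν c ⊆ idealBall ν c'`. Unlike inclusion it is recursively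
enumerable. -/
def FormallyIncluded (ν : ℕ → X) (c c' : ℕ) : Prop :=
  dist (ν c.unpair.1) (ν c'.unpair.1) + ((posRat c.unpair.2 : ℚ) : ℝ) <
    ((posRat c'.unpair.2 : ℚ) : ℝ)

theorem FormallyIncluded.subset {c c' : ℕ} (h : FormallyIncluded ν c c') :
    idealBall ν c ⊆ idealBall ν c' := by
  refine Metric.ball_subset ?_
  rw [FormallyIncluded] at h
  linarith

theorem REPredFrom.formallyIncluded (hν : IsComputableMetricSpace ν) :
    REPredFrom nm fun _ (z : ℕ × ℕ) => FormallyIncluded ν z.1 z.2 := by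
  have hdist : ComputableRealFrom nm fun (_ : T) (z : ℕ × ℕ) =>
      Dist.dist (ν z.1.unpair.1) (ν z.2.unpair.1) :=
    (ComputableRealFrom.dist_dense hν).reindex
      (g := fun z : ℕ × ℕ => (z.1.unpair.1, z.2.unpair.1)) (by fun_prop)
  have hfst : ComputableFrom nm fun (_ : T) (z : ℕ × ℕ) => z.1 := .of_computable (by fun_prop)
  have hsnd : ComputableFrom nm fun (_ : T) (z : ℕ × ℕ) => z.2 := .of_computable (by fun_prop)
  exact (hdist.add (.radius hfst)).lt (.radius hsnd)

theorem exists_pos_forall_lt_add_le {f g : ℕ → ℝ} {n : ℕ} (h : ∀ i < n, f i < g i) :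
    ∃ ε > 0, ∀ i < n, f i + ε ≤ g i := by
  have hsmall : ∀ᶠ ε in 𝓝[>] (0 : ℝ), ∀ i ∈ Finset.range n, f i + ε ≤ g i := by
    refine (Filter.eventually_all_finset _).2 fun i hi => ?_
    filter_upwards [Ioc_mem_nhdsGT (sub_pos.2 (h i (Finset.mem_range.1 hi)))] with ε hε
    linarith [hε.2]
  obtain ⟨ε, hε, hpos⟩ := (hsmall.and self_mem_nhdsWithin).exists
  exact ⟨ε, hpos, fun i hi => hε i (Finset.mem_range.2 hi)⟩

theorem exists_formallyIncluded (hν : DenseRange ν) {z : X} {n : ℕ} {c' : ℕ → ℕ}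
    (h : ∀ i < n, z ∈ idealBall ν (c' i)) :
    ∃ c, z ∈ idealBall ν c ∧ ∀ i < n, FormallyIncluded ν c (c' i) := by
  obtain ⟨ε, hε, hle⟩ := exists_pos_forall_lt_add_le h
  obtain ⟨c, hzc, hcenter, hradius⟩ := exists_idealBall hν z (half_pos hε)
  refine ⟨c, hzc, fun i hi => ?_⟩
  have := dist_triangle_left (ν c.unpair.1) (ν (c' i).unpair.1) z
  have := hle i hi
  rw [FormallyIncluded]
  linarith

theorem NamedFrom.biInter (hν : IsComputableMetricSpace ν) {n : T → α → ℕ}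
    (hn : ComputableFrom nm n) {U : T → α → ℕ → Set X}
    (hU : NamedFrom nm (openName ν) fun t (z : α × ℕ) => U t z.1 z.2) :
    NamedFrom nm (openName ν) fun t a => {z | ∀ i < n t a, z ∈ U t a i} := by
  suffices h : NamedFrom nm (openName ν) fun t (y : α × ℕ) => {z | ∀ i < y.2, z ∈ U t y.1 i} from
    h.comp (G := fun t a => (a, n t a)) (.pair (.of_computable (by fun_prop)) hn)
  obtain ⟨E, hE, hEU⟩ := hU.exists_rePred
  have hincl : REPredFrom nm fun t (y : ((α × ℕ) × ℕ) × ℕ) =>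
      ∃ c', E t ((y.1.1.1, y.2), c') ∧ FormallyIncluded ν y.1.2 c' :=
    REPredFrom.exists (.and (hE.reindex (by fun_prop)) ((REPredFrom.formallyIncluded hν).reindex
      (g := fun y : (((α × ℕ) × ℕ) × ℕ) × ℕ => (y.1.1.2, y.2)) (by fun_prop)))
  refine NamedFrom.openName_of_rePred (REPredFrom.forall_lt (P := fun t (y : (α × ℕ) × ℕ) i =>
      ∃ c', E t ((y.1.1, i), c') ∧ FormallyIncluded ν y.2 c') hincl
    (n := fun y : (α × ℕ) × ℕ => y.1.2) (by fun_prop)) (fun t a c hc z hz i hi => ?_)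
    fun t a z hz => ?_
  · obtain ⟨c', hc', hcc⟩ := hc i hi
    exact (hEU t (a.1, i) z).2 ⟨c', hc', hcc.subset hz⟩
  · have hcode : ∀ i, ∃ c', i < a.2 → E t ((a.1, i), c') ∧ z ∈ idealBall ν c' := fun i => by
      by_cases hi : i < a.2
      · obtain ⟨c', hc'⟩ := (hEU t (a.1, i) z).1 (hz i hi)
        exact ⟨c', fun _ => hc'⟩
      · exact ⟨0, fun h => absurd h hi⟩
    choose c' hc' using hcode
    obtain ⟨c, hzc, hcc⟩ := exists_formallyIncluded hν.dense fun i hi => (hc' i hi).2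
    exact ⟨c, fun i hi => ⟨c' i, (hc' i hi).1, hcc i hi⟩, hzc⟩

theorem NamedFrom.inter (hν : IsComputableMetricSpace ν) {U V : T → α → Set X}
    (hU : NamedFrom nm (openName ν) U) (hV : NamedFrom nm (openName ν) V) :
    NamedFrom nm (openName ν) fun t a => U t a ∩ V t a := by
  have h : NamedFrom nm (openName ν) fun t (y : α × ℕ) =>
      {z | y.2 = 0 ∧ z ∈ U t y.1} ∪ {z | y.2 ≠ 0 ∧ z ∈ V t y.1} :=
    (NamedFrom.sep (ComputableFrom.rePred_eq (.of_computable (by fun_prop))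
      (.of_computable (by fun_prop))) (hU.reindex (by fun_prop))).union
    (NamedFrom.sep (ComputableFrom.rePred_ne (.of_computable (by fun_prop))
      (.of_computable (by fun_prop))) (hV.reindex (by fun_prop)))
  refine (NamedFrom.biInter hν (n := fun _ _ => 2) (.of_computable (by fun_prop))
    (U := fun t a i => {z | i = 0 ∧ z ∈ U t a} ∪ {z | i ≠ 0 ∧ z ∈ V t a}) h).congr
    fun t a => ?_
  ext z
  constructor
  · rintro ⟨hu, hv⟩ i -
    by_cases h0 : i = 0
    · exact Or.inl ⟨h0, hu⟩
    · exact Or.inr ⟨h0, hv⟩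
  · intro hz
    exact ⟨(hz 0 (by omega)).elim (fun h => h.2) fun h => absurd rfl h.1,
      (hz 1 (by omega)).elim (fun h => absurd h.1 (by omega)) fun h => h.2⟩

end Metric

section Reduction

variable {X : Type*}

/-- The `i`-th set of the reduction of the sequence `V`, in which `V n` is a part of the set with
index `ι n` and `W n` is a set disjoint from `V n`: the point `z` is put into the set of index
`ι n` for some `n` with `z ∈ V n`, provided that `z` lies in `W m` for all earlier `m` that belong
to other indices. With `W m` in place of the complement of `V m` the result is an open set. -/
def reducedPart (ι : ℕ → ℕ) (V W : ℕ → Set X) (i : ℕ) : Set X :=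
  {z | ∃ n, ι n = i ∧ z ∈ V n ∧ ∀ m < n, ι m = i ∨ z ∈ W m}

theorem pairwise_disjoint_reducedPart {ι : ℕ → ℕ} {V W : ℕ → Set X}
    (h : ∀ n, Disjoint (V n) (W n)) :
    Pairwise fun i j => Disjoint (reducedPart ι V W i) (reducedPart ι V W j) := by
  have hlt : ∀ {n n' z}, n < n' → ι n ≠ ι n' → z ∈ V n → ¬ ∀ m < n', ι m = ι n' ∨ z ∈ W m :=
    fun hn hne hz hm => Set.disjoint_left.1 (h _) hz ((hm _ hn).resolve_left hne)
  refine fun i j hij => Set.disjoint_left.2 ?_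
  rintro z ⟨n, rfl, hzn, hn⟩ ⟨n', rfl, hzn', hn'⟩
  rcases lt_trichotomy n n' with hlt' | rfl | hlt'
  · exact hlt hlt' hij hzn hn'
  · exact hij rfl
  · exact hlt hlt' hij.symm hzn' hn

theorem subset_iUnion_reducedPart {ι : ℕ → ℕ} {V W : ℕ → Set X} {Y : Set X}
    (hVW : ∀ n, Y ⊆ V n ∪ W n) (hV : Y ⊆ ⋃ n, V n) : Y ⊆ ⋃ i, reducedPart ι V W i := by
  classical
  intro y hy
  have hex : ∃ n, y ∈ V n := mem_iUnion.1 (hV hy)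
  exact mem_iUnion.2 ⟨_, Nat.find hex, rfl, Nat.find_spec hex,
    fun m hm => .inr ((hVW m hy).resolve_left (Nat.find_min hex hm))⟩

end Reduction

section Sets

variable {X : Type*} [MetricSpace X] {ν : ℕ → X} {T T' : Type*} {α β : Type} [Primcodable α]
  [Primcodable β] {nm : T → Baire} {nm' : T' → Baire}

theorem NamedFrom.reducedPart (hν : IsComputableMetricSpace ν) {ι : T → α × ℕ → ℕ}
    (hι : ComputableFrom nm ι) {V W : T → α × ℕ → Set X} (hV : NamedFrom nm (openName ν) V)
    (hW : NamedFrom nm (openName ν) W) :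
    NamedFrom nm (openName ν) fun t (z : α × ℕ) => reducedPart (fun n => ι t (z.1, n))
      (fun n => V t (z.1, n)) (fun n => W t (z.1, n)) z.2 := by
  have hearlier : NamedFrom nm (openName ν) fun t (y : (α × ℕ) × ℕ) => {z | ∀ m < y.2,
      z ∈ {z | ι t (y.1.1, m) = y.1.2 ∧ z ∈ (univ : Set X)} ∪ W t (y.1.1, m)} := by
    refine NamedFrom.biInter hν (n := fun _ (y : (α × ℕ) × ℕ) => y.2)
      (U := fun t (y : (α × ℕ) × ℕ) m =>
        {z | ι t (y.1.1, m) = y.1.2 ∧ z ∈ (univ : Set X)} ∪ W t (y.1.1, m))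
      (.of_computable (by fun_prop)) (.union (.sep ?_ (.whole hν.dense))
        (hW.reindex (g := fun y : ((α × ℕ) × ℕ) × ℕ => (y.1.1.1, y.2)) (by fun_prop)))
    exact ComputableFrom.rePred_eq
      (hι.reindex (g := fun y : ((α × ℕ) × ℕ) × ℕ => (y.1.1.1, y.2)) (by fun_prop))
      (.of_computable (by fun_prop))
  have hindex : REPredFrom nm fun t (y : (α × ℕ) × ℕ) => ι t (y.1.1, y.2) = y.1.2 :=
    ComputableFrom.rePred_eq (hι.reindex (g := fun y : (α × ℕ) × ℕ => (y.1.1, y.2)) (by fun_prop))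
      (.of_computable (by fun_prop))
  refine (NamedFrom.biUnion (P := fun t (y : α × ℕ) n => ι t (y.1, n) = y.2)
    (U := fun t y n => V t (y.1, n) ∩ {z | ∀ m < n,
      z ∈ {z | ι t (y.1, m) = y.2 ∧ z ∈ (univ : Set X)} ∪ W t (y.1, m)}) hindex
    (NamedFrom.inter hν (hV.reindex (g := fun y : (α × ℕ) × ℕ => (y.1.1, y.2)) (by fun_prop))
      hearlier)).congr fun t y => ?_
  ext z
  simp [TTE.reducedPart]

/-- The ball with index `⟨j, l⟩` is the `j`-th enumerated ideal ball with its radius shrunk by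
`2⁻ˡ`; the radius `-1` stands for a step at which no ball is enumerated. -/
theorem NamedFrom.exists_closedBall_exhaustion {U : T → α → Set X}
    (hU : NamedFrom nm (openName ν) U) :
    ∃ (c : T → α × ℕ → ℕ) (r : T → α × ℕ → ℝ), ComputableFrom nm c ∧ ComputableRealFrom nm r ∧
      ∀ t a, (∀ k, Metric.closedBall (ν (c t (a, k))) (r t (a, k)) ⊆ U t a) ∧
        U t a ⊆ ⋃ k, Metric.ball (ν (c t (a, k))) (r t (a, k)) := by
  obtain ⟨F, hF, hFU⟩ := hU
  let G : T → α × ℕ → ℕ := fun t y => F t (y.1, y.2.unpair.1)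
  have hG : ComputableFrom nm G := hF.reindex (by fun_prop)
  let radius (n l : ℕ) : ℕ :=
    bif n = 0 then ratCode 0 1 0 else ratAdd (ratPos (n - 1).unpair.2) (ratNeg (ratPow l))
  have hradius_zero (l : ℕ) : ((rat (radius 0 l) : ℚ) : ℝ) = -1 := by simp [radius, rat_ratCode]
  have hradius_succ (c l : ℕ) : ((rat (radius (c + 1) l) : ℚ) : ℝ) =
      ((posRat c.unpair.2 : ℚ) : ℝ) - (2 : ℝ)⁻¹ ^ l := by
    simp [radius, rat_ratAdd, rat_ratPos, rat_ratNeg, rat_ratPow, sub_eq_add_neg]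
  refine ⟨fun t y => (G t y - 1).unpair.1, fun t y => ((rat (radius (G t y) y.2.unpair.2) : ℚ) : ℝ),
    ComputableFrom.map (g := fun n => (n - 1).unpair.1) (by fun_prop) hG,
    ComputableRealFrom.of_rat (ComputableFrom.map₂ (g := radius) (by fun_prop) hG
      (.of_computable (g := fun y : α × ℕ => y.2.unpair.2) (by fun_prop))), fun t a => ⟨?_, ?_⟩⟩
  · intro k z hz
    simp only [Metric.mem_closedBall] at hz
    rcases hGk : G t (a, k) with _ | c
    · rw [hGk, hradius_zero] at hz
      linarith [dist_nonneg (x := z) (y := ν ((0 - 1 : ℕ).unpair.1))]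
    · rw [hGk, hradius_succ, Nat.add_sub_cancel] at hz
      rw [show U t a = _ from hFU t a]
      refine mem_iUnion₂.2 ⟨c, ⟨k.unpair.1, hGk⟩, mem_idealBall.2 ?_⟩
      have : (0 : ℝ) < 2⁻¹ ^ k.unpair.2 := by positivity
      linarith
  · intro z hz
    rw [show U t a = _ from hFU t a] at hz
    obtain ⟨c, ⟨j, hj⟩, hzc⟩ := mem_iUnion₂.1 hz
    obtain ⟨l, hl⟩ := exists_pow_lt (sub_pos.2 (mem_idealBall.1 hzc))
    have hGc : G t (a, Nat.pair j l) = c + 1 := by simpa [G] using hj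
    refine mem_iUnion.2 ⟨Nat.pair j l, ?_⟩
    simp only [Metric.mem_ball]
    rw [hGc, hradius_succ, Nat.add_sub_cancel, Nat.unpair_pair]
    linarith

theorem NamedFrom.exists_pairwise_disjoint (hν : IsComputableMetricSpace ν)
    {U : T → α → ℕ → Set X} (hU : NamedFrom nm (openName ν) fun t (z : α × ℕ) => U t z.1 z.2) :
    ∃ U' : T → α → ℕ → Set X, NamedFrom nm (openName ν) (fun t (z : α × ℕ) => U' t z.1 z.2) ∧
      ∀ t a, (Pairwise fun i j => Disjoint (U' t a i) (U' t a j)) ∧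
        ∀ i, U' t a i ⊆ U t a i ∧ ∀ z ∈ U t a i, (∀ j, j ≠ i → z ∉ U t a j) → z ∈ U' t a i := by
  obtain ⟨c, r, hc, hr, hcr⟩ := hU.exists_closedBall_exhaustion
  let index (y : α × ℕ) : (α × ℕ) × ℕ := ((y.1, y.2.unpair.1), y.2.unpair.2)
  have hcenter : NamedFrom nm (cauchyName ν) fun t y => ν (c t (index y)) :=
    NamedFrom.dense (hc.reindex (by fun_prop))
  have hradius : ComputableRealFrom nm fun t y => r t (index y) := hr.reindex (by fun_prop)
  refine ⟨fun t a => TTE.reducedPart (fun k => k.unpair.1)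
      (fun k => Metric.ball (ν (c t (index (a, k)))) (r t (index (a, k))))
      (fun k => {z | r t (index (a, k)) < dist (ν (c t (index (a, k)))) z}),
    NamedFrom.reducedPart hν (ι := fun _ y => y.2.unpair.1) (.of_computable (by fun_prop))
      (NamedFrom.ball hν hcenter hradius) (NamedFrom.setOf_lt_dist hν hcenter hradius),
    fun t a => ⟨pairwise_disjoint_reducedPart fun k => ?_, fun i => ⟨?_, fun z hz hzj => ?_⟩⟩⟩
  · refine Set.disjoint_left.2 fun z hz hz' => ?_
    rw [Metric.mem_ball, dist_comm] at hz
    exact lt_asymm hz hz'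
  · rintro z ⟨k, rfl, hz, -⟩
    exact (hcr t (a, k.unpair.1)).1 _ (Metric.ball_subset_closedBall hz)
  · obtain ⟨k, hk⟩ := mem_iUnion.1 ((hcr t (a, i)).2 hz)
    refine ⟨Nat.pair i k, by simp, by simpa [index] using hk, fun m _ => ?_⟩
    by_contra! hm
    obtain ⟨hmi, hzm⟩ := hm
    refine hzj _ hmi ((hcr t (a, m.unpair.1)).1 m.unpair.2 ?_)
    rw [Metric.mem_closedBall, dist_comm]
    exact not_lt.1 hzm

theorem NamedFrom.exists_disjoint (hν : IsComputableMetricSpace ν) {U V : T → α → Set X}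
    (hU : NamedFrom nm (openName ν) U) (hV : NamedFrom nm (openName ν) V) :
    ∃ U' V' : T → α → Set X, NamedFrom nm (openName ν) U' ∧ NamedFrom nm (openName ν) V' ∧
      ∀ t a, Disjoint (U' t a) (V' t a) ∧ U' t a ⊆ U t a ∧ V' t a ⊆ V t a ∧
        U t a \ V t a ⊆ U' t a ∧ V t a \ U t a ⊆ V' t a := by
  have h : NamedFrom nm (openName ν) fun t (y : α × ℕ) =>
      {z | y.2 = 0 ∧ z ∈ U t y.1} ∪ {z | y.2 = 1 ∧ z ∈ V t y.1} :=
    (NamedFrom.sep (ComputableFrom.rePred_eq (.of_computable (by fun_prop))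
      (.of_computable (by fun_prop))) (hU.reindex (by fun_prop))).union
    (NamedFrom.sep (ComputableFrom.rePred_eq (.of_computable (by fun_prop))
      (.of_computable (by fun_prop))) (hV.reindex (by fun_prop)))
  obtain ⟨W, hW, hWd⟩ := NamedFrom.exists_pairwise_disjoint hν
    (U := fun t a i => {z | i = 0 ∧ z ∈ U t a} ∪ {z | i = 1 ∧ z ∈ V t a}) h
  refine ⟨fun t a => W t a 0, fun t a => W t a 1,
    hW.reindex (g := fun a => (a, 0)) (by fun_prop),
    hW.reindex (g := fun a => (a, 1)) (by fun_prop), fun t a =>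
    ⟨(hWd t a).1 zero_ne_one, fun z hz => ?_, fun z hz => ?_, fun z hz => ?_, fun z hz => ?_⟩⟩
  · simpa using ((hWd t a).2 0).1 hz
  · simpa using ((hWd t a).2 1).1 hz
  · refine ((hWd t a).2 0).2 z (.inl ⟨rfl, hz.1⟩) fun j hj h => ?_
    rcases h with h | h
    exacts [hj h.1, hz.2 h.2]
  · refine ((hWd t a).2 1).2 z (.inr ⟨rfl, hz.1⟩) fun j hj h => ?_
    rcases h with h | h
    exacts [hz.2 h.2, hj h.1]

theorem REPredFrom.exists_option_enumeration {P : T → α × β → Prop} (hP : REPredFrom nm P) :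
    ∃ F : T → α × ℕ → Option β, ComputableFrom nm F ∧
      ∀ t a b, P t (a, b) ↔ ∃ i, F t (a, i) = some b := by
  have hcode : REPredFrom nm fun t (z : α × ℕ) => ∃ b, Encodable.encode b = z.2 ∧ P t (z.1, b) :=
    REPredFrom.exists (.and (ComputableFrom.rePred_eq (.of_computable (by fun_prop))
      (.of_computable (by fun_prop)))
      (hP.reindex (g := fun z : (α × ℕ) × β => (z.1.1, z.2)) (by fun_prop)))
  obtain ⟨F, hF, hFP⟩ := hcode.exists_enumeration
  refine ⟨fun t y => bif F t y = 0 then none else Encodable.decode (F t y - 1),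
    ComputableFrom.map (g := fun n => bif n = 0 then none else Encodable.decode (n - 1))
      (by fun_prop) hF, fun t a b => ⟨fun hb => ?_, ?_⟩⟩
  · obtain ⟨i, hi⟩ := (hFP t a (Encodable.encode b)).1 ⟨b, rfl, hb⟩
    exact ⟨i, by simp [hi]⟩
  · rintro ⟨i, hi⟩
    rcases hc : F t (a, i) with _ | c
    · simp [hc] at hi
    · obtain ⟨b', rfl, hb'⟩ := (hFP t a c).2 ⟨i, hc⟩
      obtain rfl : b' = b := by simpa [hc] using hi
      exact hb'

theorem NamedFrom.exists_reduction (hν : IsComputableMetricSpace ν) {U : T → α → ℕ → Set X}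
    {Y : T → α → Set X} {Good : T → α × β → Prop} (hGood : REPredFrom nm Good) {ι : β → ℕ}
    (hι : Computable ι) {V W : T → α × β → Set X} (hV : NamedFrom nm (openName ν) V)
    (hW : NamedFrom nm (openName ν) W)
    (h : ∀ t a b, Good t (a, b) → Disjoint (V t (a, b)) (W t (a, b)) ∧
      Y t a ⊆ V t (a, b) ∪ W t (a, b) ∧ V t (a, b) ⊆ U t a (ι b))
    (hcover : ∀ t a, ∀ y ∈ Y t a, ∃ b, Good t (a, b) ∧ y ∈ V t (a, b)) :
    ∃ P : T → α → ℕ → Set X, NamedFrom nm (openName ν) (fun t (z : α × ℕ) => P t z.1 z.2) ∧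
      ∀ t a, (∀ i, P t a i ⊆ U t a i) ∧ Y t a ⊆ ⋃ i, P t a i ∧
        Pairwise fun i j => Disjoint (P t a i) (P t a j) := by
  obtain ⟨F, hF, hFG⟩ := hGood.exists_option_enumeration
  have hsome : REPredFrom nm fun t (y : (α × ℕ) × β) => F t y.1 = some y.2 :=
    ComputableFrom.rePred_eq (hF.reindex (by fun_prop)) (.of_computable (by fun_prop))
  let V' (t : T) (y : α × ℕ) : Set X := {z | ∃ b, F t y = some b ∧ z ∈ V t (y.1, b)}
  let W' (t : T) (y : α × ℕ) : Set X :=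
    {z | F t y = none ∧ z ∈ univ} ∪ {z | ∃ b, F t y = some b ∧ z ∈ W t (y.1, b)}
  have hV' : NamedFrom nm (openName ν) V' := NamedFrom.biUnion hsome
    (hV.reindex (g := fun y : (α × ℕ) × β => (y.1.1, y.2)) (by fun_prop))
  have hW' : NamedFrom nm (openName ν) W' :=
    .union (.sep (ComputableFrom.rePred_eq hF (.of_computable (by fun_prop))) (.whole hν.dense))
      (NamedFrom.biUnion hsome
        (hW.reindex (g := fun y : (α × ℕ) × β => (y.1.1, y.2)) (by fun_prop)))
  have hι' : ComputableFrom nm fun t y => (F t y).elim 0 ι :=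
    ComputableFrom.map (g := fun o : Option β => o.elim 0 ι) (by fun_prop) hF
  refine ⟨fun t a => TTE.reducedPart (fun n => (F t (a, n)).elim 0 ι) (fun n => V' t (a, n))
    (fun n => W' t (a, n)), NamedFrom.reducedPart hν hι' hV' hW', fun t a => ⟨?_,
      subset_iUnion_reducedPart (fun n y hy => ?_) fun y hy => ?_,
      pairwise_disjoint_reducedPart fun n => Set.disjoint_left.2 ?_⟩⟩
  · rintro i z ⟨n, rfl, ⟨b, hb, hz⟩, -⟩
    simpa [hb] using (h t a b ((hFG t a b).2 ⟨n, hb⟩)).2.2 hz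
  · rcases hb : F t (a, n) with _ | b
    · exact .inr (.inl ⟨hb, mem_univ y⟩)
    · exact ((h t a b ((hFG t a b).2 ⟨n, hb⟩)).2.1 hy).imp (fun hz => ⟨b, hb, hz⟩)
        fun hz => .inr ⟨b, hb, hz⟩
  · obtain ⟨b, hb, hyb⟩ := hcover t a y hy
    obtain ⟨n, hn⟩ := (hFG t a b).1 hb
    exact mem_iUnion.2 ⟨n, b, hn, hyb⟩
  · rintro z ⟨b, hb, hz⟩ (⟨hnone, -⟩ | ⟨b', hb', hz'⟩)
    · exact Option.some_ne_none b (hb.symm.trans hnone)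
    · obtain rfl : b = b' := Option.some_injective _ (hb.symm.trans hb')
      exact Set.disjoint_left.1 (h t a b ((hFG t a b).2 ⟨n, hb⟩)).1 hz hz'

theorem NamedFrom.exists_pullback {U : T' → Set X}
    (hU : NamedFrom nm' (openName ν) fun t' (_ : Unit) => U t') {S : T → β → Prop}
    (hS : REPredFrom nm S) (φ : ∀ t b, S t b → T') {F : T → β × ℕ → ℕ}
    (hF : ComputableFrom nm F) (h : ∀ t b hs k, nm' (φ t b hs) k = F t (b, k)) :
    NamedFrom nm (openName ν) fun t b => {z | ∃ hs : S t b, z ∈ U (φ t b hs)} := by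
  obtain ⟨E, hE, hEU⟩ := hU.exists_rePred
  refine NamedFrom.openName_of_rePred (REPredFrom.exists_pullback
    (hE.reindex (g := fun c : ℕ => ((), c)) (by fun_prop)) hS φ hF h)
    (fun t b c ⟨hs, hc⟩ z hz => ⟨hs, (hEU _ _ _).2 ⟨c, hc, hz⟩⟩) ?_
  rintro t b z ⟨hs, hz⟩
  obtain ⟨c, hc, hz⟩ := (hEU _ () _).1 hz
  exact ⟨c, ⟨hs, hc⟩, hz⟩

theorem REPredFrom.exists_modulus {P : T → α → Prop} (hP : REPredFrom nm P) {t : T} {x : α}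
    (h : P t x) : ∃ m, ∀ t', (∀ k < m, nm t' k = nm t k) → P t' x := by
  obtain ⟨D, -, -, hDP⟩ := hP
  obtain ⟨m, hm⟩ := (hDP t x).1 h
  exact ⟨m, fun t' ht' => (hDP t' x).2 ⟨m, by rwa [prefixOf_congr ht']⟩⟩

end Sets

section CauchyPrefix

variable {X : Type*} [MetricSpace X] {ν : ℕ → X} {T : Type*} {α : Type} [Primcodable α]
  {nm : T → Baire}

theorem cauchyName_of_forall_lt_of_tendsto {p : Baire} {x : X}
    (h : ∀ j, ∀ i < j, dist (ν (p i)) (ν (p j)) < (2 : ℝ)⁻¹ ^ i)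
    (hlim : Tendsto (fun i => ν (p i)) atTop (𝓝 x)) : cauchyName ν p x := by
  refine ⟨fun i j => ?_, hlim⟩
  rcases lt_trichotomy i j with hij | rfl | hij
  · rw [min_eq_left hij.le]
    exact h j i hij
  · rw [dist_self]
    positivity
  · rw [min_eq_right hij.le, dist_comm]
    exact h i j hij

/-- The finite sequences that satisfy the condition on a prefix of a Cauchy name. -/
def IsCauchyPrefix (ν : ℕ → X) (σ : List ℕ) : Prop :=
  ∀ j < σ.length, ∀ i < j, dist (ν (σ.getD i 0)) (ν (σ.getD j 0)) < (2 : ℝ)⁻¹ ^ i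

theorem REPredFrom.isCauchyPrefix (hν : IsComputableMetricSpace ν) :
    REPredFrom nm fun _ => IsCauchyPrefix ν := by
  refine REPredFrom.forall_lt (REPredFrom.forall_lt (P := fun _ (x : List ℕ × ℕ) i =>
    dist (ν (x.1.getD i 0)) (ν (x.1.getD x.2 0)) < (2 : ℝ)⁻¹ ^ i)
    (ComputableRealFrom.lt ?_ (ComputableRealFrom.pow (.of_computable (by fun_prop))))
    (n := fun x => x.2) (by fun_prop)) (by fun_prop)
  exact (ComputableRealFrom.dist_dense hν).reindex (g := fun x : (List ℕ × ℕ) × ℕ =>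
    (x.1.1.getD x.2 0, x.1.1.getD x.1.2 0)) (by fun_prop)

theorem cauchyName.isCauchyPrefix {q : Baire} {x : X} (h : cauchyName ν q x) (m : ℕ) :
    IsCauchyPrefix ν (prefixOf q m) := by
  intro j hj i hij
  rw [length_prefixOf] at hj
  rw [getD_prefixOf hj, getD_prefixOf (hij.trans hj)]
  simpa only [min_eq_left hij.le] using h.1 i j

/-- The last entry of a finite sequence, and `0` for the empty one. -/
def lastEntry (σ : List ℕ) : ℕ := σ.getD (σ.length - 1) 0

/-- The infinite sequence that continues a finite sequence by repeating its last entry. -/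
def extendByLast (σ : List ℕ) : Baire :=
  fun k => bif Nat.ble σ.length k then lastEntry σ else σ.getD k 0

@[fun_prop]
theorem computable_lastEntry {f : α → List ℕ} (hf : Computable f) :
    Computable fun x => lastEntry (f x) := by unfold lastEntry; fun_prop

@[fun_prop]
theorem computable_extendByLast {f : α → List ℕ} {g : α → ℕ} (hf : Computable f)
    (hg : Computable g) : Computable fun x => extendByLast (f x) (g x) := by
  unfold extendByLast; fun_prop

theorem extendByLast_of_lt {σ : List ℕ} {k : ℕ} (h : k < σ.length) :
    extendByLast σ k = σ.getD k 0 := by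
  have : Nat.ble σ.length k = false := by
    rw [← Bool.not_eq_true, Nat.ble_eq]
    omega
  simp [extendByLast, this]

theorem extendByLast_of_le {σ : List ℕ} {k : ℕ} (h : σ.length ≤ k) :
    extendByLast σ k = lastEntry σ := by
  have : Nat.ble σ.length k = true := by rwa [Nat.ble_eq]
  simp [extendByLast, this]

theorem extendByLast_prefixOf {q : Baire} {m i : ℕ} (h : i < m) :
    extendByLast (prefixOf q m) i = q i := by
  rw [extendByLast_of_lt (by rwa [length_prefixOf]), getD_prefixOf h]

theorem lastEntry_prefixOf (q : Baire) (m : ℕ) : lastEntry (prefixOf q (m + 1)) = q m := by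
  rw [lastEntry, length_prefixOf, Nat.add_sub_cancel, getD_prefixOf (Nat.lt_succ_self m)]

theorem IsCauchyPrefix.cauchyName_extendByLast {σ : List ℕ} (h : IsCauchyPrefix ν σ) :
    cauchyName ν (extendByLast σ) (ν (lastEntry σ)) := by
  refine cauchyName_of_forall_lt_of_tendsto (fun j i hij => ?_) (tendsto_const_nhds.congr' ?_)
  · rcases lt_or_ge j σ.length with hj | hj
    · rw [extendByLast_of_lt hj, extendByLast_of_lt (hij.trans hj)]
      exact h j hj i hij
    rw [extendByLast_of_le hj]
    rcases lt_or_ge i (σ.length - 1) with hi | hi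
    · rw [extendByLast_of_lt (by omega)]
      exact h _ (by omega) i hi
    · suffices hlast : extendByLast σ i = lastEntry σ by
        rw [hlast, dist_self]
        positivity
      rcases hi.eq_or_lt with rfl | hi
      · rcases Nat.eq_zero_or_pos σ.length with h0 | hpos
        · exact extendByLast_of_le (by omega)
        · exact extendByLast_of_lt (by omega)
      · exact extendByLast_of_le (by omega)
  · filter_upwards [eventually_ge_atTop σ.length] with k hk
    rw [extendByLast_of_le hk]

theorem IsCauchyPrefix.exists_name (hν : DenseRange ν) {τ : List ℕ} (hτ : IsCauchyPrefix ν τ)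
    {z : X} (hz : ∀ i < τ.length, dist z (ν (τ.getD i 0)) < (2 : ℝ)⁻¹ ^ i) :
    ∃ q, cauchyName ν q z ∧ ∀ i < τ.length, q i = τ.getD i 0 := by
  obtain ⟨ε, hε, hτε⟩ := exists_pos_forall_lt_add_le hz
  have happrox (j : ℕ) : ∃ n, dist z (ν n) < min ε ((2 : ℝ)⁻¹ ^ (j + 1)) :=
    hν.exists_dist_lt z (lt_min hε (by positivity))
  choose n hn using happrox
  have hnz : cauchyName ν n z := cauchyName_of_lt fun j => by
    rw [dist_comm]
    exact (hn j).trans_le (min_le_right _ _)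
  refine ⟨fun j => if j < τ.length then τ.getD j 0 else n j,
    cauchyName_of_forall_lt_of_tendsto (fun j i hij => ?_) (hnz.2.congr' ?_), fun i hi => if_pos hi⟩
  · by_cases hi : i < τ.length
    · by_cases hj : j < τ.length
      · simpa only [if_pos hi, if_pos hj] using hτ j hj i hij
      · simp only [if_pos hi, if_neg hj]
        have hnj : dist z (ν (n j)) < ε := (hn j).trans_le (min_le_left _ _)
        linarith [hτε i hi, dist_triangle_left (ν (τ.getD i 0)) (ν (n j)) z]
    · simpa only [if_neg hi, if_neg (show ¬ j < τ.length by omega), min_eq_left hij.le]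
        using hnz.1 i j
  · filter_upwards [eventually_ge_atTop τ.length] with j hj
    rw [if_neg hj.not_gt]

/-- By the triangle inequality, the sequence `τ` is certified to be a prefix of a Cauchy name of
every point of the ideal ball with number `c`. -/
def IsPrefixOnBall (ν : ℕ → X) (τ : List ℕ) (c : ℕ) : Prop :=
  IsCauchyPrefix ν τ ∧ ∀ i < τ.length,
    dist (ν c.unpair.1) (ν (τ.getD i 0)) + ((posRat c.unpair.2 : ℚ) : ℝ) < (2 : ℝ)⁻¹ ^ i

theorem REPredFrom.isPrefixOnBall (hν : IsComputableMetricSpace ν) :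
    REPredFrom nm fun _ (x : List ℕ × ℕ) => IsPrefixOnBall ν x.1 x.2 := by
  refine REPredFrom.and ((REPredFrom.isCauchyPrefix hν).reindex (by fun_prop))
    (REPredFrom.forall_lt (ComputableRealFrom.lt (ComputableRealFrom.add
      ((ComputableRealFrom.dist_dense hν).reindex
        (g := fun x : (List ℕ × ℕ) × ℕ => (x.1.2.unpair.1, x.1.1.getD x.2 0)) (by fun_prop))
      (ComputableRealFrom.of_posRat (G := fun _ (x : (List ℕ × ℕ) × ℕ) => x.1.2.unpair.2)
        (.of_computable (by fun_prop))))
      (ComputableRealFrom.pow (.of_computable (by fun_prop)))) (by fun_prop))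

theorem IsPrefixOnBall.exists_name (hν : DenseRange ν) {τ : List ℕ} {c : ℕ}
    (h : IsPrefixOnBall ν τ c) {z : X} (hz : z ∈ idealBall ν c) :
    ∃ q, cauchyName ν q z ∧ ∀ i < τ.length, q i = τ.getD i 0 :=
  h.1.exists_name hν fun i hi => by
    linarith [h.2 i hi, mem_idealBall.1 hz, dist_triangle z (ν c.unpair.1) (ν (τ.getD i 0))]

/-- The name is chosen to converge fast, so that its prefixes fit a whole neighbourhood of `z`. -/
theorem exists_cauchyName_isPrefixOnBall (hν : DenseRange ν) (z : X) :
    ∃ q, cauchyName ν q z ∧ ∀ m, ∃ c, z ∈ idealBall ν c ∧ IsPrefixOnBall ν (prefixOf q m) c := by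
  have happrox (i : ℕ) : ∃ n, dist z (ν n) < (2 : ℝ)⁻¹ ^ (i + 1) :=
    hν.exists_dist_lt z (by positivity)
  choose q hq using happrox
  have hqz : cauchyName ν q z := cauchyName_of_lt fun i => by rw [dist_comm]; exact hq i
  refine ⟨q, hqz, fun m => ?_⟩
  obtain ⟨c, hzc, hcenter, hradius⟩ := exists_idealBall hν z
    (show (0 : ℝ) < 2⁻¹ ^ m / 2 by positivity)
  refine ⟨c, hzc, hqz.isCauchyPrefix m, fun i hi => ?_⟩
  rw [length_prefixOf] at hi
  rw [getD_prefixOf hi]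
  have hm : (2 : ℝ)⁻¹ ^ m ≤ 2⁻¹ ^ (i + 1) :=
    pow_le_pow_of_le_one (by norm_num) (by norm_num) (by omega)
  have hqi := hq i
  rw [pow_succ _ i] at hqi hm
  linarith [dist_triangle_left (ν c.unpair.1) (ν (q i)) z]

end CauchyPrefix

section WithPoint

variable {X : Type*} [MetricSpace X] {ν : ℕ → X} {T : Type*} {α : Type} [Primcodable α]
  {nm : T → Baire}

/-- The inputs of `T` together with a named point of `A t`. -/
abbrev WithPoint (ν : ℕ → X) (A : T → Set X) : Type _ :=
  {s : T × Baire × X // cauchyName ν s.2.1 s.2.2 ∧ s.2.2 ∈ A s.1}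

/-- The name of an input and a point of it: the name of the point interleaved with that of the
input. -/
def withPointName (nm : T → Baire) (A : T → Set X) : WithPoint ν A → Baire :=
  fun s => interleave s.1.2.1 (nm s.1.1)

theorem WithPoint.computableFrom_base (A : T → Set X) :
    ComputableFrom (withPointName (ν := ν) nm A) fun s k => nm s.1.1 k :=
  ComputableFrom.of_interleave_right (q := fun s : WithPoint ν A => s.1.2.1) fun _ => rfl

theorem WithPoint.computableFrom_point (A : T → Set X) :
    ComputableFrom (withPointName (ν := ν) nm A) fun s k => s.1.2.1 k :=
  ComputableFrom.of_interleave_left (base := fun s : WithPoint ν A => s.1.1) fun _ => rfl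

theorem WithPoint.named (A : T → Set X) :
    NamedFrom (withPointName (ν := ν) nm A) (cauchyName ν) fun s (_ : Unit) => s.1.2.2 :=
  ⟨fun s z => s.1.2.1 z.2, (WithPoint.computableFrom_point A).reindex (by fun_prop),
    fun s _ => s.2.1⟩

/-- The finite sequences whose extension by the last entry names a point of `A t`. -/
def IsPointPrefix (ν : ℕ → X) (A : T → Set X) (t : T) (σ : List ℕ) : Prop :=
  IsCauchyPrefix ν σ ∧ ν (lastEntry σ) ∈ A t

/-- The named point of `A t` given by a finite sequence. -/
def IsPointPrefix.point {A : T → Set X} (t : T) (σ : List ℕ) (h : IsPointPrefix ν A t σ) :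
    WithPoint ν A :=
  ⟨(t, extendByLast σ, ν (lastEntry σ)), h.1.cauchyName_extendByLast, h.2⟩

theorem REPredFrom.isPointPrefix (hν : IsComputableMetricSpace ν) {A : T → Set X}
    (hA : NamedFrom nm (openName ν) fun t (_ : Unit) => A t) :
    REPredFrom nm (IsPointPrefix ν A) :=
  (REPredFrom.isCauchyPrefix hν).and (REPredFrom.mem hν (hA.reindex (g := fun _ => ())
    (by fun_prop)) (NamedFrom.dense (.of_computable (by fun_prop))))

theorem NamedFrom.of_isPointPrefix (hν : IsComputableMetricSpace ν) {A : T → Set X}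
    (hA : NamedFrom nm (openName ν) fun t (_ : Unit) => A t) {U : WithPoint ν A → Set X}
    (hU : NamedFrom (withPointName nm A) (openName ν) fun s (_ : Unit) => U s) :
    NamedFrom nm (openName ν) fun t σ => {z | ∃ h : IsPointPrefix ν A t σ, z ∈ U h.point} :=
  hU.exists_pullback (REPredFrom.isPointPrefix hν hA) (fun _ _ h => h.point)
    (ComputableFrom.interleave (F := fun _ (y : List ℕ × ℕ) => extendByLast y.1 y.2)
      (G := fun t y => nm t y.2) (.of_computable (by fun_prop))
      (ComputableFrom.name.reindex (by fun_prop))) fun _ _ _ _ => rfl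

theorem IsPointPrefix.exists_of_rePred {A : T → Set X} (hA : ∀ t, IsOpen (A t))
    {P : WithPoint ν A → α → Prop} (hP : REPredFrom (withPointName nm A) P) {s : WithPoint ν A}
    {a : α} (hs : P s a) : ∃ (σ : List ℕ) (h : IsPointPrefix ν A s.1.1 σ), P h.point a := by
  obtain ⟨m, hm⟩ := hP.exists_modulus hs
  have hev : ∀ᶠ k in atTop, ν (s.1.2.1 k) ∈ A s.1.1 :=
    s.2.1.2.eventually ((hA s.1.1).mem_nhds s.2.2)
  obtain ⟨k, hk, hkm⟩ := (hev.and (eventually_ge_atTop m)).exists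
  have h : IsPointPrefix ν A s.1.1 (prefixOf s.1.2.1 (k + 1)) :=
    ⟨s.2.1.isCauchyPrefix _, by rwa [lastEntry_prefixOf]⟩
  refine ⟨_, h, hm _ fun i hi => ?_⟩
  simp only [withPointName, IsPointPrefix.point, interleave]
  rw [extendByLast_prefixOf (by omega)]

/-- Whether a point satisfies `Q` is decided by finitely many symbols of its name, which is then
also the beginning of names of all the points nearby. -/
theorem REPredFrom.exists_open (hν : IsComputableMetricSpace ν) {A : T → Set X}
    {Q : T → X → α → Prop}
    (hQ : REPredFrom (withPointName (ν := ν) nm A) fun s a => Q s.1.1 s.1.2.2 a) :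
    ∃ O : T → α → Set X, NamedFrom nm (openName ν) O ∧
      ∀ t a, ∀ z ∈ A t, (z ∈ O t a ↔ Q t z a) := by
  obtain ⟨D, hD, hDm, hDQ⟩ := hQ
  let E (t : T) (y : α × ℕ) : Prop := ∃ τ : List ℕ, IsPrefixOnBall ν τ y.2 ∧
    D (prefixOf (interleave (fun k => τ.getD k 0) (nm t)) (2 * τ.length), y.1) = true
  have hE : REPredFrom nm E := by
    refine REPredFrom.exists (REPredFrom.and ((REPredFrom.isPrefixOnBall hν).reindex
      (g := fun y : (α × ℕ) × List ℕ => (y.2, y.1.2)) (by fun_prop))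
      (ComputableFrom.rePred_eq_true (ComputableFrom.map hD (ComputableFrom.pair ?_
        (.of_computable (by fun_prop))))))
    exact (ComputableFrom.interleave (F := fun _ (y : List ℕ × ℕ) => y.1.getD y.2 0)
      (G := fun t y => nm t y.2) (.of_computable (by fun_prop))
      (ComputableFrom.name.reindex (by fun_prop))).prefixOf.reindex
      (g := fun y : (α × ℕ) × List ℕ => (y.2, 2 * y.2.length)) (by fun_prop)
  refine ⟨fun t a => {z | ∃ c, E t (a, c) ∧ z ∈ idealBall ν c},
    NamedFrom.openName_of_rePred hE (fun t a c hc z hz => ⟨c, hc, hz⟩) fun t a z hz => hz,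
    fun t a z hzA => ⟨?_, fun hz => ?_⟩⟩
  · rintro ⟨c, ⟨τ, hτ, hDτ⟩, hzc⟩
    obtain ⟨q, hq, hqτ⟩ := hτ.exists_name hν.dense hzc
    refine (hDQ ⟨(t, q, z), hq, hzA⟩ a).2 ⟨2 * τ.length, ?_⟩
    rwa [withPointName, prefixOf_interleave hqτ fun _ _ => rfl]
  · obtain ⟨q, hqz, hq⟩ := exists_cauchyName_isPrefixOnBall hν.dense z
    obtain ⟨m, hm⟩ := (hDQ ⟨(t, q, z), hqz, hzA⟩ a).1 hz
    obtain ⟨c, hzc, hc⟩ := hq m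
    refine ⟨c, ⟨prefixOf q m, hc, ?_⟩, hzc⟩
    rw [length_prefixOf, prefixOf_interleave (fun i hi => getD_prefixOf hi) fun _ _ => rfl]
    exact hDm (prefixOf_isPrefix _ (by omega)) hm

end WithPoint

section WithNat

variable {T : Type*} {α β : Type} [Primcodable α] [Primcodable β] {nm : T → Baire}

/-- The name of an input extended by a natural number. -/
def withNatName (nm : T → Baire) : T × ℕ → Baire := fun s => interleave (fun _ => s.2) (nm s.1)

theorem computableFrom_withNatName_fst : ComputableFrom (withNatName nm) fun s k => nm s.1 k :=
  ComputableFrom.of_interleave_right (q := fun s : T × ℕ => fun _ => s.2) fun _ => rfl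

theorem computableFrom_withNatName_snd :
    ComputableFrom (withNatName nm) fun s (_ : α) => s.2 :=
  (ComputableFrom.of_interleave_left (base := Prod.fst) (q := fun s : T × ℕ => fun _ => s.2)
    fun _ => rfl).reindex (g := fun _ => 0) (by fun_prop)

theorem REPredFrom.uncurry {P : T × ℕ → α → Prop} (hP : REPredFrom (withNatName nm) P) :
    REPredFrom nm fun t (x : ℕ × α) => P (t, x.1) x.2 :=
  (hP.exists_pullback (REPredFrom.const_true (α := ℕ)) (fun t i _ => (t, i))
    (ComputableFrom.interleave (F := fun _ (y : ℕ × ℕ) => y.1) (G := fun t y => nm t y.2)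
      (.of_computable (by fun_prop)) (ComputableFrom.name.reindex (by fun_prop)))
    fun _ _ _ _ => rfl).congr fun t x => by simp only [exists_true_left]

theorem ComputableFrom.uncurry {F : T × ℕ → α → β} (hF : ComputableFrom (withNatName nm) F) :
    ComputableFrom nm fun t (x : ℕ × α) => F (t, x.1) x.2 :=
  (REPredFrom.uncurry hF).reindex (g := fun x : (ℕ × α) × β => (x.1.1, (x.1.2, x.2)))
    (by fun_prop)

theorem NamedFrom.uncurry {B : Type*} {δ : Naming B} {y : T × ℕ → α → B}
    (hy : NamedFrom (withNatName nm) δ y) : NamedFrom nm δ fun t (x : ℕ × α) => y (t, x.1) x.2 := by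
  obtain ⟨F, hF, hFy⟩ := hy
  exact ⟨_, hF.uncurry.reindex (g := fun x : (ℕ × α) × ℕ => (x.1.1, (x.1.2, x.2)))
    (by fun_prop), fun t x => hFy (t, x.1) x.2⟩

end WithNat

section DisjointSets

variable {X : Type*}

theorem union_inter_subset_sdiff {A B Y W W' : Set X} (hAB : Disjoint A B)
    (hWB : Disjoint W B) (hWA : Disjoint W' A) (hWW : Disjoint W W') (hY : Y ⊆ W ∪ W') :
    A ∪ (Y ∩ W) ⊆ ((W ∪ Yᶜ) ∩ Bᶜ) \ ((W' ∪ Yᶜ) ∩ Aᶜ) := by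
  rintro z (hzA | ⟨hzY, hzW⟩)
  · refine ⟨⟨?_, hAB.notMem_of_mem_left hzA⟩, fun h => h.2 hzA⟩
    exact or_iff_not_imp_right.2 fun hzY =>
      (hY (not_not.1 hzY)).resolve_right (hWA.notMem_of_mem_right hzA)
  · exact ⟨⟨.inl hzW, hWB.notMem_of_mem_left hzW⟩, fun h =>
      h.1.elim (hWW.notMem_of_mem_left hzW) (not_not_intro hzY)⟩

theorem disjoint_biUnion_ne {W : ℕ → Set X} (hW : Pairwise fun i j => Disjoint (W i) (W j))
    (i : ℕ) : Disjoint (W i) {z | ∃ j, j ≠ i ∧ z ∈ W j} := by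
  refine Set.disjoint_left.2 ?_
  rintro z hz ⟨j, hj, hzj⟩
  exact Set.disjoint_left.1 (hW hj) hzj hz

theorem subset_union_biUnion_ne {W : ℕ → Set X} {Y : Set X} (hY : Y ⊆ ⋃ i, W i) (i : ℕ) :
    Y ⊆ W i ∪ {z | ∃ j, j ≠ i ∧ z ∈ W j} := fun z hz => by
  obtain ⟨j, hj⟩ := mem_iUnion.1 (hY hz)
  rcases eq_or_ne j i with rfl | hji
  exacts [.inl hj, .inr ⟨j, hji, hj⟩]

end DisjointSets

section Equivalence

variable {X : Type*} [MetricSpace X] {ν : ℕ → X} {T : Type*} {α : Type} [Primcodable α]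
  {nm : T → Baire} {𝒴 : Set (Set X)} {δ : Naming (Set X)}

theorem NamedFrom.compl {A : T → α → Set X} (h : NamedFrom nm (closedName ν) A) :
    NamedFrom nm (openName ν) fun t a => (A t a)ᶜ := h

theorem NamedFrom.of_compl {A : T → α → Set X} (h : NamedFrom nm (openName ν) fun t a => (A t a)ᶜ) :
    NamedFrom nm (closedName ν) A := h

theorem NamedFrom.rePred_mem {R : T → α → Set (ℕ × ℕ)} (hR : NamedFrom nm enumName R) :
    REPredFrom nm fun t (z : α × ℕ × ℕ) => z.2 ∈ R t z.1 := by
  obtain ⟨F, hF, hFR⟩ := hR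
  refine (REPredFrom.exists (P := fun t (z : α × ℕ × ℕ) i =>
    F t (z.1, i) = Nat.pair z.2.1 z.2.2 + 1) (ComputableFrom.rePred_eq
      (hF.reindex (g := fun z : (α × ℕ × ℕ) × ℕ => (z.1.1, z.2)) (by fun_prop))
      (.of_computable (by fun_prop)))).congr fun t z => ?_
  rw [show R t z.1 = _ from hFR t z.1]
  rfl

theorem NamedFrom.enumName_of_rePred {R : T → α → Set (ℕ × ℕ)}
    (hR : REPredFrom nm fun t (z : α × ℕ × ℕ) => z.2 ∈ R t z.1) : NamedFrom nm enumName R := by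
  obtain ⟨F, hF, hFR⟩ := (hR.reindex (g := fun z : α × ℕ => (z.1, z.2.unpair))
    (by fun_prop)).exists_enumeration
  refine ⟨F, hF, fun t a => ext fun c => ?_⟩
  have h := hFR t a (Nat.pair c.1 c.2)
  rwa [Nat.unpair_pair] at h

theorem SComputable.exists_shrinking (hS : SComputable ν 𝒴 δ) {U : T → α → ℕ → Set X}
    (hU : NamedFrom nm (openName ν) fun t (z : α × ℕ) => U t z.1 z.2) {Y : T → α → Set X}
    (hY : NamedFrom nm δ Y) (hY𝒴 : ∀ t a, Y t a ∈ 𝒴) (hcover : ∀ t a, Y t a ⊆ ⋃ i, U t a i) :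
    ∃ W : T → α → ℕ → Set X, NamedFrom nm (openName ν) (fun t (z : α × ℕ) => W t z.1 z.2) ∧
      ∀ t a, (∀ i, W t a i ⊆ U t a i) ∧ Y t a ⊆ ⋃ i, W t a i ∧
        Pairwise fun i j => Disjoint (W t a i) (W t a j) := by
  obtain ⟨W, hW, hWval⟩ := Operation.IsComputable.apply (f := opS 𝒴) hS (hU.seq.prod hY)
    fun t a => ⟨fun i => hU.isOpen t (a, i), hY𝒴 t a, hcover t a⟩
  exact ⟨W, hW.seq_apply, fun t a => ⟨fun i => ((hWval t a).1 i).2, (hWval t a).2⟩⟩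

theorem SComputable.of_exists_shrinking
    (h : ∃ W : (opS 𝒴).Input (prodName (seqName (openName ν)) δ) → Unit → ℕ → Set X,
      NamedFrom Operation.Input.name (openName ν) (fun t (z : Unit × ℕ) => W t z.1 z.2) ∧
        ∀ t a, (∀ i, W t a i ⊆ t.1.2.1 i) ∧ t.1.2.2 ⊆ ⋃ i, W t a i ∧
          Pairwise fun i j => Disjoint (W t a i) (W t a j)) : SComputable ν 𝒴 δ := by
  obtain ⟨W, hW, hWval⟩ := h
  exact Operation.isComputable_of_named (f := opS 𝒴) ⟨W, hW.seq, fun t =>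
    ⟨fun i => ⟨hW.isOpen t ((), i), (hWval t ()).1 i⟩, (hWval t ()).2⟩⟩

theorem SComputable.exists_shrinking_pair (hS : SComputable ν 𝒴 δ) {U V Y : T → α → Set X}
    (hU : NamedFrom nm (openName ν) U) (hV : NamedFrom nm (openName ν) V) (hY : NamedFrom nm δ Y)
    (hY𝒴 : ∀ t a, Y t a ∈ 𝒴) (hcover : ∀ t a, Y t a ⊆ U t a ∪ V t a) :
    ∃ U' V' : T → α → Set X, NamedFrom nm (openName ν) U' ∧ NamedFrom nm (openName ν) V' ∧
      ∀ t a, U' t a ⊆ U t a ∧ V' t a ⊆ V t a ∧ Y t a ⊆ U' t a ∪ V' t a ∧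
        Disjoint (U' t a) (V' t a) := by
  obtain ⟨W, hW, hWval⟩ := hS.exists_shrinking (nm := nm)
    (U := fun t a i => {z | i = 0 ∧ z ∈ U t a} ∪ {z | i = 1 ∧ z ∈ V t a})
    ((NamedFrom.sep (ComputableFrom.rePred_eq (.of_computable (by fun_prop))
      (.of_computable (by fun_prop))) (hU.reindex (by fun_prop))).union
      (NamedFrom.sep (ComputableFrom.rePred_eq (.of_computable (by fun_prop))
        (.of_computable (by fun_prop))) (hV.reindex (by fun_prop)))) hY hY𝒴
    fun t a z hz => mem_iUnion.2 ((hcover t a hz).elim (fun h => ⟨0, .inl ⟨rfl, h⟩⟩)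
      fun h => ⟨1, .inr ⟨rfl, h⟩⟩)
  refine ⟨fun t a => W t a 0, fun t a => W t a 1, hW.reindex (g := fun a => (a, 0)) (by fun_prop),
    hW.reindex (g := fun a => (a, 1)) (by fun_prop), fun t a => ?_⟩
  obtain ⟨hsub, hWcover, hdisj⟩ := hWval t a
  refine ⟨fun z hz => ?_, fun z hz => ?_, fun z hz => ?_, hdisj zero_ne_one⟩
  · exact (hsub 0 hz).elim And.right fun h => absurd h.1 zero_ne_one
  · exact (hsub 1 hz).elim (fun h => absurd h.1 one_ne_zero) And.right
  · obtain ⟨i, hi⟩ := mem_iUnion.1 (hWcover hz)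
    rcases hsub i hi with ⟨rfl, -⟩ | ⟨rfl, -⟩
    exacts [.inl hi, .inr hi]

/-- Disjoint open sets containing `U \ V` and `V \ U` can be computed from `U` and `V`; this is used
for `U = (W ∪ Yᶜ) \ B` and `V = (W' ∪ Yᶜ) \ A`, where `W` and `W'` are disjoint and cover `Y`. -/
theorem SComputable.exists_separation (hν : IsComputableMetricSpace ν)
    (hneg : Reducible δ (closedName ν)) (hS : SComputable ν 𝒴 δ) {A B Y : T → α → Set X}
    (hA : NamedFrom nm (closedName ν) A) (hB : NamedFrom nm (closedName ν) B)
    (hY : NamedFrom nm δ Y) (hY𝒴 : ∀ t a, Y t a ∈ 𝒴) (hAB : ∀ t a, Disjoint (A t a) (B t a)) :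
    ∃ U V : T → α → Set X, NamedFrom nm (openName ν) U ∧ NamedFrom nm (openName ν) V ∧
      ∀ t a, A t a ⊆ U t a ∧ B t a ⊆ V t a ∧ Y t a ⊆ U t a ∪ V t a ∧
        Disjoint (U t a) (V t a) := by
  have hYc := (hY.reduce hneg).compl
  obtain ⟨W, W', hW, hW', hWval⟩ := hS.exists_shrinking_pair hB.compl hA.compl hY hY𝒴
    fun t a z _ => by
      rw [← compl_inter, disjoint_iff_inter_eq_empty.1 (hAB t a).symm, compl_empty]
      trivial
  obtain ⟨U, V, hU, hV, hUV⟩ := NamedFrom.exists_disjoint hν (.inter hν (hW.union hYc) hB.compl)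
    (.inter hν (hW'.union hYc) hA.compl)
  refine ⟨U, V, hU, hV, fun t a => ?_⟩
  obtain ⟨hWB, hWA, hcover, hWW⟩ := hWval t a
  obtain ⟨hdisj, -, -, hUsub, hVsub⟩ := hUV t a
  rw [subset_compl_iff_disjoint_right] at hWB hWA
  have hAU : A t a ∪ (Y t a ∩ W t a) ⊆ U t a :=
    (union_inter_subset_sdiff (hAB t a) hWB hWA hWW hcover).trans hUsub
  have hBV : B t a ∪ (Y t a ∩ W' t a) ⊆ V t a :=
    (union_inter_subset_sdiff (hAB t a).symm hWA hWB hWW.symm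
      (by rwa [union_comm])).trans hVsub
  rw [union_subset_iff] at hAU hBV
  exact ⟨hAU.1, hBV.1, fun z hz => (hcover hz).imp (fun h => hAU.2 ⟨hz, h⟩) fun h => hBV.2 ⟨hz, h⟩,
    hdisj⟩

theorem NComputable.of_SComputable (hν : IsComputableMetricSpace ν)
    (hneg : Reducible δ (closedName ν)) (hS : SComputable ν 𝒴 δ) : NComputable ν 𝒴 δ := by
  refine Operation.isComputable_of_named (f := opN 𝒴) ?_
  have hin := Operation.Input.named (opN 𝒴)
    (prodName (closedName ν) (prodName (closedName ν) δ))
  obtain ⟨U, V, hU, hV, hUV⟩ := hS.exists_separation hν hneg hin.fst hin.snd.fst hin.snd.snd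
    (fun t _ => t.2.1.2.2.1) fun t _ => t.2.1.2.2.2
  exact ⟨fun t a => (U t a, V t a), hU.prod hV, fun t => ⟨hU.isOpen t (), hV.isOpen t (), hUV t ()⟩⟩

theorem MComputable.of_NComputable (hν : IsComputableMetricSpace ν)
    (hN : NComputable ν 𝒴 δ) : MComputable ν 𝒴 δ := by
  refine Operation.isComputable_of_named (f := opM 𝒴) ?_
  have hin := Operation.Input.named (opM 𝒴) (prodName (cauchyName ν) (prodName (openName ν) δ))
  have hU := hin.snd.fst
  have hx : NamedFrom Operation.Input.name (closedName ν)
      fun (t : (opM 𝒴).Input (prodName (cauchyName ν) (prodName (openName ν) δ))) (_ : Unit) =>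
        ({t.1.2.1} : Set X) :=
    .of_compl ((NamedFrom.setOf_lt_dist hν hin.fst ComputableRealFrom.zero).congr fun t _ => by
      ext z
      rw [mem_compl_iff, mem_singleton_iff, mem_ofPred_eq, dist_pos, ne_comm])
  obtain ⟨o, ho, hval⟩ := Operation.IsComputable.apply (f := opN 𝒴) hN
    (hx.prod ((NamedFrom.of_compl (hU.congr fun t _ => compl_compl _)).prod hin.snd.snd))
    fun t _ => ⟨isClosed_singleton, (hU.isOpen t ()).isClosed_compl, t.2.1.2.1,
      Set.disjoint_singleton_left.2 (not_not_intro t.2.1.2.2)⟩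
  refine ⟨o, ho, fun t => ?_⟩
  obtain ⟨hV, hW, hxV, hUW, hcover, hdisj⟩ := hval t ()
  exact ⟨hV, hW, hxV rfl, (subset_compl_iff_disjoint_right.2 hdisj).trans (compl_subset_comm.1 hUW),
    hcover, hdisj⟩

theorem IsPointPrefix.exists_mem {A : T → Set X} (hA : ∀ t, IsOpen (A t))
    {U : WithPoint ν A → Set X}
    (hU : NamedFrom (withPointName nm A) (openName ν) fun s (_ : Unit) => U s)
    {s : WithPoint ν A} {z : X} (hz : z ∈ U s) :
    ∃ (σ : List ℕ) (h : IsPointPrefix ν A s.1.1 σ), z ∈ U h.point := by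
  obtain ⟨E, hE, hEU⟩ := hU.exists_rePred
  obtain ⟨c, hc, hzc⟩ := (hEU _ () _).1 hz
  obtain ⟨σ, h, hσ⟩ := IsPointPrefix.exists_of_rePred hA hE hc
  exact ⟨σ, h, (hEU _ () _).2 ⟨c, hσ, hzc⟩⟩

theorem SComputable.of_MComputable (hν : IsComputableMetricSpace ν)
    (hM : MComputable ν 𝒴 δ) : SComputable ν 𝒴 δ := by
  have hin := Operation.Input.named (opS 𝒴) (prodName (seqName (openName ν)) δ)
  let A (s : (opS 𝒴).Input (prodName (seqName (openName ν)) δ) × ℕ) : Set X := s.1.1.2.1 s.2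
  have hA : NamedFrom (withNatName Operation.Input.name) (openName ν) fun s (_ : Unit) => A s :=
    (hin.fst.seq_apply.pullback computableFrom_withNatName_fst).comp (G := fun s _ => ((), s.2))
      ((ComputableFrom.of_computable (Computable.const ())).pair computableFrom_withNatName_snd)
  have hbase := WithPoint.computableFrom_base (ν := ν) (nm := withNatName Operation.Input.name) A
  obtain ⟨o, ho, hval⟩ := Operation.IsComputable.apply (f := opM 𝒴) hM
    ((WithPoint.named A).prod ((hA.pullback hbase).prod
      ((hin.snd.pullback computableFrom_withNatName_fst).pullback hbase)))
    fun s _ => ⟨hA.isOpen s.1.1 (), s.1.1.1.2.1.2.1, s.2.2⟩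
  have hV := NamedFrom.of_isPointPrefix hν hA (U := fun s => (o s ()).1) ho.fst
  have hW := NamedFrom.of_isPointPrefix hν hA (U := fun s => (o s ()).2) ho.snd
  have hsnd : Computable (Prod.snd : Unit × ℕ × List ℕ → ℕ × List ℕ) := Computable.snd
  refine .of_exists_shrinking (NamedFrom.exists_reduction hν (U := fun t _ => t.1.2.1)
    (Y := fun t _ => t.1.2.2) (ι := fun b => b.1)
    ((REPredFrom.isPointPrefix hν hA).uncurry.reindex hsnd) (by fun_prop)
    (hV.uncurry.reindex hsnd) (hW.uncurry.reindex hsnd)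
    (fun t _ b hb => ?_) fun t _ y hy => ?_)
  · obtain ⟨-, -, -, hVU, hcover, hdisj⟩ := hval hb.point ()
    refine ⟨Set.disjoint_left.2 ?_, fun z hz => ?_, ?_⟩
    · rintro z ⟨_, hzV⟩ ⟨_, hzW⟩
      exact Set.disjoint_left.1 hdisj hzV hzW
    · exact (hcover hz).imp (fun h => ⟨hb, h⟩) fun h => ⟨hb, h⟩
    · rintro z ⟨_, hzV⟩
      exact hVU hzV
  · obtain ⟨i, hi⟩ := mem_iUnion.1 (t.2.1.2.2 hy)
    obtain ⟨q, hq⟩ := exists_cauchyName hν.dense y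
    obtain ⟨σ, hσ, hyσ⟩ := IsPointPrefix.exists_mem (fun s => hA.isOpen s ()) ho.fst
      (U := fun s => (o s ()).1) (s := ⟨((t, i), q, y), hq, hi⟩) (hval _ ()).2.2.1
    exact ⟨(i, σ), hσ, hσ, hyσ⟩

theorem SComputable.of_BComputable (hν : IsComputableMetricSpace ν)
    (hB : BComputable ν 𝒴 δ) : SComputable ν 𝒴 δ := by
  have hin := Operation.Input.named (opS 𝒴) (prodName (seqName (openName ν)) δ)
  obtain ⟨o, ho, hval⟩ := Operation.IsComputable.apply (f := opB ν 𝒴) hB hin.snd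
    fun t _ => t.2.1.2.1
  obtain ⟨E, hE, hEU⟩ := hin.fst.seq_apply.exists_rePred
  refine .of_exists_shrinking (NamedFrom.exists_reduction hν (U := fun t _ => t.1.2.1)
    (Y := fun t _ => t.1.2.2) (ι := fun b : (ℕ × ℕ) × ℕ => b.2)
    (Good := fun t z => z.2.1 ∈ (o t z.1).2.2 ∧ E t ((z.1, z.2.2), z.2.1.2))
    (V := fun t z => (o t z.1).1 z.2.1.1 ∩ idealBall ν z.2.1.2)
    (W := fun t z => (o t z.1).2.1 z.2.1.1)
    ((ho.snd.snd.rePred_mem.reindex (g := fun z : Unit × (ℕ × ℕ) × ℕ => (z.1, z.2.1))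
      (by fun_prop)).and (hE.reindex (by fun_prop))) (by fun_prop)
    (NamedFrom.inter hν (ho.fst.seq_apply.reindex (g := fun z : Unit × (ℕ × ℕ) × ℕ =>
      (z.1, z.2.1.1)) (by fun_prop)) (NamedFrom.ball hν
        (NamedFrom.dense (.of_computable (by fun_prop)))
        (ComputableRealFrom.radius (.of_computable (by fun_prop)))))
    (ho.snd.fst.seq_apply.reindex (g := fun z : Unit × (ℕ × ℕ) × ℕ => (z.1, z.2.1.1))
      (by fun_prop)) (fun t u b hb => ?_) fun t u y hy => ?_)
  · obtain ⟨hclopen, hincl, -⟩ := hval t u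
    refine ⟨(hclopen b.1.1).2.2.2.mono_left inter_subset_left, fun z hz => ?_, fun z hz =>
      (hEU t (u, b.2) z).2 ⟨b.1.2, hb.2, hz.2⟩⟩
    exact ((hclopen b.1.1).2.2.1 hz).imp_left fun h => ⟨h, (hincl _ _ hb.1 ⟨h, hz⟩).1⟩
  · obtain ⟨-, -, hbasis⟩ := hval t u
    obtain ⟨j, hj⟩ := mem_iUnion.1 (t.2.1.2.2 hy)
    obtain ⟨a, ha, hya⟩ := (hEU t (u, j) y).1 hj
    obtain ⟨i, hi, hyi⟩ := hbasis a y ⟨hya, hy⟩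
    exact ⟨((i, a), j), ⟨hi, ha⟩, hyi.1, hya⟩

/-- The code of the ideal ball with centre `ν j` and radius `1 / (k + 1)`. -/
def unitFractionBall (k j : ℕ) : ℕ := Nat.pair j (Nat.pair 0 k)

@[fun_prop]
theorem computable_unitFractionBall {f g : α → ℕ} (hf : Computable f) (hg : Computable g) :
    Computable fun x => unitFractionBall (f x) (g x) := by
  unfold unitFractionBall
  fun_prop

theorem mem_idealBall_unitFractionBall {k j : ℕ} {z : X} :
    z ∈ idealBall ν (unitFractionBall k j) ↔ dist z (ν j) < 1 / ((k : ℝ) + 1) := by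
  simp [unitFractionBall, mem_idealBall, posRat]

theorem exists_formallyIncluded_unitFractionBall {z : X} {a : ℕ} (hz : z ∈ idealBall ν a) :
    ∃ k, ∀ j, z ∈ idealBall ν (unitFractionBall k j) →
      FormallyIncluded ν (unitFractionBall k j) a := by
  obtain ⟨k, hk⟩ := exists_nat_one_div_lt (half_pos (sub_pos.2 (mem_idealBall.1 hz)))
  refine ⟨k, fun j hj => ?_⟩
  rw [mem_idealBall_unitFractionBall] at hj
  have := dist_triangle_left (ν j) (ν a.unpair.1) z
  simp only [FormallyIncluded, unitFractionBall, Nat.unpair_pair, posRat, Nat.cast_zero, zero_add,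
    Rat.cast_div, Rat.cast_one, Rat.cast_add, Rat.cast_natCast] at hk ⊢
  linarith

/-- The basis consists of the members of disjoint refinements of the covers of `Y` by the balls of
radius `1 / (k + 1)` around the points of the dense sequence. -/
theorem BComputable.of_SComputable (hν : IsComputableMetricSpace ν)
    (hS : SComputable ν 𝒴 δ) : BComputable ν 𝒴 δ := by
  refine Operation.isComputable_of_named (f := opB ν 𝒴) ?_
  have hY := Operation.Input.named (opB ν 𝒴) δ
  obtain ⟨W, hW, hWval⟩ := hS.exists_shrinking
    (U := fun _ k j => idealBall ν (unitFractionBall k j))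
    (NamedFrom.ball hν (NamedFrom.dense (.of_computable (by fun_prop)))
      (ComputableRealFrom.radius (.of_computable (by fun_prop))))
    (hY.reindex (g := fun _ : ℕ => ()) (by fun_prop)) (fun t _ => t.2.1) fun t k z _ => by
      obtain ⟨j, hj⟩ := hν.dense.exists_dist_lt z (Nat.one_div_pos_of_nat (α := ℝ) (n := k))
      exact mem_iUnion.2 ⟨j, mem_idealBall_unitFractionBall.2 hj⟩
  have hU : NamedFrom Operation.Input.name (seqName (openName ν))
      fun t (_ : Unit) n => W t n.unpair.1 n.unpair.2 :=
    .seq (hW.reindex (g := fun z : Unit × ℕ => z.2.unpair) (by fun_prop))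
  have hV : NamedFrom Operation.Input.name (seqName (openName ν))
      fun t (_ : Unit) n => {x | ∃ j, j ≠ n.unpair.2 ∧ x ∈ W t n.unpair.1 j} :=
    .seq <| NamedFrom.biUnion (P := fun _ (z : Unit × ℕ) j => j ≠ z.2.unpair.2)
      (U := fun t z j => W t z.2.unpair.1 j)
      (ComputableFrom.rePred_ne (.of_computable (by fun_prop)) (.of_computable (by fun_prop)))
      (hW.reindex (g := fun z : (Unit × ℕ) × ℕ => (z.1.2.unpair.1, z.2)) (by fun_prop))
  have hR : NamedFrom Operation.Input.name enumName fun (_ : (opB ν 𝒴).Input δ) (_ : Unit) =>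
      {c : ℕ × ℕ | FormallyIncluded ν (unitFractionBall c.1.unpair.1 c.1.unpair.2) c.2} :=
    .enumName_of_rePred ((REPredFrom.formallyIncluded hν).reindex (g := fun z : Unit × ℕ × ℕ =>
      (unitFractionBall z.2.1.unpair.1 z.2.1.unpair.2, z.2.2))
      (by fun_prop))
  refine ⟨_, hU.prod (hV.prod hR), fun t => ⟨fun n =>
    ⟨hU.seq_apply.isOpen t ((), n), hV.seq_apply.isOpen t ((), n),
      subset_union_biUnion_ne (hWval t _).2.1 _, disjoint_biUnion_ne (hWval t _).2.2 _⟩, ?_, ?_⟩⟩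
  · rintro n a hna z ⟨hz, hzY⟩
    exact ⟨hna.subset ((hWval t _).1 _ hz), hzY⟩
  · rintro a z ⟨hza, hzY⟩
    obtain ⟨k, hk⟩ := exists_formallyIncluded_unitFractionBall hza
    obtain ⟨hsub, hcover, -⟩ := hWval t k
    obtain ⟨j, hj⟩ := mem_iUnion.1 (hcover hzY)
    refine ⟨Nat.pair k j, ?_, ?_, hzY⟩
    · simpa only [mem_ofPred_eq, Nat.unpair_pair] using hk j (hsub j hj)
    · simpa only [Nat.unpair_pair] using hj

end Equivalence

section ClosedSets

variable {X : Type*} [MetricSpace X] {ν : ℕ → X} {T : Type*} {α : Type} [Primcodable α]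
  {nm : T → Baire}

theorem lt_dist_of_lt_infEDist {r : ℝ} {x y : X} {B : Set X} (hy : y ∈ B)
    (h : (r : EReal) < (Metric.infEDist x B : EReal)) : r < dist x y := by
  have hle : (Metric.infEDist x B : EReal) ≤ (edist x y : EReal) :=
    EReal.coe_ennreal_le_coe_ennreal_iff.2 (Metric.infEDist_le_edist_of_mem hy)
  rw [edist_dist, EReal.coe_ennreal_ofReal, max_eq_left dist_nonneg] at hle
  exact EReal.coe_lt_coe_iff.1 (h.trans_le hle)

theorem lt_infEDist_of_forall_le {r s : ℝ} {x : X} {B : Set X} (hrs : r < s)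
    (h : ∀ y ∈ B, s ≤ dist x y) : (r : EReal) < (Metric.infEDist x B : EReal) := by
  have hle : ENNReal.ofReal s ≤ Metric.infEDist x B := Metric.le_infEDist.2 fun y hy => by
    rw [edist_dist]
    exact ENNReal.ofReal_le_ofReal (h y hy)
  have hle' := EReal.coe_ennreal_le_coe_ennreal_iff.2 hle
  rw [EReal.coe_ennreal_ofReal] at hle'
  exact (EReal.coe_lt_coe_iff.2 (hrs.trans_le (le_max_left s 0))).trans_le hle'

theorem lt_infEDist_pair_iff {r : ℝ} {x y z : X} :
    (r : EReal) < (Metric.infEDist z {x, y} : EReal) ↔ r < dist z x ∧ r < dist z y := by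
  refine ⟨fun h => ⟨lt_dist_of_lt_infEDist (mem_insert x {y}) h,
    lt_dist_of_lt_infEDist (mem_insert_of_mem x (mem_singleton y)) h⟩, fun ⟨hx, hy⟩ =>
    lt_infEDist_of_forall_le (lt_min hx hy) ?_⟩
  rintro w (rfl | rfl)
  exacts [min_le_left _ _, min_le_right _ _]

theorem NamedFrom.exists_dense_seq {B : T → α → Set X} (h : NamedFrom nm (rangeName ν) B)
    (hne : ∀ t a, (B t a).Nonempty) :
    ∃ b : T → α → ℕ → X, NamedFrom nm (cauchyName ν) (fun t (z : α × ℕ) => b t z.1 z.2) ∧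
      ∀ t a, (∀ i, b t a i ∈ B t a) ∧ B t a ⊆ closure (range (b t a)) := by
  obtain ⟨F, hF, hFB⟩ := h
  have hdense (t : T) (a : α) : ∃ y : ℕ → X, (∀ i, cauchyName ν
      (fun k => component (fun k => F t (a, k)) i k - 1) (y i)) ∧
      (∀ i, y i ∈ B t a) ∧ B t a ⊆ closure (range y) :=
    (hFB t a).2.elim (fun h => absurd h.1 (hne t a).ne_empty) fun h => h.2.2
  choose y hFy hy using hdense
  exact ⟨y, ⟨fun t z => F t (z.1.1, Nat.pair z.1.2 z.2) - 1,
    ComputableFrom.map (g := fun n => n - 1) (by fun_prop) (hF.reindex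
      (g := fun z : (α × ℕ) × ℕ => (z.1.1, Nat.pair z.1.2 z.2)) (by fun_prop)),
    fun t a => hFy t a.1 a.2⟩, hy⟩

theorem NamedFrom.rePred_lt_infEDist {B : T → α → Set X} (h : NamedFrom nm (distName ν) B) :
    REPredFrom nm fun t (z : α × ℕ) =>
      (((posRat z.2.unpair.2 : ℚ) : ℝ) : EReal) < (Metric.infEDist (ν z.2.unpair.1) (B t z.1)) := by
  obtain ⟨F, hF, hFB⟩ := h
  choose R hR hRB using fun t (y : α × ℕ) =>
    (hFB t y.1).2 (fun _ => y.2.unpair.1) _ (cauchyName_const (ν := ν) y.2.unpair.1)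
  have hRc : ComputableFrom nm fun t (z : (α × ℕ) × ℕ) => R t z.1 z.2 :=
    ComputableFrom.of_eta (A := fun t (z : (α × ℕ) × ℕ) => F t (z.1.1, z.2))
      (Q := fun _ (z : (α × ℕ) × ℕ) => z.1.2.unpair.1)
      (hF.reindex (by fun_prop)) (.of_computable (by fun_prop)) hR
  refine (REPredFrom.exists (P := fun t (z : α × ℕ) i => R t z i = ratPos z.2.unpair.2 + 1)
    (ComputableFrom.rePred_eq hRc (.of_computable (by fun_prop)))).congr fun t z => ?_
  have hmem := Set.ext_iff.1 (hRB t z) (ratPos z.2.unpair.2)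
  rwa [mem_ofPred_eq, mem_ofPred_eq, rat_ratPos] at hmem

theorem NamedFrom.compl_of_distName (hν : IsComputableMetricSpace ν) {B : T → α → Set X}
    (h : NamedFrom nm (distName ν) B) : NamedFrom nm (openName ν) fun t a => (B t a)ᶜ := by
  have hclosed (t : T) (a : α) : IsClosed (B t a) := h.choose_spec.2 t a |>.1
  refine NamedFrom.openName_of_rePred h.rePred_lt_infEDist (fun t a c hc z hz hzB => ?_)
    fun t a z hz => ?_
  · rw [mem_idealBall, dist_comm] at hz
    exact lt_asymm (lt_dist_of_lt_infEDist hzB hc) hz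
  · obtain ⟨ε, hε, hball⟩ := Metric.isOpen_iff.1 (hclosed t a).isOpen_compl z hz
    obtain ⟨c, hzc, hcenter, hradius⟩ := exists_idealBall hν.dense z (half_pos hε)
    refine ⟨c, lt_infEDist_of_forall_le hradius fun y hy => ?_, hzc⟩
    have hyz : ε ≤ dist y z := not_lt.1 fun hlt => hball hlt hy
    have htriangle := dist_triangle_right y z (ν c.unpair.1)
    rw [dist_comm y (ν c.unpair.1)] at htriangle
    linarith

theorem NamedFrom.rangeName_pair {x y : T → Unit → X} (hx : NamedFrom nm (cauchyName ν) x)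
    (hy : NamedFrom nm (cauchyName ν) y) :
    NamedFrom nm (rangeName ν) fun t a => {x t a, y t a} := by
  obtain ⟨F, hF, hFx⟩ := hx
  obtain ⟨G, hG, hGy⟩ := hy
  let H (t : T) (z : Unit × ℕ) : ℕ := bif decide (z.2.unpair.1 = 0) then F t (z.1, z.2.unpair.2)
    else G t (z.1, z.2.unpair.2)
  have hH : ComputableFrom nm H := ComputableFrom.cond
    (.of_computable (computable_decide_eq (g := fun _ => 0) (by fun_prop) (by fun_prop)))
    (hF.reindex (g := fun z : Unit × ℕ => (z.1, z.2.unpair.2)) (by fun_prop))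
    (hG.reindex (g := fun z : Unit × ℕ => (z.1, z.2.unpair.2)) (by fun_prop))
  refine ⟨fun t z => H t z + 1, hH.map (g := fun n => n + 1) (by fun_prop),
    fun t a => ⟨(Set.toFinite _).isClosed, Or.inr ⟨(insert_nonempty _ _).ne_empty,
      fun i => Nat.succ_pos _, fun i => if i = 0 then x t a else y t a, fun i => ?_,
      fun i => ?_, ?_⟩⟩⟩
  · by_cases hi : i = 0
    · simpa [H, component, hi] using hFx t a
    · simpa [H, component, hi] using hGy t a
  · by_cases hi : i = 0 <;> simp [hi]
  · refine subset_closure.trans' ?_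
    rintro z (rfl | rfl)
    exacts [⟨0, if_pos rfl⟩, ⟨1, if_neg one_ne_zero⟩]

theorem NamedFrom.distName_pair (hν : IsComputableMetricSpace ν) {x y : T → Unit → X}
    (hx : NamedFrom nm (cauchyName ν) x) (hy : NamedFrom nm (cauchyName ν) y) :
    NamedFrom nm (distName ν) fun t a => {x t a, y t a} := by
  let A : T → Set X := fun _ => univ
  have hdist {w : T → Unit → X} (hw : NamedFrom nm (cauchyName ν) w) :
      REPredFrom (withPointName (ν := ν) nm A) fun s (k : ℕ) =>
        ((rat k : ℚ) : ℝ) < dist s.1.2.2 (w s.1.1 ()) :=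
    ComputableRealFrom.lt (.of_rat (.of_computable (by fun_prop)))
      ((ComputableRealFrom.dist hν (WithPoint.named A)
        (hw.pullback (WithPoint.computableFrom_base A))).reindex (Computable.const ()))
  obtain ⟨G, hG, hGdist⟩ := (((hdist hx).and (hdist hy)).reindex
    (g := fun z : Unit × ℕ => z.2) (by fun_prop)).exists_enumeration
  obtain ⟨F, hF, hFG⟩ := ComputableFrom.curry (base := fun s : WithPoint ν A => s.1.1)
    (q := fun s => s.1.2.1) (fun _ => rfl) (G := fun s k => G s ((), k))
    (hG.reindex (g := fun k => ((), k)) (by fun_prop))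
  refine ⟨F, hF, fun t a => ⟨(Set.toFinite _).isClosed, fun q z hq =>
    ⟨_, hFG ⟨(t, q, z), hq, mem_univ z⟩, Set.ext fun n => ?_⟩⟩⟩
  exact lt_infEDist_pair_iff.trans (hGdist ⟨(t, q, z), hq, mem_univ z⟩ () n)

end ClosedSets

section Maps

variable {X : Type*} [MetricSpace X] {ν : ℕ → X} {T : Type*} {α : Type} [Primcodable α]
  {nm : T → Baire}

theorem NamedFrom.of_dist_le {y : T → α → ℕ → X} {l : T → α → X}
    (hy : NamedFrom nm (cauchyName ν) fun t (z : α × ℕ) => y t z.1 z.2)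
    (hyl : ∀ t a k, dist (y t a k) (l t a) ≤ 2 * (2 : ℝ)⁻¹ ^ k) :
    NamedFrom nm (cauchyName ν) l := by
  obtain ⟨F, hF, hFy⟩ := hy
  refine ⟨fun t z => F t ((z.1, z.2 + 3), z.2 + 3), hF.reindex (by fun_prop), fun t a =>
    cauchyName_of_lt fun i => ?_⟩
  have hFyi := (hFy t (a, i + 3)).dist_le (i + 3)
  have htriangle := dist_triangle (ν (F t ((a, i + 3), i + 3))) (y t a (i + 3)) (l t a)
  have hpow : (2 : ℝ)⁻¹ ^ (i + 3) = 2⁻¹ ^ (i + 1) / 4 := by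
    rw [show i + 3 = i + 1 + 2 by omega, pow_add _ (i + 1) 2]
    norm_num
    ring
  have hpos : (0 : ℝ) < 2⁻¹ ^ (i + 1) := by positivity
  linarith [hyl t a (i + 3)]

theorem NamedFrom.map_apply {f : T → Unit → X →. X} (hf : NamedFrom nm (partialMapName ν) f)
    {A : T → Set X} {v : T → X → X} (hv : ∀ t, ∀ z ∈ A t, v t z ∈ f t () z) :
    NamedFrom (withPointName (ν := ν) nm A) (cauchyName ν) fun s (_ : Unit) => v s.1.1 s.1.2.2 := by
  obtain ⟨F, hF, hFf⟩ := hf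
  choose R hR hRv using fun (s : WithPoint ν A) (_ : Unit) =>
    (hFf s.1.1 ()).1 s.1.2.1 s.1.2.2 s.2.1 _ (hv s.1.1 _ s.2.2)
  exact ⟨fun s z => R s z.1 z.2, ComputableFrom.of_eta
    (A := fun (s : WithPoint ν A) (z : Unit × ℕ) => left (fun k => F s.1.1 ((), k)) z.2)
    (Q := fun (s : WithPoint ν A) z => s.1.2.1 z.2)
    (hF.left.pullback (WithPoint.computableFrom_base A))
    ((WithPoint.computableFrom_point A).reindex (by fun_prop)) hR, hRv⟩

theorem NamedFrom.partialMapName_of_withPoint {A : T → Unit → Set X}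
    (hA : NamedFrom nm (closedName ν) A) {v : T → X → X}
    (hv : NamedFrom (withPointName (ν := ν) nm fun t => A t ()) (cauchyName ν)
      fun s (_ : Unit) => v s.1.1 s.1.2.2) :
    NamedFrom nm (partialMapName ν) fun t u x => ⟨x ∈ A t u, fun _ => v t x⟩ := by
  obtain ⟨G, hG, hGv⟩ := hv
  obtain ⟨F, hF, hFG⟩ := ComputableFrom.curry (base := fun s : WithPoint ν fun t => A t () => s.1.1)
    (q := fun s => s.1.2.1) (fun _ => rfl) (G := fun s k => G s ((), k))
    (hG.reindex (g := fun k => ((), k)) (by fun_prop))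
  obtain ⟨C, hC, hCA⟩ := hA
  refine ⟨_, hF.interleave hC, fun t u => ⟨?_, ?_⟩⟩
  · simp only [left_interleave]
    rintro p x hp y ⟨hx, rfl⟩
    exact ⟨_, hFG ⟨(t, p, x), hp, hx⟩, hGv ⟨(t, p, x), hp, hx⟩ ()⟩
  · simp only [right_interleave]
    exact hCA t u

end Maps

section Freeze

/-- The sequence `ι k - 1`, kept constant from the first zero of `ι` on. In the construction of a
retraction onto `B`, `ι k = j + 1` says that the point is close to the `j`-th point of `B`, and
`ι k = 0` that it lies outside `B`. -/
def freeze (ι : ℕ → ℕ) : ℕ → ℕ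
  | 0 => ι 0 - 1
  | k + 1 => if ∀ i < k + 2, ι i ≠ 0 then ι (k + 1) - 1 else freeze ι k

theorem freeze_of_forall_ne_zero {ι : ℕ → ℕ} {k : ℕ} (h : ∀ i ≤ k, ι i ≠ 0) :
    ι k = freeze ι k + 1 := by
  cases k with
  | zero => exact (Nat.succ_pred_eq_of_ne_zero (h 0 le_rfl)).symm
  | succ k =>
    rw [freeze, if_pos fun i hi => h i (by omega)]
    exact (Nat.succ_pred_eq_of_ne_zero (h (k + 1) le_rfl)).symm

theorem freeze_congr {ι κ : ℕ → ℕ} {k : ℕ} (h : ∀ i ≤ k, ι i = κ i) : freeze ι k = freeze κ k := by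
  induction k with
  | zero => exact congrArg (· - 1) (h 0 le_rfl)
  | succ k ih =>
    rw [freeze, freeze, h _ le_rfl, ih fun i hi => h i (by omega)]
    exact if_congr (forall₂_congr fun i hi => by rw [h i (by omega)]) rfl rfl

theorem computable_forall_getD_ne_zero :
    Computable fun z : List ℕ × ℕ => decide (∀ i < z.2, z.1.getD i 0 ≠ 0) := by
  have hne : Computable fun y : (List ℕ × ℕ) × ℕ => !decide (y.1.1.getD y.2 0 = 0) :=
    computable_not (computable_decide_eq (by fun_prop) (by fun_prop))
  have hforall : Computable fun z : List ℕ × ℕ =>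
      decide (∀ i < z.2, (!decide (z.1.getD i 0 = 0)) = true) :=
    computable_decide_forall_lt hne Computable.snd
  refine hforall.of_eq fun z => ?_
  simp only [Bool.not_eq_true', decide_eq_false_iff_not, ne_eq]

theorem computable_freeze :
    Computable fun z : List ℕ × ℕ => freeze (fun i => z.1.getD i 0) z.2 := by
  have hforall := computable_forall_getD_ne_zero.comp
    (g := fun y : (List ℕ × ℕ) × ℕ × ℕ => (y.1.1, y.2.1 + 2)) (by fun_prop)
  have hstep : Computable fun y : (List ℕ × ℕ) × ℕ × ℕ =>
      bif decide (∀ i < y.2.1 + 2, y.1.1.getD i 0 ≠ 0) then y.1.1.getD (y.2.1 + 1) 0 - 1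
      else y.2.2 := hforall.cond (by fun_prop) (by fun_prop)
  refine (Computable.nat_rec (f := fun z : List ℕ × ℕ => z.2) (g := fun z => z.1.getD 0 0 - 1)
    Computable.snd (by fun_prop) hstep.to₂).of_eq fun ⟨l, k⟩ => ?_
  induction k with
  | zero => rfl
  | succ k ih =>
    simp only [freeze, Bool.cond_decide] at ih ⊢
    rw [ih]

theorem ComputableFrom.freeze {T : Type*} {nm : T → Baire} {F : T → ℕ → ℕ}
    (hF : ComputableFrom nm F) : ComputableFrom nm fun t k => freeze (F t) k := by
  have hprefix : ComputableFrom nm fun t k => prefixOf (F t) (k + 1) :=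
    (ComputableFrom.prefixOf (F := fun t (z : Unit × ℕ) => F t z.2)
      (hF.reindex (by fun_prop))).reindex (g := fun k => ((), k + 1)) (by fun_prop)
  refine (ComputableFrom.map computable_freeze (hprefix.pair (.of_computable (g := fun k => k)
    (by fun_prop)))).congr fun t k => freeze_congr fun i hi => ?_
  rw [getD_prefixOf (by omega)]

theorem exists_freeze_eq (ι : ℕ → ℕ) {k l : ℕ} (h : k ≤ l) :
    freeze ι l = freeze ι k ∨ ∃ m ≥ k, (∀ i ≤ m, ι i ≠ 0) ∧ freeze ι l = freeze ι m := by
  induction l, h using Nat.le_induction with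
  | base => exact .inl rfl
  | succ l hl ih =>
    by_cases hne : ∀ i < l + 2, ι i ≠ 0
    · exact .inr ⟨l + 1, by omega, fun i hi => hne i (by omega), rfl⟩
    · rwa [freeze, if_neg hne]

variable {X : Type*} [MetricSpace X]

theorem dist_freeze_le {b : ℕ → X} {ι : ℕ → ℕ} {x : X}
    (hι : ∀ k j, ι k = j + 1 → dist x (b j) < (2 : ℝ)⁻¹ ^ k) {k l : ℕ} (hkl : k ≤ l) :
    dist (b (freeze ι k)) (b (freeze ι l)) ≤ 2 * (2 : ℝ)⁻¹ ^ k := by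
  rcases exists_freeze_eq ι hkl with h | ⟨m, hkm, hne, h⟩
  · rw [h, dist_self]
    positivity
  · have hk := hι k _ (freeze_of_forall_ne_zero fun i hi => hne i (by omega))
    have hm := hι m _ (freeze_of_forall_ne_zero hne)
    have hpow : (2 : ℝ)⁻¹ ^ m ≤ 2⁻¹ ^ k := pow_le_pow_of_le_one (by norm_num) (by norm_num) hkm
    rw [h]
    linarith [dist_triangle_left (b (freeze ι k)) (b (freeze ι m)) x]

theorem exists_freeze_limit {b : ℕ → X} {B : Set X} (hB : IsClosed B) (hb : ∀ j, b j ∈ B)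
    {ι : ℕ → ℕ} {x : X} (hxB : x ∈ B → ∀ k, ι k ≠ 0)
    (hι : ∀ k j, ι k = j + 1 → dist x (b j) < (2 : ℝ)⁻¹ ^ k) :
    ∃ y ∈ B, (∀ k, dist (b (freeze ι k)) y ≤ 2 * (2 : ℝ)⁻¹ ^ k) ∧ (x ∈ B → y = x) := by
  by_cases hne : ∀ k, ι k ≠ 0
  · have hdist (k : ℕ) : dist (b (freeze ι k)) x < (2 : ℝ)⁻¹ ^ k := by
      rw [dist_comm]
      exact hι k _ (freeze_of_forall_ne_zero fun i _ => hne i)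
    have hlim : Tendsto (fun k => b (freeze ι k)) atTop (𝓝 x) :=
      tendsto_iff_dist_tendsto_zero.2 (squeeze_zero (fun _ => dist_nonneg) (fun k => (hdist k).le)
        (tendsto_pow_atTop_nhds_zero_of_lt_one (by norm_num) (by norm_num)))
    refine ⟨x, hB.mem_of_tendsto hlim (.of_forall fun k => hb _), fun k => ?_, fun _ => rfl⟩
    have hpos : (0 : ℝ) < 2⁻¹ ^ k := by positivity
    linarith [hdist k]
  · obtain ⟨m, hm⟩ := not_forall_not.1 hne
    have hconst (l : ℕ) (hl : m ≤ l) : freeze ι l = freeze ι m :=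
      (exists_freeze_eq ι hl).resolve_right fun ⟨_, hn, hne, _⟩ => hne m hn hm
    refine ⟨b (freeze ι m), hb _, fun k => ?_, fun hx => absurd hm (hxB hx m)⟩
    rw [← hconst _ (le_max_right k m)]
    exact dist_freeze_le hι (le_max_left k m)

end Freeze

section Retraction

variable {X : Type*} [MetricSpace X] {ν : ℕ → X} {T : Type*} {α : Type} [Primcodable α]
  {nm : T → Baire} {𝒴 : Set (Set X)} {δ : Naming (Set X)}

theorem SComputable.exists_partition_near (hν : IsComputableMetricSpace ν) (hS : SComputable ν 𝒴 δ)
    {Y B : T → Set X} {b : T → ℕ → X} (hY : NamedFrom nm δ fun t (_ : Unit) => Y t)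
    (hY𝒴 : ∀ t, Y t ∈ 𝒴) (hB : NamedFrom nm (openName ν) fun t (_ : Unit) => (B t)ᶜ)
    (hb : NamedFrom nm (cauchyName ν) b) (hdense : ∀ t, B t ⊆ closure (range (b t))) :
    ∃ W : T → ℕ → ℕ → Set X, NamedFrom nm (openName ν) (fun t (z : ℕ × ℕ) => W t z.1 z.2) ∧
      ∀ t k, W t k 0 ⊆ (B t)ᶜ ∧ (∀ j, W t k (j + 1) ⊆ Metric.ball (b t j) ((2 : ℝ)⁻¹ ^ k)) ∧
        Y t ⊆ ⋃ i, W t k i ∧ Pairwise fun i j => Disjoint (W t k i) (W t k j) := by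
  obtain ⟨W, hW, hWval⟩ := hS.exists_shrinking (nm := nm)
    (U := fun t k i => {z | i = 0 ∧ z ∈ (B t)ᶜ} ∪
      {z | i ≠ 0 ∧ z ∈ Metric.ball (b t (i - 1)) ((2 : ℝ)⁻¹ ^ k)})
    ((NamedFrom.sep (ComputableFrom.rePred_eq (.of_computable (by fun_prop))
      (.of_computable (by fun_prop))) (hB.reindex (Computable.const ()))).union
      (NamedFrom.sep (ComputableFrom.rePred_ne (.of_computable (by fun_prop))
        (.of_computable (by fun_prop)))
        (NamedFrom.ball hν (hb.reindex (g := fun y : ℕ × ℕ => y.2 - 1) (by fun_prop))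
          (ComputableRealFrom.pow (.of_computable (by fun_prop))))))
    (Y := fun t _ => Y t) (hY.reindex (Computable.const ())) (fun t _ => hY𝒴 t)
    fun t k z _ => by
      by_cases hz : z ∈ B t
      · obtain ⟨_, ⟨j, rfl⟩, hj⟩ := Metric.mem_closure_iff.1 (hdense t hz) ((2 : ℝ)⁻¹ ^ k)
          (by positivity)
        exact mem_iUnion.2 ⟨j + 1, .inr ⟨j.succ_ne_zero, hj⟩⟩
      · exact mem_iUnion.2 ⟨0, .inl ⟨rfl, hz⟩⟩
  refine ⟨W, hW, fun t k => ?_⟩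
  obtain ⟨hsub, hcover⟩ := hWval t k
  exact ⟨fun z hz => (hsub 0 hz).elim And.right fun h => absurd rfl h.1,
    fun j z hz => (hsub (j + 1) hz).elim (fun h => absurd h.1 j.succ_ne_zero) And.right, hcover⟩

theorem NamedFrom.exists_index (hν : IsComputableMetricSpace ν) {A : T → Set X}
    {W : T → α → ℕ → Set X} (hW : NamedFrom nm (openName ν) fun t (z : α × ℕ) => W t z.1 z.2)
    (hcover : ∀ t a, A t ⊆ ⋃ i, W t a i)
    (hdisj : ∀ t a, Pairwise fun i j => Disjoint (W t a i) (W t a j)) :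
    ∃ ι : T → X → α → ℕ,
      ComputableFrom (withPointName (ν := ν) nm A) (fun s a => ι s.1.1 s.1.2.2 a) ∧
      ∀ t, ∀ z ∈ A t, ∀ a, z ∈ W t a (ι t z a) := by
  have hex (t : T) (z : X) (a : α) : ∃ i, z ∈ A t → z ∈ W t a i := by
    by_cases hz : z ∈ A t
    · exact (mem_iUnion.1 (hcover t a hz)).imp fun _ hi _ => hi
    · exact ⟨0, fun h => absurd h hz⟩
  choose ι hι using hex
  refine ⟨ι, ?_, fun t z hz a => hι t z a hz⟩
  have hmem : REPredFrom (withPointName (ν := ν) nm A) fun s (y : α × ℕ) =>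
      s.1.2.2 ∈ W s.1.1 y.1 y.2 :=
    REPredFrom.mem hν (hW.pullback (WithPoint.computableFrom_base A))
      ((WithPoint.named A).reindex (Computable.const ()))
  refine REPredFrom.congr hmem fun s y => ⟨fun h => h ▸ hι s.1.1 s.1.2.2 y.1 s.2.2, fun h => ?_⟩
  by_contra hne
  exact Set.disjoint_left.1 (hdisj s.1.1 y.1 hne) (hι s.1.1 s.1.2.2 y.1 s.2.2) h

theorem SComputable.exists_retraction (hν : IsComputableMetricSpace ν) (hS : SComputable ν 𝒴 δ)
    {Y B : T → Set X} {b : T → ℕ → X} (hY : NamedFrom nm δ fun t (_ : Unit) => Y t)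
    (hY𝒴 : ∀ t, Y t ∈ 𝒴) (hB : NamedFrom nm (openName ν) fun t (_ : Unit) => (B t)ᶜ)
    (hb : NamedFrom nm (cauchyName ν) b)
    (hbB : ∀ t, (∀ i, b t i ∈ B t) ∧ B t ⊆ closure (range (b t))) :
    ∃ v : T → X → X,
      NamedFrom (withPointName (ν := ν) nm Y) (cauchyName ν) (fun s (_ : Unit) => v s.1.1 s.1.2.2) ∧
      ∀ t, ∀ z ∈ Y t, v t z ∈ B t ∧ (z ∈ B t → v t z = z) := by
  obtain ⟨W, hW, hWval⟩ := hS.exists_partition_near hν hY hY𝒴 hB hb fun t => (hbB t).2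
  obtain ⟨ι, hι, hιW⟩ := hW.exists_index hν (fun t k => (hWval t k).2.2.1)
    fun t k => (hWval t k).2.2.2
  have hlim (t : T) (z : X) : ∃ y, z ∈ Y t → y ∈ B t ∧
      (∀ k, dist (b t (freeze (ι t z) k)) y ≤ 2 * (2 : ℝ)⁻¹ ^ k) ∧ (z ∈ B t → y = z) := by
    by_cases hz : z ∈ Y t
    · have hzW := hιW t z hz
      obtain ⟨y, hy⟩ := exists_freeze_limit ⟨hB.isOpen t ()⟩ (hbB t).1 (ι := ι t z) (x := z)
        (fun hzB k hk => (hWval t k).1 (hk ▸ hzW k) hzB)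
        fun k j hkj => (hWval t k).2.1 j (hkj ▸ hzW k)
      exact ⟨y, fun _ => hy⟩
    · exact ⟨z, fun h => absurd h hz⟩
  choose v hv using hlim
  refine ⟨v, NamedFrom.of_dist_le (y := fun s _ k => b s.1.1 (freeze (ι s.1.1 s.1.2.2) k)) ?_
    fun s _ k => (hv s.1.1 s.1.2.2 s.2.2).2.1 k,
    fun t z hz => ⟨(hv t z hz).1, (hv t z hz).2.2⟩⟩
  exact (hb.pullback (WithPoint.computableFrom_base Y)).comp
    (hι.freeze.reindex (g := fun y : Unit × ℕ => y.2) (by fun_prop))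

theorem RetractComputable.of_SComputable (hν : IsComputableMetricSpace ν)
    (hneg : Reducible δ (closedName ν)) (hS : SComputable ν 𝒴 δ) : RetractComputable ν 𝒴 δ := by
  refine Operation.isComputable_of_named (f := opRetract ν 𝒴) ?_
  have hin := Operation.Input.named (opRetract ν 𝒴)
    (prodName δ (meetName (rangeName ν) (distName ν)))
  have hA := hin.fst.reduce hneg
  obtain ⟨b, hb, hbB⟩ := hin.snd.meet_left.exists_dense_seq fun t _ => t.2.1.2.2.1
  have hretract := hS.exists_retraction hν (T := (opRetract ν 𝒴).Input _)
    (Y := fun t => t.1.2.1) (B := fun t => t.1.2.2) (b := fun t => b t ())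
    hin.fst (fun t => t.2.1.1) (hin.snd.meet_right.compl_of_distName hν)
    (hb.reindex (g := fun k => ((), k)) (by fun_prop)) fun t => hbB t ()
  obtain ⟨v, hv, hvB⟩ := hretract
  have hf := NamedFrom.partialMapName_of_withPoint hA hv
  refine ⟨_, hf, fun t => ?_⟩
  obtain ⟨F, -, hF⟩ := hf
  have hBA : t.1.2.2 ⊆ t.1.2.1 := t.2.1.2.2.2.1
  refine ⟨⟨⟨hA.compl.isOpen t ()⟩, _, (hF t ()).1⟩, rfl, ?_, fun z hz =>
    ⟨hBA hz, (hvB t z (hBA hz)).2 hz⟩⟩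
  ext y
  constructor
  · rintro ⟨z, hz, rfl⟩
    exact (hvB t z hz).1
  · exact fun hy => ⟨y, hBA hy, (hvB t y (hBA hy)).2 hy⟩

end Retraction

section Lists

theorem forall_mem_list_iff {β : Type*} {l : List β} {P : β → Prop} :
    (∀ e ∈ l, P e) ↔ ∀ i < l.length, ∃ e, l[i]? = some e ∧ P e := by
  refine ⟨fun h i hi => ⟨_, List.getElem?_eq_getElem hi, h _ (List.getElem_mem hi)⟩,
    fun h e he => ?_⟩
  obtain ⟨i, hi, rfl⟩ := List.mem_iff_getElem.1 he
  obtain ⟨e, he, hP⟩ := h i hi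
  rw [List.getElem?_eq_getElem hi, Option.some_inj] at he
  rwa [he]

variable {X : Type*} [MetricSpace X] {ν : ℕ → X} {T : Type*} {α β : Type} [Primcodable α]
  [Primcodable β] {nm : T → Baire}

theorem ComputableFrom.rePred_getElem?_eq {L : T → α → List β} (hL : ComputableFrom nm L) :
    REPredFrom nm fun t (z : (α × ℕ) × β) => (L t z.1.1)[z.1.2]? = some z.2 :=
  ComputableFrom.rePred_eq
    (ComputableFrom.map₂ (g := fun (l : List β) (i : ℕ) => l[i]?)
      (computable_getElem? Computable.fst Computable.snd)
      (hL.reindex (g := fun z : (α × ℕ) × β => z.1.1) (by fun_prop))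
      (.of_computable (g := fun z : (α × ℕ) × β => z.1.2) (by fun_prop)))
    (.of_computable (Computable.option_some.comp Computable.snd))

theorem ComputableFrom.rePred_mem_list {L : T → α → List β} (hL : ComputableFrom nm L) :
    REPredFrom nm fun t (z : α × β) => z.2 ∈ L t z.1 :=
  (REPredFrom.exists (P := fun t (z : α × β) i => (L t z.1)[i]? = some z.2)
    (hL.rePred_getElem?_eq.reindex (g := fun y : (α × β) × ℕ => ((y.1.1, y.2), y.1.2))
      (by fun_prop))).congr fun _ _ => List.mem_iff_getElem?

theorem REPredFrom.forall_mem_list {P : T → α → β → Prop}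
    (hP : REPredFrom nm fun t (z : α × β) => P t z.1 z.2) {l : α → List β} (hl : Computable l) :
    REPredFrom nm fun t a => ∀ e ∈ l a, P t a e := by
  have hentry : REPredFrom nm fun t (z : α × ℕ) => ∃ e, (l z.1)[z.2]? = some e ∧ P t z.1 e :=
    REPredFrom.exists (P := fun t (z : α × ℕ) e => (l z.1)[z.2]? = some e ∧ P t z.1 e)
      ((ComputableFrom.of_computable hl).rePred_getElem?_eq.and
        (hP.reindex (g := fun y : (α × ℕ) × β => (y.1.1, y.2)) (by fun_prop)))
  exact (REPredFrom.forall_lt (P := fun t a i => ∃ e, (l a)[i]? = some e ∧ P t a e) hentry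
    (Computable.list_length.comp hl)).congr fun _ _ => forall_mem_list_iff

theorem NamedFrom.biUnion_list {L : T → α → List β} (hL : ComputableFrom nm L)
    {U : T → α → β → Set X} (hU : NamedFrom nm (openName ν) fun t (z : α × β) => U t z.1 z.2) :
    NamedFrom nm (openName ν) fun t a => {z | ∃ e ∈ L t a, z ∈ U t a e} :=
  NamedFrom.biUnion (P := fun t a e => e ∈ L t a) hL.rePred_mem_list hU

theorem NamedFrom.biInter_list (hν : IsComputableMetricSpace ν) {L : T → α → List β}
    (hL : ComputableFrom nm L) {U : T → α → β → Set X}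
    (hU : NamedFrom nm (openName ν) fun t (z : α × β) => U t z.1 z.2) :
    NamedFrom nm (openName ν) fun t a => {z | ∀ e ∈ L t a, z ∈ U t a e} := by
  have hentry : NamedFrom nm (openName ν) fun t (y : α × ℕ) =>
      {z | ∃ e, (L t y.1)[y.2]? = some e ∧ z ∈ U t y.1 e} :=
    NamedFrom.biUnion (P := fun t (y : α × ℕ) e => (L t y.1)[y.2]? = some e)
      (U := fun t y e => U t y.1 e) hL.rePred_getElem?_eq
      (hU.reindex (g := fun y : (α × ℕ) × β => (y.1.1, y.2)) (by fun_prop))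
  exact (NamedFrom.biInter hν (ComputableFrom.map Computable.list_length hL)
    (U := fun t a i => {z | ∃ e, (L t a)[i]? = some e ∧ z ∈ U t a e}) hentry).congr
    fun t a => Set.ext fun z => forall_mem_list_iff

end Lists

section Compact

variable {X : Type*} [MetricSpace X] {ν : ℕ → X} {T : Type*} {α β : Type} [Primcodable α]
  [Primcodable β] {nm : T → Baire}

/-- The finite covers enumerated by the names of `K` in `minCoverName`: `w` lists codes of ideal
balls that cover `K` and each of which meets `K`. -/
def IsMinimalCover (ν : ℕ → X) (K : Set X) (w : List ℕ) : Prop :=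
  (K ⊆ ⋃ b ∈ {b | b ∈ w}, idealBall ν b) ∧ ∀ b ∈ w, (idealBall ν b ∩ K).Nonempty

theorem NamedFrom.rePred_isMinimalCover {K : T → α → Set X}
    (hK : NamedFrom nm (minCoverName ν) K) :
    REPredFrom nm fun t (z : α × List ℕ) => IsMinimalCover ν (K t z.1) z.2 := by
  obtain ⟨F, hF, hFK⟩ := hK
  have hcode : REPredFrom nm fun t (y : (α × List ℕ) × ℕ) =>
      F t (y.1.1, y.2) = Encodable.encode y.1.2 :=
    ComputableFrom.rePred_eq
      (hF.reindex (g := fun y : (α × List ℕ) × ℕ => (y.1.1, y.2)) (by fun_prop))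
      (.of_computable (Computable.encode.comp (Computable.snd.comp Computable.fst)))
  refine (REPredFrom.exists (P := fun t (z : α × List ℕ) i =>
    F t (z.1, i) = Encodable.encode z.2) hcode).congr fun t z => ?_
  have hmem := Set.ext_iff.1 (hFK t z.1).2 (Encodable.encode z.2)
  refine Iff.trans ⟨fun h => ⟨z.2, rfl, h⟩, ?_⟩ hmem.symm
  rintro ⟨w, hw, h⟩
  rwa [Encodable.encode_injective hw]

theorem exists_isMinimalCover {K : Set X} (hK : IsCompact K) {β : Type*} {Q : β → Prop} {c : β → ℕ}
    (h : ∀ z ∈ K, ∃ e, Q e ∧ z ∈ idealBall ν (c e)) :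
    ∃ l : List β, (∀ e ∈ l, Q e) ∧ IsMinimalCover ν K (l.map c) := by
  choose e heQ he using h
  obtain ⟨s, hs⟩ := hK.elim_nhds_subcover' (fun z hz => idealBall ν (c (e z hz)))
    fun z hz => Metric.isOpen_ball.mem_nhds (he z hz)
  refine ⟨s.toList.map fun z : K => e z z.2, List.forall_mem_map.2 fun z _ => heQ z z.2,
    fun z hz => ?_, List.forall_mem_map.2 (List.forall_mem_map.2 fun z _ => ⟨z, he z z.2, z.2⟩)⟩
  obtain ⟨y, hy, hzy⟩ := mem_iUnion₂.1 (hs hz)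
  exact mem_iUnion₂.2 ⟨c (e y y.2), List.mem_map_of_mem (List.mem_map_of_mem
    (Finset.mem_toList.2 hy)), hzy⟩

theorem NamedFrom.exists_finite_subcover {K : T → α → Set X}
    (hK : NamedFrom nm (minCoverName ν) K) {U : T → α → β → Set X}
    (hU : NamedFrom nm (openName ν) fun t (z : α × β) => U t z.1 z.2)
    (hcover : ∀ t a, ∀ z ∈ K t a, ∃ e, z ∈ U t a e) :
    ∃ L : T → α → List β, ComputableFrom nm L ∧ ∀ t a,
      (∀ e ∈ L t a, (U t a e).Nonempty) ∧ ∀ z ∈ K t a, ∃ e ∈ L t a, z ∈ U t a e := by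
  obtain ⟨E, hE, hEU⟩ := hU.exists_rePred
  have hlist : ∀ t a, ∃ l : List (β × ℕ), (∀ e ∈ l, E t ((a, e.1), e.2)) ∧
      IsMinimalCover ν (K t a) (l.map Prod.snd) := fun t a => by
    obtain ⟨F, -, hFK⟩ := hK
    refine exists_isMinimalCover (hFK t a).1 fun z hz => ?_
    obtain ⟨e, he⟩ := hcover t a z hz
    obtain ⟨c, hc, hzc⟩ := (hEU t (a, e) z).1 he
    exact ⟨(e, c), hc, hzc⟩
  have hmap : Computable fun l : List (β × ℕ) => l.map Prod.snd :=
    (Primrec.list_map Primrec.id (Primrec.snd.comp Primrec.snd).to₂).to_comp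
  have hfst : Computable fun l : List (β × ℕ) => l.map Prod.fst :=
    (Primrec.list_map Primrec.id (Primrec.fst.comp Primrec.snd).to₂).to_comp
  have hrefine : REPredFrom nm fun t (z : α × List (β × ℕ)) =>
      ∀ e ∈ z.2, E t ((z.1, e.1), e.2) :=
    REPredFrom.forall_mem_list (P := fun t (z : α × List (β × ℕ)) (e : β × ℕ) =>
      E t ((z.1, e.1), e.2)) (hE.reindex (g := fun y : (α × List (β × ℕ)) × (β × ℕ) =>
      ((y.1.1, y.2.1), y.2.2)) (by fun_prop)) Computable.snd
  obtain ⟨L, hL, hLE⟩ := REPredFrom.exists_choice (hrefine.and (hK.rePred_isMinimalCover.reindex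
    (g := fun z : α × List (β × ℕ) => (z.1, z.2.map Prod.snd))
    (Computable.fst.pair (hmap.comp Computable.snd)))) hlist
  refine ⟨fun t a => (L t a).map Prod.fst, ComputableFrom.map hfst hL, fun t a => ?_⟩
  obtain ⟨hLU, hLcover, hLmeets⟩ := hLE t a
  refine ⟨List.forall_mem_map.2 fun e he => ?_, fun z hz => ?_⟩
  · obtain ⟨z, hz, -⟩ := hLmeets e.2 (List.mem_map_of_mem he)
    exact ⟨z, (hEU t (a, e.1) z).2 ⟨e.2, hLU e he, hz⟩⟩
  · obtain ⟨c, hc, hzc⟩ := mem_iUnion₂.1 (hLcover hz)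
    obtain ⟨e, he, rfl⟩ := List.mem_map.1 hc
    exact ⟨e.1, List.mem_map_of_mem he, (hEU t (a, e.1) z).2 ⟨e.2, hLU e he, hzc⟩⟩

end Compact

section Separation

variable {X : Type*} [MetricSpace X] {ν : ℕ → X} {T : Type*} {α β : Type} [Primcodable α]
  [Primcodable β] {nm : T → Baire} {𝒴 : Set (Set X)} {δ : Naming (Set X)}

theorem Operation.IsComputable.ofFun_apply {B C : Type*} {δ : Naming B} {δ' : Naming C} {s : Set B}
    {g : B → C} (hg : (Operation.ofFun s g).IsComputable δ δ') {y : T → α → B}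
    (hy : NamedFrom nm δ y) (hs : ∀ t a, y t a ∈ s) : NamedFrom nm δ' fun t a => g (y t a) := by
  obtain ⟨z, hz, hzg⟩ := hg.apply hy hs
  exact hz.congr fun t a => (hzg t a).symm

theorem RetractComputable.exists_retraction (hR : RetractComputable ν 𝒴 δ) {A B : T → Set X}
    (hA : NamedFrom nm δ fun t (_ : Unit) => A t)
    (hB : NamedFrom nm (meetName (rangeName ν) (distName ν)) fun t (_ : Unit) => B t)
    (hAB : ∀ t, A t ∈ 𝒴 ∧ IsClosed (B t) ∧ (B t).Nonempty ∧ B t ⊆ A t ∧ B t ≠ univ) :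
    ∃ v : T → X → X,
      NamedFrom (withPointName (ν := ν) nm A) (cauchyName ν) (fun s (_ : Unit) => v s.1.1 s.1.2.2) ∧
        ∀ t, (∀ z ∈ A t, v t z ∈ B t) ∧ ∀ z ∈ B t, v t z = z := by
  obtain ⟨f, hf, hfval⟩ := Operation.IsComputable.apply (f := opRetract ν 𝒴) hR (hA.prod hB)
    fun t _ => hAB t
  have hdom : ∀ t, ∀ z ∈ A t, ∃ w, w ∈ f t () z := fun t z hz =>
    Part.dom_iff_mem.1 ((hfval t ()).2.1.ge hz)
  choose! v hv using hdom
  refine ⟨v, hf.map_apply hv, fun t => ⟨fun z hz => (hfval t ()).2.2.1.le ⟨z, hv t z hz⟩,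
    fun z hz => ?_⟩⟩
  exact Part.mem_unique (hv t z ((hAB t).2.2.2.1 hz)) ((hfval t ()).2.2.2 z hz)

theorem NamedFrom.exists_open_ne (hν : IsComputableMetricSpace ν) {A : T → Set X} {v : T → X → X}
    (hv : NamedFrom (withPointName (ν := ν) nm A) (cauchyName ν)
      fun s (_ : Unit) => v s.1.1 s.1.2.2) {x : T → Unit → X}
    (hx : NamedFrom nm (cauchyName ν) x) :
    ∃ O : T → Unit → Set X, NamedFrom nm (openName ν) O ∧
      ∀ t, ∀ z ∈ A t, (z ∈ O t () ↔ v t z ≠ x t ()) := by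
  obtain ⟨O, hO, hOv⟩ := REPredFrom.exists_open hν (A := A)
    (Q := fun t z _ => 0 < dist (v t z) (x t ()))
    (ComputableRealFrom.zero.lt (ComputableRealFrom.dist hν hv
      (hx.pullback (WithPoint.computableFrom_base A))))
  exact ⟨O, hO, fun t z hz => (hOv t () z hz).trans dist_pos⟩

theorem RetractComputable.exists_separation (hν : IsComputableMetricSpace ν)
    (hR : RetractComputable ν 𝒴 δ) (hγ_mem : ∀ x, ∀ Y ∈ 𝒴, insert x Y ∈ 𝒴)
    (hγ : (opAddPoint 𝒴).IsComputable (prodName (cauchyName ν) δ) δ)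
    (hX : ∀ x y : X, ({x, y} : Set X) ≠ univ)
    {x y : T → Unit → X} {Y : T → Unit → Set X} (hx : NamedFrom nm (cauchyName ν) x)
    (hy : NamedFrom nm (cauchyName ν) y) (hY : NamedFrom nm δ Y) (hY𝒴 : ∀ t, Y t () ∈ 𝒴)
    (hxy : ∀ t, x t () ≠ y t ()) :
    ∃ V W : T → Unit → Set X, NamedFrom nm (openName ν) V ∧ NamedFrom nm (openName ν) W ∧
      ∀ t, Disjoint (V t ()) (W t ()) ∧ Y t () ⊆ V t () ∪ W t () ∧ x t () ∈ V t () ∧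
        y t () ∈ W t () := by
  have hA : NamedFrom nm δ fun t a => insert (y t a) (insert (x t a) (Y t a)) :=
    hγ.ofFun_apply (hy.prod (hγ.ofFun_apply (hx.prod hY) fun t _ => hY𝒴 t))
      fun t _ => hγ_mem _ _ (hY𝒴 t)
  have hxyA : ∀ t, ({x t (), y t ()} : Set X) ⊆ insert (y t ()) (insert (x t ()) (Y t ())) :=
    fun t => insert_subset (by simp) (by simp)
  obtain ⟨v, hv, hvxy⟩ := hR.exists_retraction hA
    ((hx.rangeName_pair hy).meet (hx.distName_pair hν hy)) fun t =>
      ⟨hγ_mem _ _ (hγ_mem _ _ (hY𝒴 t)), (Set.toFinite _).isClosed, insert_nonempty _ _, hxyA t,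
        hX _ _⟩
  obtain ⟨O, hO, hOv⟩ := NamedFrom.exists_open_ne hν hv hy
  obtain ⟨O', hO', hOv'⟩ := NamedFrom.exists_open_ne hν hv hx
  obtain ⟨V, W, hV, hW, hVW⟩ := NamedFrom.exists_disjoint hν hO hO'
  refine ⟨V, W, hV, hW, fun t => ?_⟩
  obtain ⟨hdisj, -, -, hOV, hOW⟩ := hVW t ()
  obtain ⟨hvmem, hvfix⟩ := hvxy t
  have hxV : ∀ z ∈ insert (y t ()) (insert (x t ()) (Y t ())), v t z = x t () → z ∈ V t () :=
    fun z hz h => hOV ⟨(hOv t z hz).2 (h ▸ hxy t), fun h' => (hOv' t z hz).1 h' h⟩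
  have hyW : ∀ z ∈ insert (y t ()) (insert (x t ()) (Y t ())), v t z = y t () → z ∈ W t () :=
    fun z hz h => hOW ⟨(hOv' t z hz).2 (h ▸ (hxy t).symm), fun h' => (hOv t z hz).1 h' h⟩
  refine ⟨hdisj, fun z hz => ?_, hxV _ (by simp) (hvfix _ (by simp)),
    hyW _ (by simp) (hvfix _ (by simp))⟩
  have hzA : z ∈ insert (y t ()) (insert (x t ()) (Y t ())) :=
    mem_insert_of_mem _ (mem_insert_of_mem _ hz)
  exact (hvmem z hzA).imp (hxV z hzA) (hyW z hzA)

theorem RetractComputable.exists_separation_family (hν : IsComputableMetricSpace ν)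
    (hR : RetractComputable ν 𝒴 δ) (hγ_mem : ∀ x, ∀ Y ∈ 𝒴, insert x Y ∈ 𝒴)
    (hγ : (opAddPoint 𝒴).IsComputable (prodName (cauchyName ν) δ) δ)
    (hX : ∀ x y : X, ({x, y} : Set X) ≠ univ) {x : T → Unit → X} {Y : T → Unit → Set X}
    (hx : NamedFrom nm (cauchyName ν) x) (hY : NamedFrom nm δ Y) (hY𝒴 : ∀ t, Y t () ∈ 𝒴) :
    ∃ (P : T → List ℕ → Prop) (V W : T → List ℕ → Set X), REPredFrom nm P ∧
      NamedFrom nm (openName ν) V ∧ NamedFrom nm (openName ν) W ∧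
      (∀ t σ, P t σ → Disjoint (V t σ) (W t σ) ∧ Y t () ⊆ V t σ ∪ W t σ ∧ x t () ∈ V t σ) ∧
      ∀ t z, z ≠ x t () → ∃ σ, P t σ ∧ z ∈ W t σ := by
  let A : T → Set X := fun t => {z | 0 < dist (x t ()) z}
  have hA : NamedFrom nm (openName ν) fun t (_ : Unit) => A t :=
    NamedFrom.setOf_lt_dist hν hx ComputableRealFrom.zero
  have hbase := WithPoint.computableFrom_base (ν := ν) (nm := nm) A
  obtain ⟨V, W, hV, hW, hVW⟩ := hR.exists_separation hν hγ_mem hγ hX (hx.pullback hbase)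
    (WithPoint.named A) (hY.pullback hbase) (fun s => hY𝒴 s.1.1) (fun s => dist_pos.1 s.2.2)
  refine ⟨IsPointPrefix ν A, _, _, REPredFrom.isPointPrefix hν hA,
    NamedFrom.of_isPointPrefix hν hA (U := fun s => V s ()) hV,
    NamedFrom.of_isPointPrefix hν hA (U := fun s => W s ()) hW, fun t σ h => ?_, fun t z hz => ?_⟩
  · obtain ⟨hdisj, hcover, hxV, -⟩ := hVW h.point
    refine ⟨Set.disjoint_left.2 ?_, fun z hz => ?_, h, hxV⟩
    · rintro z ⟨_, hzV⟩ ⟨_, hzW⟩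
      exact Set.disjoint_left.1 hdisj hzV hzW
    · exact (hcover hz).imp (fun hzV => ⟨h, hzV⟩) fun hzW => ⟨h, hzW⟩
  · obtain ⟨q, hq⟩ := exists_cauchyName hν.dense z
    let s : WithPoint ν A := ⟨(t, q, z), hq, dist_pos.2 hz.symm⟩
    obtain ⟨σ, h, hσ⟩ := IsPointPrefix.exists_mem (fun t => hA.isOpen t ()) (U := fun s => W s ())
      hW (hVW s).2.2.2
    exact ⟨σ, h, h, hσ⟩

theorem NamedFrom.exists_ball_subset (hν : IsComputableMetricSpace ν) {x : T → α → X}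
    {U : T → α → Set X} (hx : NamedFrom nm (cauchyName ν) x) (hU : NamedFrom nm (openName ν) U)
    (hxU : ∀ t a, x t a ∈ U t a) :
    ∃ n : T → α → ℕ, ComputableFrom nm n ∧ ∀ t a,
      Metric.ball (x t a) ((2 : ℝ)⁻¹ ^ n t a) ⊆ U t a := by
  obtain ⟨E, hE, hEU⟩ := hU.exists_rePred
  have hexists : ∀ t a, ∃ n c : ℕ, E t (a, c) ∧ dist (x t a) (ν c.unpair.1) + (2 : ℝ)⁻¹ ^ n <
      ((posRat c.unpair.2 : ℚ) : ℝ) := fun t a => by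
    obtain ⟨c, hc, hxc⟩ := (hEU t a _).1 (hxU t a)
    obtain ⟨n, hn⟩ := exists_pow_lt (sub_pos.2 (mem_idealBall.1 hxc))
    exact ⟨n, c, hc, by linarith⟩
  have hre : REPredFrom nm fun t (z : α × ℕ) => ∃ c : ℕ, E t (z.1, c) ∧
      dist (x t z.1) (ν c.unpair.1) + (2 : ℝ)⁻¹ ^ z.2 < ((posRat c.unpair.2 : ℚ) : ℝ) := by
    have hc : ComputableFrom nm fun _ (y : (α × ℕ) × ℕ) => y.2 := .of_computable (by fun_prop)
    refine REPredFrom.exists (REPredFrom.and (hE.reindex (by fun_prop)) (ComputableRealFrom.lt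
      (ComputableRealFrom.add ?_ (ComputableRealFrom.pow (.of_computable (by fun_prop))))
      (ComputableRealFrom.radius hc)))
    exact ComputableRealFrom.dist_center hν
      (hx.reindex (g := fun y : (α × ℕ) × ℕ => y.1.1) (by fun_prop)) hc
  obtain ⟨n, hn, hnE⟩ := REPredFrom.exists_choice hre hexists
  refine ⟨n, hn, fun t a z hz => ?_⟩
  obtain ⟨c, hc, hlt⟩ := hnE t a
  refine (hEU t a z).2 ⟨c, hc, mem_idealBall.2 ?_⟩
  have := dist_triangle z (x t a) (ν c.unpair.1)
  linarith [Metric.mem_ball.1 hz]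

/-- Finitely many `W e` cover the part of `Y ∩ closedBall x r` outside `ball x r`, so that
`ball x r` intersected with the corresponding `V e` is relatively clopen in `Y`. -/
theorem NamedFrom.exists_separation_of_family [Nontrivial X] (hν : IsComputableMetricSpace ν)
    {x : T → α → X} {r : T → α → ℝ} {Y : T → α → Set X} (hx : NamedFrom nm (cauchyName ν) x)
    (hr : ComputableRealFrom nm r) (hr_pos : ∀ t a, 0 < r t a)
    (hK : NamedFrom nm (minCoverName ν) fun t a => Y t a ∩ Metric.closedBall (x t a) (r t a))
    {P : T → β → Prop} (hP : REPredFrom nm P)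
    {V W : T → β → Set X} (hV : NamedFrom nm (openName ν) V) (hW : NamedFrom nm (openName ν) W)
    (hVW : ∀ t a e, P t e → Disjoint (V t e) (W t e) ∧ Y t a ⊆ V t e ∪ W t e ∧ x t a ∈ V t e)
    (hcover : ∀ t a z, z ≠ x t a → ∃ e, P t e ∧ z ∈ W t e) :
    ∃ V' W' : T → α → Set X, NamedFrom nm (openName ν) V' ∧ NamedFrom nm (openName ν) W' ∧
      ∀ t a, x t a ∈ V' t a ∧ V' t a ⊆ Metric.ball (x t a) (r t a) ∧
        Y t a ⊆ V' t a ∪ W' t a ∧ Disjoint (V' t a) (W' t a) := by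
  have hball := NamedFrom.ball hν hx hr
  have hsnd : Computable (Prod.snd : α × β → β) := Computable.snd
  obtain ⟨L, hL, hLP⟩ := hK.exists_finite_subcover
    (U := fun t a e => {z | P t e ∧ z ∈ Metric.ball (x t a) (r t a) ∪ W t e})
    (NamedFrom.sep (hP.reindex hsnd) ((hball.reindex Computable.fst).union (hW.reindex hsnd)))
    fun t a z _ => by
      rcases eq_or_ne z (x t a) with rfl | hz
      · obtain ⟨z', hz'⟩ := exists_ne (x t a)
        obtain ⟨e, he, -⟩ := hcover t a z' hz'
        exact ⟨e, he, Or.inl (Metric.mem_ball_self (hr_pos t a))⟩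
      · exact (hcover t a z hz).imp fun e he => he.imp_right Or.inr
  refine ⟨_, _, hball.inter hν (NamedFrom.biInter_list hν hL (U := fun t _ e => V t e)
      (hV.reindex hsnd)),
    (NamedFrom.setOf_lt_dist hν hx hr).union (NamedFrom.biUnion_list hL
      (U := fun t _ e => W t e) (hW.reindex hsnd)),
    fun t a => ?_⟩
  obtain ⟨hLne, hLcover⟩ := hLP t a
  have hLP : ∀ e ∈ L t a, P t e := fun e he => (hLne e he).some_mem.1
  refine ⟨⟨Metric.mem_ball_self (hr_pos t a), fun e he => (hVW t a e (hLP e he)).2.2⟩,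
    inter_subset_left, fun z hz => ?_, Set.disjoint_left.2 ?_⟩
  · by_cases hzW : r t a < dist (x t a) z ∨ ∃ e ∈ L t a, z ∈ W t e
    · exact Or.inr hzW
    obtain ⟨hnear, hnotW⟩ := not_or.1 hzW
    have hnotW : ∀ e ∈ L t a, z ∉ W t e := fun e he h => hnotW ⟨e, he, h⟩
    obtain ⟨e, he, -, hze⟩ := hLcover z ⟨hz, Metric.mem_closedBall'.2 (not_lt.1 hnear)⟩
    exact Or.inl ⟨hze.resolve_right (hnotW e he), fun e he =>
      ((hVW t a e (hLP e he)).2.1 hz).resolve_right (hnotW e he)⟩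
  · rintro z ⟨hzball, hzV⟩ (hfar | ⟨e, he, hzW⟩)
    · exact lt_asymm (Metric.mem_ball'.1 hzball) hfar
    · exact Set.disjoint_left.1 (hVW t a e (hLP e he)).1 (hzV e he) hzW

theorem exists_pow_separated_of_finite [Finite X] :
    ∃ k : ℕ, ∀ x y : X, dist x y < (2 : ℝ)⁻¹ ^ k → x = y := by
  rcases subsingleton_or_nontrivial X
  · exact ⟨0, fun x y _ => Subsingleton.elim x y⟩
  obtain ⟨k, hk⟩ := exists_pow_lt
    (Set.finite_univ.infsep_pos_iff_nontrivial.2 (nontrivial_univ (α := X)))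
  refine ⟨k, fun x y hxy => by_contra fun hne => ?_⟩
  exact (Set.infsep_le_dist_of_mem (mem_univ x) (mem_univ y) hne).not_gt (hxy.trans hk)

theorem MComputable.of_finite [Finite X] (hν : IsComputableMetricSpace ν) :
    MComputable ν 𝒴 δ := by
  have hin := Operation.Input.named (opM 𝒴) (prodName (cauchyName ν) (prodName (openName ν) δ))
  obtain ⟨k, hk⟩ := exists_pow_separated_of_finite (X := X)
  have hV := NamedFrom.ball hν hin.fst
    (ComputableRealFrom.pow (G := fun _ _ => k) (.of_computable (by fun_prop)))
  have hW := NamedFrom.setOf_lt_dist hν hin.fst ComputableRealFrom.zero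
  refine Operation.isComputable_of_named (f := opM 𝒴) ⟨_, hV.prod hW, fun t =>
    ⟨hV.isOpen t (), hW.isOpen t (), Metric.mem_ball_self (by positivity), fun z hz => ?_,
      fun z _ => ?_, Set.disjoint_left.2 fun z hz hzx => ?_⟩⟩
  · rw [hk _ _ hz]
    exact t.2.1.2.2
  · rcases eq_or_ne t.1.2.1 z with rfl | hz
    · exact Or.inl (Metric.mem_ball_self (by positivity))
    · exact Or.inr (dist_pos.2 hz)
  · exact (dist_pos.1 hzx) (hk _ _ hz).symm

theorem MComputable.of_RetractComputable (hν : IsComputableMetricSpace ν)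
    (hγ_mem : ∀ x, ∀ Y ∈ 𝒴, insert x Y ∈ 𝒴)
    (hγ : (opAddPoint 𝒴).IsComputable (prodName (cauchyName ν) δ) δ)
    (hβ : (opBall 𝒴).IsComputable (prodName (cauchyName ν) (prodName natName δ))
      (minCoverName ν)) (hR : RetractComputable ν 𝒴 δ) : MComputable ν 𝒴 δ := by
  cases finite_or_infinite X
  · exact MComputable.of_finite hν
  have hX : ∀ x y : X, ({x, y} : Set X) ≠ univ := fun x y h =>
    Set.infinite_univ (h ▸ Set.toFinite {x, y})
  have hin := Operation.Input.named (opM 𝒴) (prodName (cauchyName ν) (prodName (openName ν) δ))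
  obtain ⟨n, hn, hnU⟩ := NamedFrom.exists_ball_subset hν hin.fst hin.snd.fst
    fun t _ => t.2.1.2.2
  have hK := hβ.ofFun_apply (hin.fst.prod ((NamedFrom.nat hn).prod hin.snd.snd))
    fun t _ => t.2.1.2.1
  obtain ⟨P, V, W, hP, hV, hW, hVW, hcover⟩ := hR.exists_separation_family hν hγ_mem hγ hX hin.fst
    hin.snd.snd fun t => t.2.1.2.1
  obtain ⟨V', W', hV', hW', hVW'⟩ := NamedFrom.exists_separation_of_family hν hin.fst
    (ComputableRealFrom.pow hn) (fun _ _ => by positivity) hK hP hV hW (fun t _ => hVW t)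
    fun t _ => hcover t
  refine Operation.isComputable_of_named (f := opM 𝒴) ⟨_, hV'.prod hW', fun t => ?_⟩
  obtain ⟨hxV, hVball, hYcover, hdisj⟩ := hVW' t ()
  exact ⟨hV'.isOpen t (), hW'.isOpen t (), hxV, hVball.trans (hnU t ()), hYcover, hdisj⟩

end Separation

end TTE

theorem mainTheorem3_general {X : Type*} [MetricSpace X] {ν : ℕ → X}
    (hν : TTE.IsComputableMetricSpace ν) {𝒴 : Set (Set X)} {δ : TTE.Naming (Set X)}
    (_hδ : TTE.IsRepresentation δ 𝒴) (hneg : TTE.Reducible δ (TTE.closedName ν))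
    (hγ_mem : ∀ x, ∀ Y ∈ 𝒴, insert x Y ∈ 𝒴)
    (hγ : (TTE.opAddPoint 𝒴).IsComputable (TTE.prodName (TTE.cauchyName ν) δ) δ)
    (hβ : (TTE.opBall 𝒴).IsComputable
      (TTE.prodName (TTE.cauchyName ν) (TTE.prodName TTE.natName δ)) (TTE.minCoverName ν)) :
    (TTE.RetractComputable ν 𝒴 δ ↔ TTE.UniformlyEffectivelyZeroDimensional ν 𝒴 δ) ∧
      [TTE.NComputable ν 𝒴 δ, TTE.MComputable ν 𝒴 δ, TTE.BComputable ν 𝒴 δ,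
        TTE.SComputable ν 𝒴 δ].TFAE := by
  refine ⟨⟨fun h => TTE.SComputable.of_MComputable hν
    (TTE.MComputable.of_RetractComputable hν hγ_mem hγ hβ h),
    TTE.RetractComputable.of_SComputable hν hneg⟩, ?_⟩
  tfae_have 4 → 1 := TTE.NComputable.of_SComputable hν hneg
  tfae_have 1 → 2 := TTE.MComputable.of_NComputable hν
  tfae_have 2 → 4 := TTE.SComputable.of_MComputable hν
  tfae_have 4 → 3 := TTE.BComputable.of_SComputable hν
  tfae_have 3 → 4 := TTE.SComputable.of_BComputable hν
  tfae_finish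

theorem mainTheorem3 {X : Type*} [MetricSpace X] (ν : ℕ → X)
    (hν : TTE.IsComputableMetricSpace ν)
    (𝒴 : Set (Set X)) (δ : TTE.Naming (Set X)) (hδ : TTE.IsRepresentation δ 𝒴)
    (h𝒴 : ∀ A ∈ 𝒴, IsClosed A ∧ HasSmallInductiveDimensionLE A 0)
    (hneg : TTE.Reducible δ (TTE.closedName ν))
    (hγ_mem : ∀ x, ∀ Y ∈ 𝒴, insert x Y ∈ 𝒴)
    (hγ : (TTE.opAddPoint 𝒴).IsComputable (TTE.prodName (TTE.cauchyName ν) δ) δ)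
    (hβ_mem : ∀ (x : X) (n : ℕ), ∀ Y ∈ 𝒴,
      IsCompact (Y ∩ Metric.closedBall x ((2 : ℝ)⁻¹ ^ n)))
    (hβ : (TTE.opBall 𝒴).IsComputable
      (TTE.prodName (TTE.cauchyName ν) (TTE.prodName TTE.natName δ)) (TTE.minCoverName ν)) :
    (TTE.RetractComputable ν 𝒴 δ ↔ TTE.UniformlyEffectivelyZeroDimensional ν 𝒴 δ) ∧
      [TTE.NComputable ν 𝒴 δ, TTE.MComputable ν 𝒴 δ, TTE.BComputable ν 𝒴 δ,
        TTE.SComputable ν 𝒴 δ].TFAE := by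
  exact mainTheorem3_general hν hδ hneg hγ_mem hγ hβ
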